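/- **Setting.** Let $p>0$ and $b<d$, and put $C=(0,p)\times(b,d)$ and $\Omega=\mathbb R\times(b,d)$. Let $q_0:\Omega\to\mathbb C$ be measurable, bounded and $p$-periodic in $x_1$, with $\operatorname{Re}q_0>0$ and $\operatorname{Im}q_0\ge 0$. Let $q:\mathbb R\to(0,\infty)$ be measurable, bounded and $2\pi$-periodic. For a wavenumber $k>0$ and an angle of incidence $\theta\in(-\pi/2,\pi/2)$ put $\hat\alpha=k\sin\theta$, $\beta=k\cos\theta$, $\alpha_n=\hat\alpha+2\pi n/p$ for $n\in\mathbb Z$, and $\beta_n=\sqrt{k^2-\alpha_n^2}$ if $\alpha_n^2\le k^2$, $\beta_n=i\sqrt{\alpha_n^2-k^2}$ otherwise. *Space.* $H^1_{\hat\alpha}(C)$ is the space of functions $u$ on $\Omega$ such that $e^{-i\hat\alpha x_1}u(x_1,x_2)$ is $p$-periodic in $x_1$, and such that $u$ and its first weak derivatives on $\Omega$ are square-integrable over $C$ (functions are identified if they agree almost everywhere in $C$). For $u\in H^1_{\hat\alpha}(C)$, the numbers $u_n(b)$ and $u_n(d)$ denote the coefficients $\frac1p\int_0^p f(x_1)e^{-i\alpha_nx_1}\,dx_1$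 of the traces $f=u(\cdot,b)$ and $f=u(\cdot,d)$, respectively. *Downward modes.* For $n\in\mathbb Z$ consider Hill's equation $$w''+(k^2q-\alpha_n^2)\,w=0\quad\text{on }\mathbb R,$$ where $w'$ is locally absolutely continuous and the equation holds almost everywhere. Let $w_{n,1},w_{n,2}$ be its solutions with $w_{n,1}(0)=w_{n,2}'(0)=1$ and $w_{n,1}'(0)=w_{n,2}(0)=0$. Let $W_n=\begin{pmatrix}w_{n,1}(2\pi)&w_{n,2}(2\pi)\\ w_{n,1}'(2\pi)&w_{n,2}'(2\pi)\end{pmatrix}$ and $\eta_n=\operatorname{tr}W_n$. A downward mode $u_n^-$ is a nontrivial solution of the form $u_n^-(t)=e^{mt}v(t)$ with $v$ being $2\pi$-periodic, where $m=\mu$ for some $\mu>0$ if $\eta_n>2$; $m=\mu+\frac i2$ for some $\mu>0$ if $\eta_n<-2$; $m=-i\vartheta$ for some $\vartheta\in(0,\frac12)$ if $|\eta_n|<2$; $m=0$ if $\eta_n=2$ and $W_n\ne I$; $m=\frac i2$ if $\eta_n=-2$ and $W_n\neq -I$. (If $W_n=\pm I$, no downward mode is defined.) *Variational problem.* Given downward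 modes $u_n^-$ with $u_n^-(b)\neq0$ for all $n\in\mathbb Z$, find $u\in H^1_{\hat\alpha}(C)$ such that $a(u,v)=F(v)$ for all $v\in H^1_{\hat\alpha}(C)$, where $$a(u,v)=\int_C\big(\nabla u\cdot\nabla\bar v-k^2q_0u\bar v\big)\,dx-p\sum_{n\in\mathbb Z}i\beta_n\,u_n(d)\overline{v_n(d)}+p\sum_{n\in\mathbb Z}\frac{(u_n^-)'(b)}{u_n^-(b)}\,u_n(b)\overline{v_n(b)},$$ $$F(v)=-\int_0^p2i\beta\,e^{i\hat\alpha x_1-i\beta d}\,\overline{v(x_1,d)}\,dx_1 .$$ The two sums are the boundary terms $-\int Tu\,\bar v\,ds$ on $x_2=d$ and $-\int T^-u\,\bar v\,ds$ on $x_2=b$ of the upward and downward Dirichlet-to-Neumann maps $T$ and $T^-$. **Theorem (Solvability at small wavenumbers).** There is $k_0>0$, depending only on $p,b,d,q_0,q$ and not on the direction of incidence, such that the following holds for every $\theta\in(-\pi/2,\pi/2)$ with $q(x_2)>\sin^2\theta$ for all $x_2\in(b-2\pi,b]$, and for every $k\in(0,k_0)$. Downward modes $u_n^-$ exist for all $n\in\mathbb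 Z$. For every choice of them, $u_n^-(b)\ne0$ for all $n$, the series in $a(u,v)$ converge absolutely for all $u,v\in H^1_{\hat\alpha}(C)$, and the variational problem has a unique solution $u\in H^1_{\hat\alpha}(C)$. -/

import Mathlib

open Set Filter Topology MeasureTheory
open scoped ContDiff ComplexConjugate

noncomputable section

namespace Grating

/-- The medium: a horizontally `p`-periodic grating layer `b < x₂ < d` of complex refractive
index `q₀`, below a homogeneous cover (index `1` for `x₂ > d`) and above a substrate `x₂ < b`
whose real index `q` depends on `x₂` only and is `2π`-periodic (`q` is given here as its
`2π`-periodic extension to the whole line). -/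
structure Medium where
  p : ℝ
  b : ℝ
  d : ℝ
  q₀ : ℝ × ℝ → ℂ
  q : ℝ → ℝ
  p_pos : 0 < p
  b_lt_d : b < d
  q₀_meas : AEStronglyMeasurable q₀ (volume.restrict (univ ×ˢ Ioo b d))
  q₀_periodic : ∀ x₁, ∀ x₂ ∈ Ioo b d, q₀ (x₁ + p, x₂) = q₀ (x₁, x₂)
  q₀_bounded : ∃ B : ℝ, ∀ x ∈ (univ ×ˢ Ioo b d : Set (ℝ × ℝ)), ‖q₀ x‖ ≤ B
  q₀_re : ∀ x ∈ (univ ×ˢ Ioo b d : Set (ℝ × ℝ)), 0 < (q₀ x).re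
  q₀_im : ∀ x ∈ (univ ×ˢ Ioo b d : Set (ℝ × ℝ)), 0 ≤ (q₀ x).im
  q_meas : AEStronglyMeasurable q volume
  q_periodic : Function.Periodic q (2 * Real.pi)
  q_bounded : ∃ B : ℝ, ∀ t, q t ≤ B
  q_pos : ∀ t, 0 < q t

/-! ### Wave numbers of the Fourier modes -/

/-- `α_n = k sin θ + 2πn/p`; in particular `α_0 = α̂` is the quasi-periodicity parameter. -/
def alpha (M : Medium) (k θ : ℝ) (n : ℤ) : ℝ :=
  k * Real.sin θ + 2 * Real.pi / M.p * n

/-- `β_n = √(k² - α_n²)` if `α_n² ≤ k²`, and `β_n = i √(α_n² - k²)` otherwise. -/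
def beta (M : Medium) (k θ : ℝ) (n : ℤ) : ℂ :=
  if alpha M k θ n ^ 2 ≤ k ^ 2 then (Real.sqrt (k ^ 2 - alpha M k θ n ^ 2) : ℂ)
  else Complex.I * (Real.sqrt (alpha M k θ n ^ 2 - k ^ 2) : ℂ)

/-! ### Hill's equation and the downward modes -/

/-- `w` solves `w'' + V w = 0` on `ℝ` in the Carathéodory sense: `w` is differentiable and `w'`
is an indefinite integral of `-V w`. -/
def IsHillSolution {E : Type*} [NormedAddCommGroup E] [NormedSpace ℝ E]
    (V : ℝ → ℝ) (w : ℝ → E) : Prop :=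
  Differentiable ℝ w ∧
    ∀ s t : ℝ, deriv w t - deriv w s = -∫ τ in s..t, V τ • w τ

/-- `w₁, w₂` are the (real) fundamental solutions of `w'' + V w = 0` normalised at `0`. -/
def IsFundamentalPair (V : ℝ → ℝ) (w₁ w₂ : ℝ → ℝ) : Prop :=
  IsHillSolution V w₁ ∧ w₁ 0 = 1 ∧ deriv w₁ 0 = 0 ∧
    IsHillSolution V w₂ ∧ w₂ 0 = 0 ∧ deriv w₂ 0 = 1

/-- The monodromy matrix over one period `2π`. -/
def monodromy (w₁ w₂ : ℝ → ℝ) : Matrix (Fin 2) (Fin 2) ℝ :=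
  !![w₁ (2 * Real.pi), w₂ (2 * Real.pi);
    deriv w₁ (2 * Real.pi), deriv w₂ (2 * Real.pi)]

/-- `u(t) = e^{m t} v(t)` with a `2π`-periodic function `v`. -/
def HasFloquetExponent (m : ℂ) (u : ℝ → ℂ) : Prop :=
  ∃ v : ℝ → ℂ, Function.Periodic v (2 * Real.pi) ∧ ∀ t : ℝ, u t = Complex.exp (m * t) * v t

/-- `u` is a downward mode of `w'' + V w = 0`, where `V` is real and `2π`-periodic: a nontrivial
solution whose Floquet form is prescribed by the trace `η` of the monodromy matrix. For `|η| > 2`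
it decays as `x₂ → -∞`, for `|η| < 2` it is the mode `e^{-i ϑ x₂} v(x₂)` with `0 < ϑ < 1/2`, and
for `η = ± 2` (with a non-diagonalisable monodromy matrix) it is the bounded mode. There is no
(scalar) downward mode if the monodromy matrix is `± 1`. -/
def IsDownwardMode (V : ℝ → ℝ) (u : ℝ → ℂ) : Prop :=
  IsHillSolution V u ∧ u ≠ 0 ∧
  ∃ w₁ w₂ : ℝ → ℝ, IsFundamentalPair V w₁ w₂ ∧
    ∃ η : ℝ, η = w₁ (2 * Real.pi) + deriv w₂ (2 * Real.pi) ∧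
      ((2 < η ∧ ∃ μ : ℝ, 0 < μ ∧ HasFloquetExponent μ u) ∨
       (η < -2 ∧ ∃ μ : ℝ, 0 < μ ∧ HasFloquetExponent (μ + Complex.I / 2) u) ∨
       (|η| < 2 ∧ ∃ ϑ ∈ Ioo (0 : ℝ) (1 / 2), HasFloquetExponent (-(Complex.I * ϑ)) u) ∨
       (η = 2 ∧ monodromy w₁ w₂ ≠ 1 ∧ HasFloquetExponent 0 u) ∨
       (η = -2 ∧ monodromy w₁ w₂ ≠ -1 ∧ HasFloquetExponent (Complex.I / 2) u))

/-- The potential `k² q(x₂) - α_n²` of the Hill equation for the `n`-th mode. -/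
def hillPotential (M : Medium) (k θ : ℝ) (n : ℤ) (t : ℝ) : ℝ :=
  k ^ 2 * M.q t - alpha M k θ n ^ 2

/-- A choice of one downward mode `u_n^-` for each `n`. -/
def IsDownwardModeFamily (M : Medium) (k θ : ℝ) (U : ℤ → ℝ → ℂ) : Prop :=
  ∀ n : ℤ, IsDownwardMode (hillPotential M k θ n) (U n)

/-! ### The quasi-periodic Sobolev space `H¹_α̂(C)` -/

/-- The infinite strip `Ω = ℝ × (b, d)`. -/
def strip (M : Medium) : Set (ℝ × ℝ) := univ ×ˢ Ioo M.b M.d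

/-- The periodic cell `C = (0, p) × (b, d)`. -/
def cell (M : Medium) : Set (ℝ × ℝ) := Ioo 0 M.p ×ˢ Ioo M.b M.d

/-- `u(x₁, x₂) e^{-i a x₁}` is `p`-periodic in `x₁` on the strip. -/
def IsQuasiPeriodic (M : Medium) (a : ℝ) (u : ℝ × ℝ → ℂ) : Prop :=
  ∀ x₂ ∈ Ioo M.b M.d,
    Function.Periodic (fun x₁ : ℝ => u (x₁, x₂) * Complex.exp (-(Complex.I * a * x₁))) M.p

/-- `g` is an `a`-quasi-periodic function in `L²(C)` that is the weak derivative of `u` on the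
strip in the direction `e`. -/
def IsWeakPartial (M : Medium) (a : ℝ) (e : ℝ × ℝ) (u g : ℝ × ℝ → ℂ) : Prop :=
  IsQuasiPeriodic M a g ∧ MemLp g 2 (volume.restrict (cell M)) ∧
    ∀ φ : ℝ × ℝ → ℂ, ContDiff ℝ ∞ φ → HasCompactSupport φ → tsupport φ ⊆ strip M →
      ∫ x, u x * fderiv ℝ φ x e = -∫ x, g x * φ x

/-- `u` belongs to `H¹_a(C)`: it is `a`-quasi-periodic on the strip, and it is square-integrable
on the cell together with its first weak derivatives. -/
def MemH1 (M : Medium) (a : ℝ) (u : ℝ × ℝ → ℂ) : Prop :=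
  IsQuasiPeriodic M a u ∧ MemLp u 2 (volume.restrict (cell M)) ∧
    (∃ g, IsWeakPartial M a (1, 0) u g) ∧ (∃ g, IsWeakPartial M a (0, 1) u g)

open Classical in
/-- The weak derivative of `u` in the direction `e` (unique up to null sets). -/
def weakPartial (M : Medium) (a : ℝ) (e : ℝ × ℝ) (u : ℝ × ℝ → ℂ) : ℝ × ℝ → ℂ :=
  if h : ∃ g, IsWeakPartial M a e u g then h.choose else 0

/-- `f ∈ L²(0, p)` is the trace of `u` on the horizontal line that the slabs
`(0, p) × I h` of height `h` approach as `h → 0+`: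
`(1/h) ∫_{(0,p) × I h} |u(x₁, x₂) - f(x₁)|² dx → 0`. -/
def IsTrace (M : Medium) (I : ℝ → Set ℝ) (u : ℝ × ℝ → ℂ) (f : ℝ → ℂ) : Prop :=
  MemLp f 2 (volume.restrict (Ioo 0 M.p)) ∧
    Tendsto (fun h : ℝ => h⁻¹ * ∫ x in Ioo 0 M.p ×ˢ I h, ‖u x - f x.1‖ ^ 2) (𝓝[>] 0) (𝓝 0)

open Classical in
/-- The trace `u(·, d)` on the upper side of the cell (unique up to null sets). -/
def topTrace (M : Medium) (u : ℝ × ℝ → ℂ) : ℝ → ℂ :=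
  if h : ∃ f, IsTrace M (fun h => Ioo (M.d - h) M.d) u f then h.choose else 0

open Classical in
/-- The trace `u(·, b)` on the lower side of the cell (unique up to null sets). -/
def bottomTrace (M : Medium) (u : ℝ × ℝ → ℂ) : ℝ → ℂ :=
  if h : ∃ f, IsTrace M (fun h => Ioo M.b (M.b + h)) u f then h.choose else 0

/-! ### DtN maps and the variational problem -/

/-- The coefficient `f_n = (1/p) ∫_0^p f(x₁) e^{-i α_n x₁} dx₁`. -/
def coeff (M : Medium) (k θ : ℝ) (f : ℝ → ℂ) (n : ℤ) : ℂ :=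
  (M.p : ℂ)⁻¹ * ∫ x in (0 : ℝ)..M.p, f x * Complex.exp (-(Complex.I * alpha M k θ n * x))

/-- The `n`-th term of `∫_Γ (𝒯 f) ḡ ds = ∑_n p τ_n f_n ḡ_n`, where `𝒯` is the Fourier multiplier
`∑ f_n e^{i α_n x₁} ↦ ∑ τ_n f_n e^{i α_n x₁}`. -/
def pairingTerm (M : Medium) (k θ : ℝ) (τ : ℤ → ℂ) (f g : ℝ → ℂ) (n : ℤ) : ℂ :=
  M.p * (τ n * coeff M k θ f n * conj (coeff M k θ g n))

/-- Multiplier of the upward DtN map `T` of the homogeneous cover. -/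
def upMultiplier (M : Medium) (k θ : ℝ) (n : ℤ) : ℂ := Complex.I * beta M k θ n

/-- Multiplier `-(u_n^-)'(b) / u_n^-(b)` of the downward DtN map `T⁻` of the substrate. -/
def downMultiplier (M : Medium) (U : ℤ → ℝ → ℂ) (n : ℤ) : ℂ := -(deriv (U n) M.b / U n M.b)

/-- The sesquilinear form
`a(u, v) = ∫_C (∇u · ∇v̄ - k² q₀ u v̄) dx - ∫_{Γ_d} (T u) v̄ ds - ∫_{Γ_b} (T⁻ u) v̄ ds`. -/
def form (M : Medium) (k θ : ℝ) (U : ℤ → ℝ → ℂ) (u v : ℝ × ℝ → ℂ) : ℂ :=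
  (∫ x in cell M,
    (weakPartial M (alpha M k θ 0) (1, 0) u x * conj (weakPartial M (alpha M k θ 0) (1, 0) v x)
      + weakPartial M (alpha M k θ 0) (0, 1) u x * conj (weakPartial M (alpha M k θ 0) (0, 1) v x)
      - (k : ℂ) ^ 2 * M.q₀ x * u x * conj (v x)))
  - ∑' n : ℤ, pairingTerm M k θ (upMultiplier M k θ) (topTrace M u) (topTrace M v) n
  - ∑' n : ℤ, pairingTerm M k θ (downMultiplier M U) (bottomTrace M u) (bottomTrace M v) n

/-- The right-hand side `F(v) = -∫_{Γ_d} 2iβ e^{i α̂ x₁ - i β d} v̄ ds`, with `β = k cos θ`,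
of the incident plane wave `e^{i α̂ x₁ - i β x₂}`. -/
def rhs (M : Medium) (k θ : ℝ) (v : ℝ × ℝ → ℂ) : ℂ :=
  ∫ x in (0 : ℝ)..M.p,
    -(2 * Complex.I * ((k * Real.cos θ : ℝ) : ℂ)
      * Complex.exp (Complex.I * ((k * Real.sin θ : ℝ) : ℂ) * x
          - Complex.I * ((k * Real.cos θ : ℝ) : ℂ) * M.d)
      * conj (topTrace M v x))

/-- `u ∈ H¹_α̂(C)` solves the variational problem `a(u, v) = F(v)` for all `v ∈ H¹_α̂(C)`. -/
def IsVariationalSolution (M : Medium) (k θ : ℝ) (U : ℤ → ℝ → ℂ) (u : ℝ × ℝ → ℂ) : Prop :=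
  MemH1 M (alpha M k θ 0) u ∧
    ∀ v, MemH1 M (alpha M k θ 0) v → form M k θ U u v = rhs M k θ v

end Grating

end

noncomputable section

namespace Grating

/-! ### Hill's equation: basic facts -/

section Hill

variable {E : Type*} [NormedAddCommGroup E] [NormedSpace ℝ E]

/-! The form itself need not be coercive, but for small `k` the form multiplied by `1 + iτ`, with a
suitable real `τ ≥ 0`, is; Lax–Milgram then gives existence and uniqueness at once, with no
compactness argument.

For `k < π/p` only the mode `n = 0` can propagate. If `n ≠ 0`, the upward multiplier is `-√(α_n² -
k²)`, and the Hill potential `k²q - α_n²` is negative, so the downward mode is a complex constant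
times a real growing solution and its multiplier is `-r` with `0 ≤ r ≤ |α_n|`
(`downwardMode_of_neg`). Both have the good sign, and the rotation leaves that sign alone. If `n =
0`, the potential `k²(q - sin² θ)` is positive and small, so the trace of the monodromy matrix lies
strictly between `-2` and `2`, and the logarithmic derivative of the downward mode has negative
imaginary part (`downwardMode_of_small`). Its real part has no known sign, but multiplication by `1
+ iτ` makes the imaginary part dominate. In the same way the upward multiplier `ik cos θ` turns into
a positive multiple of the squared zeroth coefficient on the upper side. That is the one quantity
Poincaré's inequality needs besides the gradient (`IsSobolevTriple.poincare`).

The volume term is not harmed: since `Im q₀ ≥ 0`, the real part of `(1 + iτ) q₀` never exceeds a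
bound of `|q₀|` (`re_rotated_volume_le`). The smallness required of `k` is therefore independent of
`τ`. Although `τ` depends on `k`, `θ` and the chosen modes, and may blow up at grazing incidence,
`k₀` does not depend on `θ` (`coercive_form`, `solvability`).

The analytic work lies in moving the problem to a Hilbert space. Triples of a function and its two
weak derivatives form a closed subspace of `L²(C)³` once the test functions are folded onto the
cell. Horizontal Fourier coefficients turn the weak relations into one-dimensional ones, which give
explicit end point values, the trace estimate with weight `|α_n| + 1`
(`IsSobolevTriple.endCoeff_le`), and the identification of the abstract traces
(`IsSobolevTriple.tendsto_trace`, `IsTrace.unique`). -/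

lemma intervalIntegrable_potential_smul {V : ℝ → ℝ} {m : ℝ} (hV : AEStronglyMeasurable V volume)
    (hm : ∀ t, |V t| ≤ m) {w : ℝ → E} (hw : Continuous w) (s t : ℝ) :
    IntervalIntegrable (fun τ => V τ • w τ) volume s t := by
  have h1 : IntervalIntegrable V volume s t := by
    refine (intervalIntegrable_const (c := m)).mono_fun hV.restrict ?_
    exact Eventually.of_forall fun x => by
      simpa using (hm x).trans (le_abs_self m)
  exact h1.smul_continuousOn hw.continuousOn

lemma IsHillSolution.continuous_deriv {V : ℝ → ℝ} {m : ℝ} (hV : AEStronglyMeasurable V volume)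
    (hm : ∀ t, |V t| ≤ m) {w : ℝ → E} (hw : IsHillSolution V w) : Continuous (deriv w) := by
  have h : deriv w = fun t => deriv w 0 - ∫ τ in (0 : ℝ)..t, V τ • w τ := by
    funext t
    have := hw.2 0 t
    rw [sub_eq_iff_eq_add] at this
    rw [this]; abel
  rw [h]
  exact continuous_const.sub (intervalIntegral.continuous_primitive
    (fun a b => intervalIntegrable_potential_smul hV hm hw.1.continuous a b) 0)

lemma IsHillSolution.sub_eq_integral [CompleteSpace E] {V : ℝ → ℝ} {m : ℝ}
    (hV : AEStronglyMeasurable V volume)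
    (hm : ∀ t, |V t| ≤ m) {w : ℝ → E} (hw : IsHillSolution V w) (s t : ℝ) :
    w t - w s = ∫ τ in s..t, deriv w τ :=
  (intervalIntegral.integral_deriv_eq_sub (fun x _ => hw.1 x)
    ((hw.continuous_deriv hV hm).intervalIntegrable _ _)).symm

/-- A priori bounds of a solution near `t₀` by its maximum there. -/
lemma IsHillSolution.exists_max_bound [CompleteSpace E] {V : ℝ → ℝ} {m : ℝ}
    (hV : AEStronglyMeasurable V volume)
    (hm : ∀ t, |V t| ≤ m) {w : ℝ → E} (hw : IsHillSolution V w) (t₀ : ℝ) {δ : ℝ} (hδ : 0 ≤ δ) :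
    ∃ S : ℝ, 0 ≤ S ∧ (∀ t, |t - t₀| ≤ δ → ‖w t‖ ≤ S) ∧
      S ≤ ‖w t₀‖ + δ * ‖deriv w t₀‖ + δ ^ 2 * m * S ∧
      (∀ t, |t - t₀| ≤ δ → ‖deriv w t - deriv w t₀‖ ≤ δ * m * S) ∧
      (∀ t, |t - t₀| ≤ δ → ‖w t - w t₀ - (t - t₀) • deriv w t₀‖ ≤ δ ^ 2 * m * S) := by
  have hm0 : 0 ≤ m := (abs_nonneg _).trans (hm 0)
  -- `S` is the attained maximum `‖w x‖`. Inserted into the integral equations for `w'` and then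
  -- `w`, it gives bounds that close up as soon as `δ² m < 1`.
  obtain ⟨x, hx, hmax⟩ := (isCompact_Icc (a := t₀ - δ) (b := t₀ + δ)).exists_isMaxOn
    ⟨t₀, by constructor <;> linarith⟩ (hw.1.continuous.norm.continuousOn)
  have hI : ∀ t, |t - t₀| ≤ δ ↔ t ∈ Icc (t₀ - δ) (t₀ + δ) := fun t => by
    rw [abs_le, mem_Icc]; constructor <;> rintro ⟨h1, h2⟩ <;> constructor <;> linarith
  have hS : ∀ t, |t - t₀| ≤ δ → ‖w t‖ ≤ ‖w x‖ := fun t ht => hmax ((hI t).1 ht)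
  have hsub : ∀ t, |t - t₀| ≤ δ → ∀ τ ∈ uIoc t₀ t, |τ - t₀| ≤ δ := fun t ht τ hτ => by
    rw [abs_le] at *
    rcases le_total t₀ t with h | h
    · rw [uIoc_of_le h] at hτ; constructor <;> linarith [hτ.1, hτ.2]
    · rw [uIoc_of_ge h] at hτ; constructor <;> linarith [hτ.1, hτ.2]
  have hd : ∀ t, |t - t₀| ≤ δ → ‖deriv w t - deriv w t₀‖ ≤ δ * m * ‖w x‖ := fun t ht => by
    rw [hw.2 t₀ t, norm_neg]
    refine (intervalIntegral.norm_integral_le_of_norm_le_const (C := m * ‖w x‖) ?_).trans ?_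
    · intro τ hτ
      rw [norm_smul]
      exact mul_le_mul (hm τ) (hS τ (hsub t ht τ hτ)) (norm_nonneg _) hm0
    · calc m * ‖w x‖ * |t - t₀| ≤ m * ‖w x‖ * δ := by gcongr
        _ = _ := by ring
  have hw2 : ∀ t, |t - t₀| ≤ δ →
      ‖w t - w t₀ - (t - t₀) • deriv w t₀‖ ≤ δ ^ 2 * m * ‖w x‖ := fun t ht => by
    have : w t - w t₀ - (t - t₀) • deriv w t₀ = ∫ τ in t₀..t, (deriv w τ - deriv w t₀) := by
      rw [intervalIntegral.integral_sub ((hw.continuous_deriv hV hm).intervalIntegrable _ _)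
        intervalIntegrable_const, ← hw.sub_eq_integral hV hm, intervalIntegral.integral_const]
    rw [this]
    refine (intervalIntegral.norm_integral_le_of_norm_le_const (C := δ * m * ‖w x‖) ?_).trans ?_
    · exact fun τ hτ => hd τ (hsub t ht τ hτ)
    · calc δ * m * ‖w x‖ * |t - t₀| ≤ δ * m * ‖w x‖ * δ := by gcongr
        _ = _ := by ring
  refine ⟨‖w x‖, norm_nonneg _, hS, ?_, hd, hw2⟩
  have h1 := hw2 x ((hI x).2 hx)
  have h2 : ‖(x - t₀) • deriv w t₀‖ ≤ δ * ‖deriv w t₀‖ := by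
    rw [norm_smul]; exact mul_le_mul_of_nonneg_right ((hI x).2 hx) (norm_nonneg _)
  have h3 : ‖w x‖ ≤ ‖w x - w t₀ - (x - t₀) • deriv w t₀‖ + ‖w t₀‖ + ‖(x - t₀) • deriv w t₀‖ := by
    have : w x = (w x - w t₀ - (x - t₀) • deriv w t₀) + w t₀ + (x - t₀) • deriv w t₀ := by abel
    conv_lhs => rw [this]
    exact norm_add₃_le
  linarith

/-- With zero Cauchy data the a priori bound reads `S ≤ δ² m S`, so `S = 0` once `δ² m < 1`. The
step `δ` is the same at every base point, so finitely many steps reach any `t`. -/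
lemma IsHillSolution.eq_zero [CompleteSpace E] {V : ℝ → ℝ} {m : ℝ}
    (hV : AEStronglyMeasurable V volume)
    (hm : ∀ t, |V t| ≤ m) {w : ℝ → E} (hw : IsHillSolution V w) {t₀ : ℝ} (h0 : w t₀ = 0)
    (h1 : deriv w t₀ = 0) : w = 0 := by
  have hm0 : 0 ≤ m := (abs_nonneg _).trans (hm 0)
  obtain ⟨δ, hδ, hδm⟩ : ∃ δ : ℝ, 0 < δ ∧ δ ^ 2 * m < 1 := by
    refine ⟨(m + 1)⁻¹, by positivity, ?_⟩
    rw [inv_pow, inv_mul_lt_one₀ (by positivity)]; nlinarith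
  have step : ∀ s, w s = 0 → deriv w s = 0 → ∀ t, |t - s| ≤ δ → w t = 0 ∧ deriv w t = 0 := by
    intro s hs hs' t ht
    obtain ⟨S, hS0, hS, hS1, hd, -⟩ := hw.exists_max_bound hV hm s hδ.le
    have : S = 0 := by
      rw [hs, hs'] at hS1
      simp only [norm_zero, mul_zero, add_zero, zero_add] at hS1
      nlinarith
    subst this
    have h2 := hS t ht
    have h3 := hd t ht
    rw [hs', sub_zero, mul_zero] at h3
    exact ⟨norm_le_zero_iff.1 h2, norm_le_zero_iff.1 h3⟩
  have all : ∀ n : ℕ, ∀ t, |t - t₀| ≤ n * δ → w t = 0 ∧ deriv w t = 0 := by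
    intro n
    induction n with
    | zero =>
      intro t ht
      have : t = t₀ := by
        have h2 : t - t₀ = 0 := by simpa using ht
        linarith
      rw [this]; exact ⟨h0, h1⟩
    | succ n ih =>
      intro t ht
      push_cast at ht
      have hn : (0 : ℝ) < n + 1 := by positivity
      -- The point at the fraction `n/(n+1)` of the way to `t` is within `n δ` of `t₀` and within
      -- `δ` of `t`.
      set s := t₀ + (n / (n + 1)) * (t - t₀) with hs
      have h2 : |s - t₀| ≤ n * δ := by
        have : s - t₀ = (n / (n + 1)) * (t - t₀) := by rw [hs]; ring
        rw [this, abs_mul, abs_of_nonneg (by positivity), div_mul_eq_mul_div, div_le_iff₀ hn]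
        nlinarith [Nat.cast_nonneg (α := ℝ) n]
      have h3 : |t - s| ≤ δ := by
        have : t - s = (t - t₀) / (n + 1) := by rw [hs]; field_simp; ring
        rw [this, abs_div, abs_of_pos hn, div_le_iff₀ hn]; linarith
      exact step s (ih s h2).1 (ih s h2).2 t h3
  funext t
  obtain ⟨n, hn⟩ := exists_nat_gt (|t - t₀| / δ)
  exact (all n t ((div_lt_iff₀ hδ).1 hn).le).1

lemma IsHillSolution.add {V : ℝ → ℝ} {m : ℝ} (hV : AEStronglyMeasurable V volume)
    (hm : ∀ t, |V t| ≤ m) {u w : ℝ → E} (hu : IsHillSolution V u) (hw : IsHillSolution V w) :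
    IsHillSolution V (fun t => u t + w t) := by
  refine ⟨hu.1.add hw.1, fun s t => ?_⟩
  rw [deriv_fun_add (hu.1 t) (hw.1 t), deriv_fun_add (hu.1 s) (hw.1 s), add_sub_add_comm,
    hu.2 s t, hw.2 s t]
  simp only [smul_add]
  rw [intervalIntegral.integral_add
    (intervalIntegrable_potential_smul hV hm hu.1.continuous _ _)
    (intervalIntegrable_potential_smul hV hm hw.1.continuous _ _)]
  abel

/-- Composition of a solution with a continuous linear map is a solution. -/
lemma IsHillSolution.clm_comp [CompleteSpace E] {F : Type*} [NormedAddCommGroup F]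
    [NormedSpace ℝ F] [CompleteSpace F] {V : ℝ → ℝ} {m : ℝ} (hV : AEStronglyMeasurable V volume)
    (hm : ∀ t, |V t| ≤ m) {u : ℝ → E} (hu : IsHillSolution V u) (L : E →L[ℝ] F) :
    IsHillSolution V (fun t => L (u t)) ∧ deriv (fun t => L (u t)) = fun t => L (deriv u t) := by
  have hd : ∀ t, HasDerivAt (fun t => L (u t)) (L (deriv u t)) t := fun t =>
    L.hasFDerivAt.comp_hasDerivAt t (hu.1 t).hasDerivAt
  refine ⟨⟨fun t => (hd t).differentiableAt, fun s t => ?_⟩, funext fun t => (hd t).deriv⟩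
  rw [(hd t).deriv, (hd s).deriv, ← map_sub, hu.2 s t, map_neg,
    ← L.intervalIntegral_comp_comm (intervalIntegrable_potential_smul hV hm hu.1.continuous _ _)]
  simp only [map_smul]

lemma IsHillSolution.comp_add_period {V : ℝ → ℝ} {T : ℝ} (hT : Function.Periodic V T)
    {u : ℝ → E} (hu : IsHillSolution V u) :
    IsHillSolution V (fun t => u (t + T)) ∧ ∀ t, deriv (fun t => u (t + T)) t = deriv u (t + T) := by
  have hd : ∀ t, deriv (fun t => u (t + T)) t = deriv u (t + T) := fun t =>
    deriv_comp_add_const u T t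
  refine ⟨⟨fun t => (hu.1 (t + T)).comp t (differentiableAt_id.add_const T), fun s t => ?_⟩, hd⟩
  rw [hd, hd, hu.2 (s + T) (t + T), ← intervalIntegral.integral_comp_add_right]
  simp only [hT _]

lemma IsHillSolution.eq_of_eq [CompleteSpace E] {V : ℝ → ℝ} {m : ℝ}
    (hV : AEStronglyMeasurable V volume)
    (hm : ∀ t, |V t| ≤ m) {u w : ℝ → E} (hu : IsHillSolution V u) (hw : IsHillSolution V w)
    {t₀ : ℝ} (h0 : u t₀ = w t₀) (h1 : deriv u t₀ = deriv w t₀) : u = w := by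
  obtain ⟨h2, h3⟩ := hw.clm_comp hV hm (-(ContinuousLinearMap.id ℝ E))
  have h4 := (hu.add hV hm h2).eq_zero hV hm (t₀ := t₀) (by simp [h0]) (by
    rw [deriv_fun_add (hu.1 t₀) (h2.1 t₀), h3, h1]; simp)
  funext t
  have := congrFun h4 t
  simpa [add_neg_eq_zero] using this

end Hill

/-! ### Existence of solutions -/

/-- Each integration gains a factor `1/lam` in the exponentially weighted sup norm. Two of them make
the Picard map of a second-order equation a contraction on the whole line. -/
lemma norm_integral_le_exp_abs {lam C : ℝ} (hl : 0 < lam) (hC : 0 ≤ C) {f : ℝ → ℝ}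
    (hf : ∀ r, ‖f r‖ ≤ C * Real.exp (lam * |r|)) (t : ℝ) :
    ‖∫ r in (0 : ℝ)..t, f r‖ ≤ C / lam * Real.exp (lam * |t|) := by
  have key : ∀ g : ℝ → ℝ, (∀ r, ‖g r‖ ≤ C * Real.exp (lam * |r|)) → ∀ s, 0 ≤ s →
      ‖∫ r in (0 : ℝ)..s, g r‖ ≤ C / lam * Real.exp (lam * |s|) := by
    intro g hg s hs
    have h1 : ‖∫ r in (0 : ℝ)..s, g r‖ ≤ ∫ r in (0 : ℝ)..s, C * Real.exp (lam * r) := by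
      refine intervalIntegral.norm_integral_le_of_norm_le hs ?_
        (Continuous.intervalIntegrable (by fun_prop) _ _)
      refine Eventually.of_forall fun r hr => ?_
      simpa [abs_of_pos hr.1] using hg r
    refine h1.trans ?_
    rw [intervalIntegral.integral_const_mul, show (∫ r in (0:ℝ)..s, Real.exp (lam * r)) = (Real.exp (lam * s) - Real.exp (lam * 0)) / lam by
      rw [intervalIntegral.integral_comp_mul_left Real.exp hl.ne', integral_exp, smul_eq_mul]; ring, abs_of_nonneg hs]
    rw [mul_zero, Real.exp_zero, div_mul_eq_mul_div, mul_div_assoc]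
    gcongr
    linarith
  rcases le_total 0 t with ht | ht
  · exact key f hf t ht
  · have h2 := key (fun r => f (-r)) (fun r => by simpa using hf (-r)) (-t) (by linarith)
    rw [abs_neg] at h2
    have h3 : ∫ r in (0 : ℝ)..(-t), f (-r) = ∫ r in t..0, f r := by
      rw [intervalIntegral.integral_comp_neg]; simp
    rw [h3, intervalIntegral.integral_symm, norm_neg] at h2
    exact h2

/-- Carathéodory existence for Hill's equation with bounded measurable potential. -/
lemma exists_isHillSolution {V : ℝ → ℝ} {m : ℝ} (hV : AEStronglyMeasurable V volume)
    (hm : ∀ t, |V t| ≤ m) (A B : ℝ) :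
    ∃ w : ℝ → ℝ, IsHillSolution V w ∧ w 0 = A ∧ deriv w 0 = B := by
  have hm0 : 0 ≤ m := (abs_nonneg _).trans (hm 0)
  -- Any weight with `m / lam² ≤ 1/2` would do; this number is the contraction constant of `K`
  -- below.
  set lam : ℝ := 2 * m + 1 with hlam
  have hl : 0 < lam := by positivity
  have hcontr : m / lam / lam ≤ 1 / 2 := by
    rw [div_div, div_le_div_iff₀ (by positivity) (by norm_num)]; nlinarith
  -- The unknown is the bounded function `z = e^{-lam |t|} w`, and `W` undoes the weight. A single
  -- fixed point then gives a global solution, without gluing local ones.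
  let W : (BoundedContinuousFunction ℝ ℝ) → ℝ → ℝ := fun z t => Real.exp (lam * |t|) * z t
  have hWc : ∀ z, Continuous (W z) := fun z => by
    have := z.continuous
    simp only [W]; fun_prop
  have hint : ∀ z s t, IntervalIntegrable (fun r => V r • W z r) volume s t := fun z s t =>
    intervalIntegrable_potential_smul hV hm (hWc z) s t
  let N : (BoundedContinuousFunction ℝ ℝ) → ℝ → ℝ := fun z s => ∫ r in (0 : ℝ)..s, V r • W z r
  have hNc : ∀ z, Continuous (N z) := fun z => intervalIntegral.continuous_primitive (hint z) 0
  let P : (BoundedContinuousFunction ℝ ℝ) → ℝ → ℝ := fun z t => ∫ s in (0 : ℝ)..t, N z s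
  have hPd : ∀ z t, HasDerivAt (P z) (N z t) t := fun z t =>
    intervalIntegral.integral_hasDerivAt_right ((hNc z).intervalIntegrable _ _)
      (hNc z).stronglyMeasurable.stronglyMeasurableAtFilter (hNc z).continuousAt
  have hPc : ∀ z, Continuous (P z) := fun z =>
    continuous_iff_continuousAt.2 fun t => (hPd z t).continuousAt
  have hsub : ∀ z z' t, P z t - P z' t = P (z - z') t := by
    intro z z' t
    have h1 : ∀ s, N (z - z') s = N z s - N z' s := fun s => by
      simp only [N]
      rw [← intervalIntegral.integral_sub (hint z _ _) (hint z' _ _)]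
      congr 1; funext r
      simp only [W, BoundedContinuousFunction.coe_sub, Pi.sub_apply, smul_eq_mul]; ring
    simp only [P, h1]
    rw [intervalIntegral.integral_sub ((hNc z).intervalIntegrable _ _)
      ((hNc z').intervalIntegrable _ _)]
  have hPb : ∀ z t, ‖P z t‖ ≤ m / lam / lam * ‖z‖ * Real.exp (lam * |t|) := by
    intro z t
    have h1 : ∀ s, ‖N z s‖ ≤ m * ‖z‖ / lam * Real.exp (lam * |s|) := by
      refine norm_integral_le_exp_abs hl (by positivity) fun r => ?_
      rw [norm_smul, norm_mul, Real.norm_of_nonneg (Real.exp_pos _).le, mul_comm (Real.exp _),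
        ← mul_assoc]
      gcongr
      · exact hm r
      · exact z.norm_coe_le_norm r
    refine (norm_integral_le_exp_abs hl (by positivity) h1 t).trans (le_of_eq ?_)
    ring
  have hexp : ∀ t : ℝ, Real.exp (-(lam * |t|)) * Real.exp (lam * |t|) = 1 := fun t => by
    rw [← Real.exp_add]; simp
  have hlin : ∀ t : ℝ, Real.exp (-(lam * |t|)) * |t| ≤ 1 / lam := fun t => by
    have h1 : lam * |t| ≤ Real.exp (lam * |t|) := by linarith [Real.add_one_le_exp (lam * |t|)]
    rw [Real.exp_neg, inv_mul_le_iff₀ (Real.exp_pos _), mul_one_div, le_div_iff₀ hl]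
    linarith
  let K : (BoundedContinuousFunction ℝ ℝ) → (BoundedContinuousFunction ℝ ℝ) := fun z =>
    BoundedContinuousFunction.ofNormedAddCommGroup
      (fun t => Real.exp (-(lam * |t|)) * (A + B * t - P z t))
      (by have := hPc z; fun_prop) (|A| + |B| * (1 / lam) + m / lam / lam * ‖z‖) (by
        intro t
        rw [norm_mul, Real.norm_of_nonneg (Real.exp_pos _).le]
        have h0 : Real.exp (-(lam * |t|)) ≤ 1 := Real.exp_le_one_iff.2 (by
          have := abs_nonneg t; nlinarith)
        have h1 : ‖A + B * t - P z t‖ ≤ |A| + |B| * |t| + ‖P z t‖ := by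
          refine (norm_sub_le _ _).trans ?_
          gcongr
          refine (norm_add_le _ _).trans ?_
          rw [norm_mul]; simp
        calc _ ≤ Real.exp (-(lam * |t|)) * (|A| + |B| * |t| +
              m / lam / lam * ‖z‖ * Real.exp (lam * |t|)) := by
              gcongr; exact h1.trans (by gcongr; exact hPb z t)
          _ = Real.exp (-(lam * |t|)) * |A| + |B| * (Real.exp (-(lam * |t|)) * |t|)
              + m / lam / lam * ‖z‖ * (Real.exp (-(lam * |t|)) * Real.exp (lam * |t|)) := by ring
          _ ≤ 1 * |A| + |B| * (1 / lam) + m / lam / lam * ‖z‖ * 1 := by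
              rw [hexp]; gcongr; exact hlin t
          _ = _ := by ring)
  have hK : ContractingWith (1 / 2 : NNReal) K := by
    refine ⟨by rw [← NNReal.coe_lt_coe]; norm_num, LipschitzWith.of_dist_le_mul fun z z' => ?_⟩
    rw [dist_eq_norm, dist_eq_norm, BoundedContinuousFunction.norm_le (by positivity)]
    intro t
    have : (K z - K z') t = - (Real.exp (-(lam * |t|)) * P (z - z') t) := by
      rw [← hsub]
      simp only [K, BoundedContinuousFunction.coe_sub, Pi.sub_apply,
        BoundedContinuousFunction.coe_ofNormedAddCommGroup]
      ring
    rw [this, norm_neg, norm_mul, Real.norm_of_nonneg (Real.exp_pos _).le]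
    calc _ ≤ Real.exp (-(lam * |t|)) * (m / lam / lam * ‖z - z'‖ * Real.exp (lam * |t|)) := by
            gcongr; exact hPb _ _
      _ = m / lam / lam * ‖z - z'‖ * (Real.exp (-(lam * |t|)) * Real.exp (lam * |t|)) := by ring
      _ ≤ _ := by
            rw [hexp, mul_one]; push_cast; gcongr
  obtain ⟨z, hz⟩ : ∃ z, K z = z := ⟨_, hK.fixedPoint_isFixedPt⟩
  have hw : ∀ t, W z t = A + B * t - P z t := fun t => by
    have h1 : z t = Real.exp (-(lam * |t|)) * (A + B * t - P z t) := by
      conv_lhs => rw [← hz]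
      rfl
    simp only [W]
    rw [h1, ← mul_assoc, mul_comm (Real.exp (lam * |t|)), hexp, one_mul]
  have hd : ∀ t, HasDerivAt (W z) (B - N z t) t := fun t => by
    have h1 : W z = fun t => A + B * t - P z t := funext hw
    rw [h1]
    have h2 := ((hasDerivAt_id t).const_mul B).const_add A
    have h3 : HasDerivAt (fun t => A + B * t - P z t) (B * 1 - N z t) t := h2.sub (hPd z t)
    rwa [mul_one] at h3
  refine ⟨W z, ⟨fun t => (hd t).differentiableAt, fun s t => ?_⟩, ?_, ?_⟩
  · rw [(hd t).deriv, (hd s).deriv]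
    have := intervalIntegral.integral_add_adjacent_intervals (hint z 0 s) (hint z s t)
    simp only [N]
    rw [← this]; ring
  · rw [hw]; simp [P]
  · rw [(hd 0).deriv]; simp [N]

lemma exists_isFundamentalPair {V : ℝ → ℝ} {m : ℝ} (hV : AEStronglyMeasurable V volume)
    (hm : ∀ t, |V t| ≤ m) : ∃ w₁ w₂, IsFundamentalPair V w₁ w₂ := by
  obtain ⟨w₁, h1, h2, h3⟩ := exists_isHillSolution hV hm 1 0
  obtain ⟨w₂, h4, h5, h6⟩ := exists_isHillSolution hV hm 0 1
  exact ⟨w₁, w₂, h1, h2, h3, h4, h5, h6⟩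

/-! ### Energy identities for real solutions -/

/-- The second derivative of a solution exists only almost everywhere, so the product rule is taken
from absolute continuity of indefinite integrals. All energy identities below are instances. -/
lemma mul_sub_mul_eq_integral {f g f' g' : ℝ → ℝ} (hf' : ∀ s t, IntervalIntegrable f' volume s t)
    (hg' : ∀ s t, IntervalIntegrable g' volume s t) (hf : ∀ s t, f t - f s = ∫ τ in s..t, f' τ)
    (hg : ∀ s t, g t - g s = ∫ τ in s..t, g' τ) (s t : ℝ) :
    f t * g t - f s * g s = ∫ τ in s..t, (f' τ * g τ + f τ * g' τ) := by
  have ac : ∀ {h h' : ℝ → ℝ}, (∀ s t, IntervalIntegrable h' volume s t) →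
      (∀ s t, h t - h s = ∫ τ in s..t, h' τ) → AbsolutelyContinuousOnInterval h s t ∧
        ∀ᵐ x, x ∈ uIcc s t → deriv h x = h' x := by
    intro h h' hh' hh
    have e : h = fun x => h s + ∫ τ in s..x, h' τ := funext fun x => by rw [← hh]; ring
    constructor
    · rw [e]
      exact (LipschitzOnWith.absolutelyContinuousOnInterval (K := 0)
        ((LipschitzWith.const (h s)).lipschitzOnWith)).add
        ((hh' s t).absolutelyContinuousOnInterval_intervalIntegral left_mem_uIcc)
    · filter_upwards [(hh' s t).ae_hasDerivAt_integral] with x hx hx'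
      rw [e]
      exact ((hx hx' s left_mem_uIcc).const_add (h s)).deriv
  obtain ⟨a1, a2⟩ := ac hf' hf
  obtain ⟨b1, b2⟩ := ac hg' hg
  rw [← a1.integral_deriv_mul_eq_sub b1]
  refine intervalIntegral.integral_congr_ae ?_
  filter_upwards [a2, b2] with x hx hx' hxm
  rw [hx (uIoc_subset_uIcc hxm), hx' (uIoc_subset_uIcc hxm)]

section Real

variable {V : ℝ → ℝ} {m : ℝ} (hV : AEStronglyMeasurable V volume) (hm : ∀ t, |V t| ≤ m)
include hV hm

lemma IsHillSolution.mul_deriv_sub {y z : ℝ → ℝ} (hy : IsHillSolution V y)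
    (hz : IsHillSolution V z) (s t : ℝ) :
    y t * deriv z t - y s * deriv z s = ∫ τ in s..t, (deriv y τ * deriv z τ - V τ * y τ * z τ) := by
  rw [mul_sub_mul_eq_integral (f' := deriv y) (g' := fun τ => -(V τ • z τ))
    (fun s t => (hy.continuous_deriv hV hm).intervalIntegrable _ _)
    (fun s t => (intervalIntegrable_potential_smul hV hm hz.1.continuous _ _).neg)
    (hy.sub_eq_integral hV hm)
    (fun s t => by rw [intervalIntegral.integral_neg]; exact hz.2 s t)]
  congr 1; funext τ; simp only [smul_eq_mul]; ring

lemma IsHillSolution.sq_sub {y : ℝ → ℝ} (hy : IsHillSolution V y) (s t : ℝ) :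
    y t ^ 2 - y s ^ 2 = ∫ τ in s..t, 2 * (y τ * deriv y τ) := by
  rw [sq, sq, mul_sub_mul_eq_integral (f' := deriv y) (g' := deriv y)
    (fun s t => (hy.continuous_deriv hV hm).intervalIntegrable _ _)
    (fun s t => (hy.continuous_deriv hV hm).intervalIntegrable _ _)
    (hy.sub_eq_integral hV hm) (hy.sub_eq_integral hV hm)]
  congr 1; funext τ; ring

lemma IsHillSolution.deriv_sq_sub {y : ℝ → ℝ} (hy : IsHillSolution V y) (s t : ℝ) :
    deriv y t ^ 2 - deriv y s ^ 2 = ∫ τ in s..t, -(2 * V τ * (y τ * deriv y τ)) := by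
  have h1 := fun s t => (intervalIntegrable_potential_smul hV hm hy.1.continuous s t).neg
  have h2 : ∀ s t, deriv y t - deriv y s = ∫ τ in s..t, -(V τ • y τ) := fun s t => by
    rw [intervalIntegral.integral_neg]; exact hy.2 s t
  rw [sq, sq, mul_sub_mul_eq_integral (f' := fun τ => -(V τ • y τ)) (g' := fun τ => -(V τ • y τ))
    h1 h1 h2 h2]
  congr 1; funext τ; simp only [smul_eq_mul]; ring

/-- The integrand in `IsHillSolution.mul_deriv_sub` is symmetric in the two solutions, so `y z'` and
`z y'` have the same increments. -/
lemma IsHillSolution.wronskian_eq {y z : ℝ → ℝ} (hy : IsHillSolution V y)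
    (hz : IsHillSolution V z) (s t : ℝ) :
    y t * deriv z t - z t * deriv y t = y s * deriv z s - z s * deriv y s := by
  have h1 := hy.mul_deriv_sub hV hm hz s t
  have h2 := hz.mul_deriv_sub hV hm hy s t
  have h3 : ∫ τ in s..t, (deriv y τ * deriv z τ - V τ * y τ * z τ) =
      ∫ τ in s..t, (deriv z τ * deriv y τ - V τ * z τ * y τ) := by
    congr 1; funext τ; ring
  linarith

/-! ### Negative potentials -/

lemma IsHillSolution.mul_deriv_mono (hneg : ∀ t, V t ≤ 0) {y : ℝ → ℝ} (hy : IsHillSolution V y) :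
    Monotone fun t => y t * deriv y t := by
  intro s t hst
  have h := hy.mul_deriv_sub hV hm hy s t
  have h2 : 0 ≤ ∫ τ in s..t, (deriv y τ * deriv y τ - V τ * y τ * y τ) :=
    intervalIntegral.integral_nonneg hst fun τ _ => by
      nlinarith [mul_self_nonneg (deriv y τ), mul_nonneg (neg_nonneg.2 (hneg τ))
        (mul_self_nonneg (y τ))]
  show y s * deriv y s ≤ y t * deriv y t
  linarith

/-- To the right of `0` both products `w w'` are nonnegative, so `w₁²` and `(w₂')²` stay above their
initial value `1`, and continuity rules out a jump to the negative branch. Strictness comes from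
`w₁' ≥ c t`, which pushes `w₁(2π)` beyond `1`. -/
lemma trace_gt_two_of_neg {c : ℝ} (hc : 0 < c) (hneg : ∀ t, V t ≤ -c) {w₁ w₂ : ℝ → ℝ}
    (h : IsFundamentalPair V w₁ w₂) : 2 < w₁ (2 * Real.pi) + deriv w₂ (2 * Real.pi) := by
  obtain ⟨h1, h10, h10', h2, h20, h20'⟩ := h
  have hpi := Real.pi_pos
  have hneg' : ∀ t, V t ≤ 0 := fun t => (hneg t).trans (by linarith)
  have g1 : ∀ t, 0 ≤ t → 0 ≤ w₁ t * deriv w₁ t := fun t ht => by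
    have := h1.mul_deriv_mono hV hm hneg' ht
    simpa [h10'] using this
  have g2 : ∀ t, 0 ≤ t → 0 ≤ w₂ t * deriv w₂ t := fun t ht => by
    have := h2.mul_deriv_mono hV hm hneg' ht
    simpa [h20] using this
  have ge_one : ∀ f : ℝ → ℝ, Continuous f → f 0 = 1 → (∀ t, 0 ≤ t → 1 ≤ f t ^ 2) →
      ∀ t, 0 ≤ t → 1 ≤ f t := by
    intro f hf hf0 hf1 t ht
    by_contra! hlt
    have h3 := hf1 t ht
    have h4 : f t ≤ -1 := by nlinarith
    obtain ⟨x, hx, hx0⟩ : (0 : ℝ) ∈ f '' Icc 0 t :=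
      intermediate_value_Icc' ht hf.continuousOn ⟨by linarith, by linarith⟩
    have := hf1 x hx.1
    rw [hx0] at this; norm_num at this
  have w1ge : ∀ t, 0 ≤ t → 1 ≤ w₁ t := by
    refine ge_one w₁ h1.1.continuous h10 fun t ht => ?_
    have := h1.sq_sub hV hm 0 t
    have h4 : 0 ≤ ∫ τ in (0 : ℝ)..t, 2 * (w₁ τ * deriv w₁ τ) :=
      intervalIntegral.integral_nonneg ht fun τ hτ => by linarith [g1 τ hτ.1]
    rw [h10] at this; linarith
  have w2ge : ∀ t, 0 ≤ t → 1 ≤ deriv w₂ t := by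
    refine ge_one _ (h2.continuous_deriv hV hm) h20' fun t ht => ?_
    have := h2.deriv_sq_sub hV hm 0 t
    have h4 : 0 ≤ ∫ τ in (0 : ℝ)..t, -(2 * V τ * (w₂ τ * deriv w₂ τ)) :=
      intervalIntegral.integral_nonneg ht fun τ hτ => by
        nlinarith [mul_nonneg (neg_nonneg.2 (hneg' τ)) (g2 τ hτ.1)]
    rw [h20'] at this; linarith
  have w1' : ∀ t, 0 ≤ t → c * t ≤ deriv w₁ t := fun t ht => by
    have h3 := h1.2 0 t
    rw [h10', sub_zero, ← intervalIntegral.integral_neg] at h3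
    have h4 : ∫ _ in (0 : ℝ)..t, c ≤ ∫ τ in (0 : ℝ)..t, -(V τ • w₁ τ) := by
      refine intervalIntegral.integral_mono_on ht intervalIntegrable_const
        (intervalIntegrable_potential_smul hV hm h1.1.continuous _ _).neg fun τ hτ => ?_
      rw [smul_eq_mul]
      nlinarith [w1ge τ hτ.1, hneg τ]
    rw [intervalIntegral.integral_const, sub_zero, smul_eq_mul] at h4
    linarith
  have h5 : 1 < w₁ (2 * Real.pi) := by
    have h3 := h1.sub_eq_integral hV hm 0 (2 * Real.pi)
    have h4 : ∫ t in (0 : ℝ)..(2 * Real.pi), c * t ≤ ∫ t in (0 : ℝ)..(2 * Real.pi), deriv w₁ t :=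
      intervalIntegral.integral_mono_on (by positivity)
        (Continuous.intervalIntegrable (by fun_prop) _ _)
        ((h1.continuous_deriv hV hm).intervalIntegrable _ _) fun t ht => w1' t ht.1
    rw [intervalIntegral.integral_const_mul, integral_id] at h4
    have : 0 < c * (((2 * Real.pi) ^ 2 - 0 ^ 2) / 2) := by
      rw [zero_pow two_ne_zero, sub_zero]; positivity
    rw [h10] at h3
    linarith
  linarith [w2ge (2 * Real.pi) (by positivity)]

/-- Growing Floquet solutions of a real Hill equation with negative potential. -/
lemma IsHillSolution.growing_bounds {κ ρ T : ℝ} (hneg : ∀ t, V t ≤ 0)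
    (hκ : ∀ t, -V t ≤ κ ^ 2) (hT : 0 < T) (hρ : 1 < ρ) {y : ℝ → ℝ} (hy : IsHillSolution V y)
    (hper : ∀ t, y (t + T) = ρ * y t) (hper' : ∀ t, deriv y (t + T) = ρ * deriv y t) (t : ℝ) :
    0 ≤ y t * deriv y t ∧ deriv y t ^ 2 ≤ κ ^ 2 * y t ^ 2 := by
  -- The monotone function `y y'` is multiplied by `ρ² > 1` over a period, so it cannot be negative.
  have g0 : ∀ t, 0 ≤ y t * deriv y t := fun t => by
    have h1 := hy.mul_deriv_mono hV hm hneg (show t ≤ t + T by linarith)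
    simp only [hper, hper'] at h1
    have h2 : 0 ≤ (ρ ^ 2 - 1) * (y t * deriv y t) := by linarith
    exact nonneg_of_mul_nonneg_right h2 (by nlinarith)
  refine ⟨g0 t, ?_⟩
  -- Pointwise `(y'²)' = -2V y y' ≤ κ² (y²)'`. Over one period both increments equal `ρ² - 1` times
  -- the values at `t`, which turns the integrated inequality into a pointwise one.
  have h1 := hy.deriv_sq_sub hV hm t (t + T)
  have h2 := hy.sq_sub hV hm t (t + T)
  have h3 : ∫ τ in t..(t + T), -(2 * V τ * (y τ * deriv y τ)) ≤
      ∫ τ in t..(t + T), κ ^ 2 * (2 * (y τ * deriv y τ)) := by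
    have hc : Continuous fun τ => y τ * deriv y τ := hy.1.continuous.mul (hy.continuous_deriv hV hm)
    refine intervalIntegral.integral_mono_on (by linarith) ?_
      (Continuous.intervalIntegrable (by fun_prop) _ _) fun τ _ => ?_
    · have := (intervalIntegrable_potential_smul hV hm hc t (t + T)).const_mul (-2)
      refine this.congr fun τ _ => ?_
      simp only [smul_eq_mul]; ring
    · nlinarith [mul_le_mul_of_nonneg_right (hκ τ) (g0 τ)]
  rw [intervalIntegral.integral_const_mul, ← h1, ← h2, hper, hper'] at h3
  have h4 : 0 ≤ (ρ ^ 2 - 1) * (κ ^ 2 * y t ^ 2 - deriv y t ^ 2) := by linarith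
  linarith [nonneg_of_mul_nonneg_right h4 (by nlinarith)]

/-! ### Small potentials -/

/-- With `δ = 2π` the hypothesis says `δ² m ≤ 1/3`. Hence `S ≤ 1 + S/3`, so `S ≤ 3/2`, and `y`
deviates from `1` by at most `S/3 ≤ 1/2`. -/
lemma IsHillSolution.half_le_of_small (hsmall : 12 * Real.pi ^ 2 * m ≤ 1) {y : ℝ → ℝ}
    (hy : IsHillSolution V y) {t₀ : ℝ} (h0 : y t₀ = 1) (h0' : deriv y t₀ = 0) :
    ∀ t, |t - t₀| ≤ 2 * Real.pi → 1 / 2 ≤ y t := by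
  intro t ht
  have hm0 : 0 ≤ m := (abs_nonneg _).trans (hm 0)
  obtain ⟨S, hS0, -, hS1, -, hd⟩ := hy.exists_max_bound hV hm t₀ (δ := 2 * Real.pi)
    (by positivity)
  have h1 := hd t ht
  rw [h0, h0'] at *
  simp only [norm_one, norm_zero, mul_zero, add_zero, smul_zero, sub_zero] at hS1 h1
  have h2 : (2 * Real.pi) ^ 2 * m * S ≤ S / 3 := by nlinarith
  rw [Real.norm_eq_abs, abs_le] at h1
  linarith

/-- Now `S ≤ 2π + S/3` gives `S ≤ 3π`, and `y'` deviates from `1` by at most `2π m · 3π = 6π² m ≤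
1/2`; this is where the constant `12` is used up. In particular a solution vanishing at `t₀` has no
further zero within one period to the right. -/
lemma IsHillSolution.half_le_deriv_of_small (hsmall : 12 * Real.pi ^ 2 * m ≤ 1) {y : ℝ → ℝ}
    (hy : IsHillSolution V y) {t₀ : ℝ} (h0 : y t₀ = 0) (h0' : deriv y t₀ = 1) :
    (∀ t, |t - t₀| ≤ 2 * Real.pi → 1 / 2 ≤ deriv y t) ∧
      ∀ t, t₀ ≤ t → t ≤ t₀ + 2 * Real.pi → (t - t₀) / 2 ≤ y t := by
  have hm0 : 0 ≤ m := (abs_nonneg _).trans (hm 0)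
  have hpi := Real.pi_pos
  obtain ⟨S, hS0, -, hS1, hd, -⟩ := hy.exists_max_bound hV hm t₀ (δ := 2 * Real.pi)
    (by positivity)
  have key : ∀ t, |t - t₀| ≤ 2 * Real.pi → 1 / 2 ≤ deriv y t := by
    intro t ht
    have h1 := hd t ht
    rw [h0, h0'] at *
    simp only [norm_one, norm_zero, mul_one, zero_add] at hS1
    have h2 : (2 * Real.pi) ^ 2 * m * S ≤ S / 3 := by nlinarith
    have h3 : S ≤ 3 * Real.pi := by linarith
    have h4 : 2 * Real.pi * m * S ≤ 1 / 2 := by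
      have : 2 * Real.pi * m * S ≤ 2 * Real.pi * m * (3 * Real.pi) := by gcongr
      nlinarith
    rw [Real.norm_eq_abs, abs_le] at h1
    linarith
  refine ⟨key, fun t ht ht' => ?_⟩
  have h1 := hy.sub_eq_integral hV hm t₀ t
  have h2 : ∫ _ in t₀..t, (1 / 2 : ℝ) ≤ ∫ τ in t₀..t, deriv y τ :=
    intervalIntegral.integral_mono_on ht intervalIntegrable_const
      ((hy.continuous_deriv hV hm).intervalIntegrable _ _) fun τ hτ => key τ (by
        rw [abs_le]; constructor <;> linarith [hτ.1, hτ.2])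
  rw [intervalIntegral.integral_const, smul_eq_mul] at h2
  linarith

/-- Smallness keeps both diagonal entries of the monodromy matrix above `1/2`. Positivity of `V`
bounds them from above: `w₁` cannot increase while it is positive, and `w₂'` drops strictly below
`1` because `w₂ > 0` inside the period. -/
lemma abs_trace_lt_two_of_small (hsmall : 12 * Real.pi ^ 2 * m ≤ 1) (hpos : ∀ t, 0 < V t)
    {w₁ w₂ : ℝ → ℝ} (h : IsFundamentalPair V w₁ w₂) :
    |w₁ (2 * Real.pi) + deriv w₂ (2 * Real.pi)| < 2 := by
  obtain ⟨h1, h10, h10', h2, h20, h20'⟩ := h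
  have hpi := Real.pi_pos
  have e1 := h1.half_le_of_small hV hm hsmall h10 h10'
  obtain ⟨e2, e3⟩ := h2.half_le_deriv_of_small hV hm hsmall h20 h20'
  have habs : ∀ t, 0 ≤ t → t ≤ 2 * Real.pi → |t - 0| ≤ 2 * Real.pi := fun t h h' => by
    rw [sub_zero, abs_of_nonneg h]; exact h'
  have a1 := e1 (2 * Real.pi) (habs _ (by positivity) le_rfl)
  have a2 := e2 (2 * Real.pi) (habs _ (by positivity) le_rfl)
  have w1' : ∀ t ∈ Icc 0 (2 * Real.pi), deriv w₁ t ≤ 0 := fun t ht => by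
    have h3 := h1.2 0 t
    have h4 : 0 ≤ ∫ τ in (0 : ℝ)..t, V τ • w₁ τ :=
      intervalIntegral.integral_nonneg ht.1 fun τ hτ => by
        have := e1 τ (habs τ hτ.1 (hτ.2.trans ht.2))
        rw [smul_eq_mul]
        exact mul_nonneg (hpos τ).le (by linarith)
    linarith
  have b1 : w₁ (2 * Real.pi) ≤ 1 := by
    have h3 := h1.sub_eq_integral hV hm 0 (2 * Real.pi)
    have h4 : 0 ≤ ∫ τ in (0 : ℝ)..(2 * Real.pi), -deriv w₁ τ :=
      intervalIntegral.integral_nonneg (by positivity) fun τ hτ => by linarith [w1' τ hτ]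
    rw [intervalIntegral.integral_neg] at h4
    linarith
  have b2 : deriv w₂ (2 * Real.pi) < 1 := by
    have h3 := h2.2 0 (2 * Real.pi)
    have h4 : 0 < ∫ τ in (0 : ℝ)..(2 * Real.pi), V τ • w₂ τ :=
      intervalIntegral.intervalIntegral_pos_of_pos_on
        (intervalIntegrable_potential_smul hV hm h2.1.continuous _ _) (fun τ hτ => by
        have := e3 τ hτ.1.le (by linarith [hτ.2])
        have h5 := hτ.1
        exact mul_pos (hpos τ) (by linarith)) (by positivity)
    linarith
  rw [abs_lt]; constructor <;> linarith

end Real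

/-! ### Downward modes -/

lemma HasFloquetExponent.add_period {m : ℂ} {u : ℝ → ℂ} (h : HasFloquetExponent m u) (t : ℝ) :
    u (t + 2 * Real.pi) = Complex.exp (2 * Real.pi * m) * u t := by
  obtain ⟨v, hv, hu⟩ := h
  rw [hu, hu, hv, ← mul_assoc, ← Complex.exp_add]
  congr 2; push_cast; ring

lemma hasFloquetExponent_of_add_period {m : ℂ} {u : ℝ → ℂ}
    (h : ∀ t, u (t + 2 * Real.pi) = Complex.exp (2 * Real.pi * m) * u t) :
    HasFloquetExponent m u := by
  refine ⟨fun t => Complex.exp (-(m * t)) * u t, fun t => ?_, fun t => ?_⟩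
  · simp only
    rw [h, ← mul_assoc, ← Complex.exp_add]
    congr 2; push_cast; ring
  · rw [← mul_assoc, ← Complex.exp_add]; simp

section Modes

variable {V : ℝ → ℝ} {m : ℝ} (hV : AEStronglyMeasurable V volume) (hm : ∀ t, |V t| ≤ m)
include hV hm

lemma IsHillSolution.re {U : ℝ → ℂ} (hU : IsHillSolution V U) :
    IsHillSolution V (fun t => (U t).re) ∧
      deriv (fun t => (U t).re) = fun t => (deriv U t).re :=
  hU.clm_comp hV hm Complex.reCLM

lemma IsHillSolution.im {U : ℝ → ℂ} (hU : IsHillSolution V U) :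
    IsHillSolution V (fun t => (U t).im) ∧
      deriv (fun t => (U t).im) = fun t => (deriv U t).im :=
  hU.clm_comp hV hm Complex.imCLM

lemma IsFundamentalPair.exists_linearComb {w₁ w₂ : ℝ → ℝ} (h : IsFundamentalPair V w₁ w₂)
    (a b : ℂ) : IsHillSolution V (fun t => w₁ t * a + w₂ t * b) ∧
      ∀ t, deriv (fun t => w₁ t * a + w₂ t * b) t = deriv w₁ t * a + deriv w₂ t * b := by
  obtain ⟨h1, -, -, h2, -, -⟩ := h
  obtain ⟨a1, a2⟩ := h1.clm_comp hV hm ((ContinuousLinearMap.id ℝ ℝ).smulRight a)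
  obtain ⟨b1, b2⟩ := h2.clm_comp hV hm ((ContinuousLinearMap.id ℝ ℝ).smulRight b)
  have e : (fun t => (w₁ t : ℂ) * a + w₂ t * b) = fun t =>
      ((ContinuousLinearMap.id ℝ ℝ).smulRight a) (w₁ t) +
        ((ContinuousLinearMap.id ℝ ℝ).smulRight b) (w₂ t) := by
    funext t; simp
  refine ⟨e ▸ a1.add hV hm b1, fun t => ?_⟩
  rw [e, deriv_fun_add (a1.1 t) (b1.1 t), a2, b2]
  simp

/-- By constancy of the Wronskian the monodromy matrix has determinant one, so the hypothesis is its
characteristic equation at `e^{2π m'}`. An eigenvector serves as Cauchy data at `0`. The translate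
by `2π` and the multiple `ρ U` then have the same Cauchy data, hence agree. -/
lemma IsFundamentalPair.exists_floquet (hper : Function.Periodic V (2 * Real.pi)) {w₁ w₂ : ℝ → ℝ}
    (h : IsFundamentalPair V w₁ w₂) {m' : ℂ}
    (hρ : Complex.exp (2 * Real.pi * m') ^ 2
      - ((w₁ (2 * Real.pi) + deriv w₂ (2 * Real.pi) : ℝ) : ℂ) * Complex.exp (2 * Real.pi * m')
      + 1 = 0) :
    ∃ U : ℝ → ℂ, IsHillSolution V U ∧ U ≠ 0 ∧ HasFloquetExponent m' U := by
  obtain ⟨h1, h10, h10', h2, h20, h20'⟩ := id h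
  set ρ := Complex.exp (2 * Real.pi * m') with hρdef
  have hW := h1.wronskian_eq hV hm h2 0 (2 * Real.pi)
  rw [h10, h10', h20, h20'] at hW
  have hWc : (w₁ (2 * Real.pi) : ℂ) * deriv w₂ (2 * Real.pi)
      - w₂ (2 * Real.pi) * deriv w₁ (2 * Real.pi) = 1 := by
    have : ((w₁ (2 * Real.pi) * deriv w₂ (2 * Real.pi)
      - w₂ (2 * Real.pi) * deriv w₁ (2 * Real.pi) : ℝ) : ℂ) = 1 := by rw [hW]; norm_num
    exact_mod_cast this
  push_cast at hρ
  obtain ⟨x, hx, hx0⟩ := Matrix.exists_mulVec_eq_zero_iff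
    (M := !![(w₁ (2 * Real.pi) : ℂ) - ρ, (w₂ (2 * Real.pi) : ℂ);
      ((deriv w₁ (2 * Real.pi) : ℝ) : ℂ), ((deriv w₂ (2 * Real.pi) : ℝ) : ℂ) - ρ]).2 (by
      rw [Matrix.det_fin_two_of]; linear_combination hWc + hρ)
  have hx1 := congrFun hx0 0
  have hx2 := congrFun hx0 1
  simp [Matrix.mulVec, dotProduct, Fin.sum_univ_two] at hx1 hx2
  obtain ⟨hU, hU'⟩ := h.exists_linearComb hV hm (x 0) (x 1)
  set U : ℝ → ℂ := fun t => w₁ t * x 0 + w₂ t * x 1 with hUdef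
  have hU0 : U 0 = x 0 := by simp [hUdef, h10, h20]
  have hU0' : deriv U 0 = x 1 := by rw [hU']; simp [h10', h20']
  refine ⟨U, hU, ?_, hasFloquetExponent_of_add_period fun t => ?_⟩
  · intro h0
    apply hx
    funext i
    fin_cases i
    · simpa [h0] using hU0.symm
    · simpa [h0] using hU0'.symm
  · obtain ⟨a1, a2⟩ := hU.comp_add_period hper
    obtain ⟨b1, b2⟩ := hU.clm_comp hV hm (ρ • ContinuousLinearMap.id ℝ ℂ)
    have := a1.eq_of_eq hV hm b1 (t₀ := 0)
      (by
        simp only [zero_add, hU0]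
        simp only [hUdef, _root_.smul_apply, ContinuousLinearMap.id_apply, smul_eq_mul]
        linear_combination hx1)
      (by
        rw [a2, b2]
        simp only [zero_add, hU0', hU', _root_.smul_apply, ContinuousLinearMap.id_apply, smul_eq_mul]
        linear_combination hx2)
    have := congrFun this t
    simpa using this

/-- Since the trace exceeds `2`, only the first alternative in the definition of a mode can hold,
with a real multiplier `ρ > 1`. The real and imaginary parts are both growing solutions. Their
Wronskian is constant and also multiplied by `ρ²` over a period, so it vanishes. Thus the
logarithmic derivative is real, and `IsHillSolution.growing_bounds` locates it in `[0, κ]`. -/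
lemma downwardMode_of_neg (hper : Function.Periodic V (2 * Real.pi)) {c κ : ℝ} (hc : 0 < c)
    (hneg : ∀ t, V t ≤ -c) (hκ0 : 0 ≤ κ) (hκ : ∀ t, -V t ≤ κ ^ 2) :
    (∃ U, IsDownwardMode V U) ∧ ∀ U, IsDownwardMode V U → ∀ t, U t ≠ 0 ∧
      ∃ r : ℝ, 0 ≤ r ∧ r ≤ κ ∧ deriv U t / U t = r := by
  have hpi := Real.pi_pos
  constructor
  · obtain ⟨w₁, w₂, hw⟩ := exists_isFundamentalPair hV hm
    have hη := trace_gt_two_of_neg hV hm hc hneg hw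
    set η := w₁ (2 * Real.pi) + deriv w₂ (2 * Real.pi) with hηdef
    -- The larger root of `R² - η R + 1 = 0`, which belongs to the solution decaying downwards; `μ =
    -- log R / 2π`.
    set R := (η + Real.sqrt (η ^ 2 - 4)) / 2 with hR
    have hs : Real.sqrt (η ^ 2 - 4) ^ 2 = η ^ 2 - 4 := Real.sq_sqrt (by nlinarith)
    have hs0 := Real.sqrt_nonneg (η ^ 2 - 4)
    have hR1 : 1 < R := by rw [hR]; linarith
    have hRη : R ^ 2 - η * R + 1 = 0 := by rw [hR]; nlinarith
    have hexp : Complex.exp (2 * Real.pi * ((Real.log R / (2 * Real.pi) : ℝ) : ℂ)) = (R : ℂ) := by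
      have h1 : (2 * Real.pi * ((Real.log R / (2 * Real.pi) : ℝ) : ℂ)) = ((Real.log R : ℝ) : ℂ) := by
        rw [← Complex.ofReal_ofNat, ← Complex.ofReal_mul, ← Complex.ofReal_mul]
        congr 1; field_simp
      rw [h1, ← Complex.ofReal_exp, Real.exp_log (by linarith)]
    obtain ⟨U, hU, hU0, hF⟩ := hw.exists_floquet hV hm hper
      (m' := ((Real.log R / (2 * Real.pi) : ℝ) : ℂ)) (by
        rw [hexp, ← hηdef]; exact_mod_cast hRη)
    exact ⟨U, hU, hU0, w₁, w₂, hw, η, rfl, Or.inl ⟨hη, _,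
      div_pos (Real.log_pos hR1) (by positivity), hF⟩⟩
  · rintro U ⟨hU, hU0, w₁, w₂, hw, η, hηdef, hcases⟩ t
    have hη := trace_gt_two_of_neg hV hm hc hneg hw
    rw [← hηdef] at hη
    obtain ⟨μ, hμ, hF⟩ : ∃ μ : ℝ, 0 < μ ∧ HasFloquetExponent μ U := by
      rcases hcases with h | h | h | h | h
      · exact h.2
      · linarith [h.1]
      · linarith [h.1, le_abs_self η]
      · linarith [h.1]
      · linarith [h.1]
    have hρ : 1 < Real.exp (2 * Real.pi * μ) := Real.one_lt_exp_iff.2 (by positivity)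
    set ρ := Real.exp (2 * Real.pi * μ) with hρdef
    have hUp : ∀ t, U (t + 2 * Real.pi) = ρ * U t := fun t => by
      rw [hF.add_period, hρdef]; push_cast; rfl
    have hUp' : ∀ t, deriv U (t + 2 * Real.pi) = ρ * deriv U t := fun t => by
      rw [← (hU.comp_add_period hper).2, funext hUp, deriv_const_mul _ (hU.1 t)]
    obtain ⟨hr, hr'⟩ := hU.re hV hm
    obtain ⟨hi, hi'⟩ := hU.im hV hm
    have hneg' : ∀ t, V t ≤ 0 := fun t => (hneg t).trans (by linarith)
    obtain ⟨r1, r2⟩ := hr.growing_bounds hV hm hneg' hκ (by positivity) hρ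
      (T := 2 * Real.pi) (fun t => by simp [hUp]) (fun t => by simp [hr', hUp']) t
    obtain ⟨i1, i2⟩ := hi.growing_bounds hV hm hneg' hκ (by positivity) hρ
      (T := 2 * Real.pi) (fun t => by simp [hUp]) (fun t => by simp [hi', hUp']) t
    have wr := hr.wronskian_eq hV hm hi t (t + 2 * Real.pi)
    simp only [hr', hi', hUp, hUp'] at r1 r2 i1 i2 wr
    simp only [Complex.re_ofReal_mul, Complex.im_ofReal_mul] at wr
    have wr0 : (U t).re * (deriv U t).im - (U t).im * (deriv U t).re = 0 := by
      have : (ρ ^ 2 - 1) * ((U t).re * (deriv U t).im - (U t).im * (deriv U t).re) = 0 := by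
        linarith
      exact (mul_eq_zero.1 this).resolve_left (by nlinarith)
    -- The bound `y'² ≤ κ² y²` for both parts means that a zero of `U` would be a zero of `U'` as
    -- well.
    have hne : U t ≠ 0 := by
      intro h0
      rw [h0] at r2 i2
      simp only [Complex.zero_re, Complex.zero_im] at r2 i2
      have e1 : (deriv U t).re = 0 := by nlinarith
      have e2 : (deriv U t).im = 0 := by nlinarith
      exact hU0 (hU.eq_zero hV hm h0 (Complex.ext e1 e2))
    have hn : 0 < Complex.normSq (U t) := Complex.normSq_pos.2 hne
    have hn' : Complex.normSq (U t) = (U t).re ^ 2 + (U t).im ^ 2 := by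
      rw [Complex.normSq_apply]; ring
    refine ⟨hne, ((U t).re * (deriv U t).re + (U t).im * (deriv U t).im) / Complex.normSq (U t),
      div_nonneg (by linarith) hn.le, ?_, ?_⟩
    · rw [div_le_iff₀ hn]
      have hsq : ((U t).re * (deriv U t).re + (U t).im * (deriv U t).im) ^ 2
          ≤ (κ * Complex.normSq (U t)) ^ 2 := by
        -- Lagrange's identity; the vanishing Wronskian makes Cauchy–Schwarz an equality.
        have e : ((U t).re * (deriv U t).re + (U t).im * (deriv U t).im) ^ 2
          = ((deriv U t).re ^ 2 + (deriv U t).im ^ 2) * Complex.normSq (U t) := by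
          rw [hn']
          linear_combination (-((U t).re * (deriv U t).im - (U t).im * (deriv U t).re)) * wr0
        rw [e, mul_pow, sq (Complex.normSq (U t)), ← mul_assoc]
        refine mul_le_mul_of_nonneg_right ?_ hn.le
        rw [hn']; linarith
      exact le_of_sq_le_sq hsq (by positivity)
    · rw [div_eq_iff hne]
      apply Complex.ext
      · rw [Complex.re_ofReal_mul, div_mul_eq_mul_div, eq_div_iff hn.ne', hn']
        linear_combination (-(U t).im) * wr0
      · rw [Complex.im_ofReal_mul, div_mul_eq_mul_div, eq_div_iff hn.ne', hn']
        linear_combination (U t).re * wr0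

/-- For the sign, consider the real solution `z = Im(conj(U t₀) U)`, which vanishes at `t₀`. The
multiplier `e^{-2πiϑ}` with `2πϑ ∈ (0, π)` gives `z(t₀ + 2π) = -sin(2πϑ) |U t₀|² < 0`. By smallness
of the potential, `z` does not return to zero within a period, so `z(t₀ + 2π)` has the sign of
`z'(t₀)`. Hence `Im(conj(U t₀) U'(t₀)) < 0`. -/
lemma downwardMode_of_small (hper : Function.Periodic V (2 * Real.pi))
    (hsmall : 12 * Real.pi ^ 2 * m ≤ 1) (hpos : ∀ t, 0 < V t) :
    (∃ U, IsDownwardMode V U) ∧ ∀ U, IsDownwardMode V U → ∀ t, U t ≠ 0 ∧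
      (deriv U t / U t).im < 0 := by
  have hpi := Real.pi_pos
  constructor
  · obtain ⟨w₁, w₂, hw⟩ := exists_isFundamentalPair hV hm
    have hη := abs_trace_lt_two_of_small hV hm hsmall hpos hw
    set η := w₁ (2 * Real.pi) + deriv w₂ (2 * Real.pi) with hηdef
    have hη' := abs_lt.1 hη
    -- The multipliers are `e^{±iφ}` with `φ ∈ (0, π)`; the downward choice is `e^{-iφ}`, that is `ϑ
    -- = φ / 2π`.
    set φ := Real.arccos (η / 2) with hφ
    have hcos : Real.cos φ = η / 2 := Real.cos_arccos (by linarith) (by linarith)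
    have hφ0 : 0 < φ := Real.arccos_pos.2 (by linarith)
    have hφ1 : φ < Real.pi := by
      refine lt_of_le_of_ne (Real.arccos_le_pi _) fun h => ?_
      rw [hφ, Real.arccos_eq_pi] at h; linarith
    have hexp : Complex.exp (2 * Real.pi * (-(Complex.I * ((φ / (2 * Real.pi) : ℝ) : ℂ))))
        = Real.cos φ - Real.sin φ * Complex.I := by
      have : (2 * Real.pi * (-(Complex.I * ((φ / (2 * Real.pi) : ℝ) : ℂ)))) =
          ((-φ : ℝ) : ℂ) * Complex.I := by
        have : (Real.pi : ℂ) ≠ 0 := by exact_mod_cast hpi.ne'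
        push_cast; field_simp
      rw [this, Complex.exp_mul_I, ← Complex.ofReal_cos, ← Complex.ofReal_sin, Real.cos_neg,
        Real.sin_neg]
      push_cast; ring
    obtain ⟨U, hU, hU0, hF⟩ := hw.exists_floquet hV hm hper
      (m' := -(Complex.I * ((φ / (2 * Real.pi) : ℝ) : ℂ))) (by
        have h1 : (η : ℂ) = 2 * Real.cos φ := by rw [hcos]; push_cast; ring
        have h2 : (Real.cos φ : ℂ) ^ 2 + (Real.sin φ : ℂ) ^ 2 = 1 := by
          exact_mod_cast Real.cos_sq_add_sin_sq φ
        rw [hexp, ← hηdef, h1]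
        linear_combination (-1 : ℂ) * h2 + (Real.sin φ : ℂ) ^ 2 * Complex.I_sq)
    refine ⟨U, hU, hU0, w₁, w₂, hw, η, rfl, Or.inr (Or.inr (Or.inl ⟨hη, _, ⟨?_, ?_⟩, hF⟩))⟩
    · positivity
    · rw [div_lt_div_iff₀ (by positivity) (by norm_num)]; linarith
  · rintro U ⟨hU, hU0, w₁, w₂, hw, η, hηdef, hcases⟩ t₀
    have hη := abs_trace_lt_two_of_small hV hm hsmall hpos hw
    rw [← hηdef] at hη
    have hη' := abs_lt.1 hη
    obtain ⟨ϑ, hϑ, hF⟩ : ∃ ϑ ∈ Ioo (0 : ℝ) (1 / 2), HasFloquetExponent (-(Complex.I * ϑ)) U := by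
      rcases hcases with h | h | h | h | h
      · linarith [h.1]
      · linarith [h.1]
      · exact h.2
      · linarith [h.1]
      · linarith [h.1]
    have hsin : 0 < Real.sin (2 * Real.pi * ϑ) :=
      Real.sin_pos_of_pos_of_lt_pi (by have := hϑ.1; positivity) (by nlinarith [hϑ.2])
    have hUp : U (t₀ + 2 * Real.pi) =
        (Real.cos (2 * Real.pi * ϑ) - Real.sin (2 * Real.pi * ϑ) * Complex.I) * U t₀ := by
      rw [hF.add_period]
      congr 1
      have : (2 * Real.pi * -(Complex.I * ϑ) : ℂ) = ((-(2 * Real.pi * ϑ) : ℝ) : ℂ) * Complex.I := by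
        push_cast; ring
      rw [this, Complex.exp_mul_I, ← Complex.ofReal_cos, ← Complex.ofReal_sin, Real.cos_neg,
        Real.sin_neg]
      push_cast; ring
    -- a real solution vanishing at `t₀` does not vanish at `t₀ + 2π`
    have disc : ∀ (c : ℂ), (c * U t₀).im = 0 →
        ∃ g : ℝ, 0 < g ∧ (c * U (t₀ + 2 * Real.pi)).im = (c * deriv U t₀).im * g := by
      intro c h0
      obtain ⟨z1, z2⟩ := hU.clm_comp hV hm (Complex.imCLM.comp (c • ContinuousLinearMap.id ℝ ℂ))
      simp only [ContinuousLinearMap.comp_apply, _root_.smul_apply,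
        ContinuousLinearMap.id_apply, smul_eq_mul, Complex.imCLM_apply] at z1 z2
      set B := (c * deriv U t₀).im with hB
      have hz2 : deriv (fun t => (c * U t).im) t₀ = B := congrFun z2 t₀
      rcases eq_or_ne B 0 with hB0 | hB0
      · refine ⟨1, one_pos, ?_⟩
        have := z1.eq_zero hV hm h0 (hz2.trans hB0)
        have := congrFun this (t₀ + 2 * Real.pi)
        rw [hB0, zero_mul]; exact this
      · obtain ⟨y1, y2⟩ := z1.clm_comp hV hm (B⁻¹ • ContinuousLinearMap.id ℝ ℝ)
        simp only [_root_.smul_apply,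
          ContinuousLinearMap.id_apply, smul_eq_mul] at y1 y2
        have := (y1.half_le_deriv_of_small hV hm hsmall (t₀ := t₀) (by simp [h0])
          (by rw [y2]; simp only [hz2]; exact inv_mul_cancel₀ hB0)).2 (t₀ + 2 * Real.pi)
          (by linarith) le_rfl
        refine ⟨B⁻¹ * (c * U (t₀ + 2 * Real.pi)).im, lt_of_lt_of_le ?_ this, ?_⟩
        · rw [add_sub_cancel_left]; positivity
        · rw [mul_inv_cancel_left₀ hB0]
    -- If `U t₀ = 0`, the Floquet relation gives `U (t₀ + 2π) = 0`, and `disc` with `c = 1` and `c =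
    -- i` kills both parts of `U'(t₀)`.
    have hne : U t₀ ≠ 0 := by
      intro h0
      obtain ⟨g1, hg1, e1⟩ := disc 1 (by simp [h0])
      obtain ⟨g2, hg2, e2⟩ := disc Complex.I (by simp [h0])
      rw [hUp, h0] at e1 e2
      simp [hg1.ne', hg2.ne'] at e1 e2
      exact hU0 (hU.eq_zero hV hm h0 (Complex.ext e2 e1))
    refine ⟨hne, ?_⟩
    have hn : 0 < Complex.normSq (U t₀) := Complex.normSq_pos.2 hne
    obtain ⟨g, hg, e⟩ := disc (conj (U t₀)) (by
      rw [mul_comm, Complex.mul_conj, Complex.ofReal_im])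
    rw [hUp, mul_left_comm, mul_comm (conj (U t₀)), Complex.mul_conj, Complex.im_mul_ofReal] at e
    simp only [Complex.sub_im, Complex.ofReal_im, Complex.mul_I_im, Complex.ofReal_re] at e
    have h1 : (conj (U t₀) * deriv U t₀).im < 0 := by
      by_contra! h2
      have := mul_nonneg h2 hg.le
      have := mul_pos hsin hn
      linarith
    have h2 : deriv U t₀ / U t₀ = (conj (U t₀) * deriv U t₀) / (Complex.normSq (U t₀) : ℂ) := by
      rw [← Complex.mul_conj]
      have : conj (U t₀) ≠ 0 := by simpa using hne
      field_simp
    rw [h2, Complex.div_ofReal_im]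
    exact div_neg_of_neg_of_pos h1 hn

end Modes

/-! ### One-dimensional Sobolev functions -/

/-- Cauchy–Schwarz against the constant `1`; the source of the Hölder bounds of order `1/2` for the
Fourier modes. -/
lemma sq_norm_integral_le {b d : ℝ} {g : ℝ → ℂ} (hg : MemLp g 2 (volume.restrict (Ioo b d)))
    {s t : ℝ} (hs : s ∈ Icc b d) (ht : t ∈ Icc b d) :
    ‖∫ τ in s..t, g τ‖ ^ 2 ≤ |t - s| * ∫ τ in Ioo b d, ‖g τ‖ ^ 2 := by
  wlog hst : s ≤ t generalizing s t
  · rw [intervalIntegral.integral_symm, norm_neg, abs_sub_comm]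
    exact this ht hs (le_of_not_ge hst)
  rw [intervalIntegral.integral_of_le hst, integral_Ioc_eq_integral_Ioo]
  have hsub : Ioo s t ⊆ Ioo b d := Ioo_subset_Ioo hs.1 ht.2
  have hg1 : MemLp g 2 (volume.restrict (Ioo s t)) := hg.mono_measure (Measure.restrict_mono hsub le_rfl)
  have h1 : ∫ τ in Ioo s t, ‖g τ‖ * 1 ≤ (∫ τ in Ioo s t, ‖g τ‖ ^ (2 : ℝ)) ^ (1 / (2 : ℝ)) *
      (∫ τ in Ioo s t, (1 : ℝ) ^ (2 : ℝ)) ^ (1 / (2 : ℝ)) := by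
    refine integral_mul_le_Lp_mul_Lq_of_nonneg (by constructor <;> norm_num)
      (Eventually.of_forall fun _ => norm_nonneg _) (Eventually.of_forall fun _ => zero_le_one) ?_ ?_
    · simpa using hg1.norm
    · simpa using memLp_const (1 : ℝ)
  have h2 : ‖∫ τ in Ioo s t, g τ‖ ≤ ∫ τ in Ioo s t, ‖g τ‖ * 1 := by
    simpa using norm_integral_le_integral_norm g
  have h3 := h2.trans h1
  have hA : 0 ≤ ∫ τ in Ioo s t, ‖g τ‖ ^ 2 := integral_nonneg fun _ => by positivity
  have h4 : ∫ τ in Ioo s t, ‖g τ‖ ^ 2 ≤ ∫ τ in Ioo b d, ‖g τ‖ ^ 2 :=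
    setIntegral_mono_set (hg.integrable_norm_pow (by norm_num))
      (Eventually.of_forall fun _ => by positivity) hsub.eventuallyLE
  simp only [Real.rpow_two, one_pow, integral_const, MeasurableSet.univ, measureReal_restrict_apply,
    univ_inter, Real.volume_real_Ioo_of_le hst, smul_eq_mul, mul_one] at h3
  rw [← Real.mul_rpow hA (by linarith), ← Real.sqrt_eq_rpow] at h3
  calc ‖∫ τ in Ioo s t, g τ‖ ^ 2 ≤ Real.sqrt ((∫ τ in Ioo s t, ‖g τ‖ ^ 2) * (t - s)) ^ 2 := by gcongr
    _ = (∫ τ in Ioo s t, ‖g τ‖ ^ 2) * (t - s) := Real.sq_sqrt (mul_nonneg hA (by linarith))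
    _ ≤ (∫ τ in Ioo b d, ‖g τ‖ ^ 2) * (t - s) := by
      have : 0 ≤ t - s := by linarith
      gcongr
    _ = _ := by rw [abs_of_nonneg (by linarith)]; ring

lemma complex_mul_sub_mul_eq_integral {F F' : ℝ → ℂ} {g g' : ℝ → ℝ}
    (hF' : ∀ s t, IntervalIntegrable F' volume s t) (hg' : ∀ s t, IntervalIntegrable g' volume s t)
    (hF : ∀ s t, F t - F s = ∫ τ in s..t, F' τ)
    (hg : ∀ s t, g t - g s = ∫ τ in s..t, g' τ) (s t : ℝ) :
    F t * g t - F s * g s = ∫ τ in s..t, (F' τ * g τ + F τ * g' τ) := by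
  have cont : ∀ {E : Type} [NormedAddCommGroup E] [NormedSpace ℝ E] {h h' : ℝ → E},
      (∀ s t, IntervalIntegrable h' volume s t) →
      (∀ s t, h t - h s = ∫ τ in s..t, h' τ) → Continuous h := by
    intro E _ _ h h' hh' hh
    have : h = fun t => h 0 + ∫ τ in (0 : ℝ)..t, h' τ := funext fun t => by rw [← hh]; abel
    rw [this]
    exact continuous_const.add (intervalIntegral.continuous_primitive hh' 0)
  have hFc := cont hF' hF
  have hgc := cont hg' hg
  have hint : IntervalIntegrable (fun τ => F' τ * g τ + F τ * g' τ) volume s t := by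
    refine IntervalIntegrable.add ?_ ?_
    · exact (hF' s t).mul_continuousOn (Complex.continuous_ofReal.comp hgc).continuousOn
    · refine IntervalIntegrable.continuousOn_mul ?_ hFc.continuousOn
      exact ⟨(hg' s t).1.ofReal, (hg' s t).2.ofReal⟩
  have hre := mul_sub_mul_eq_integral (f := fun τ => (F τ).re) (f' := fun τ => (F' τ).re)
    (fun s t => ⟨(hF' s t).1.re, (hF' s t).2.re⟩) hg'
    (fun s t => by
      rw [← Complex.sub_re, hF]
      exact (Complex.reCLM.intervalIntegral_comp_comm (hF' s t)).symm) hg s t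
  have him := mul_sub_mul_eq_integral (f := fun τ => (F τ).im) (f' := fun τ => (F' τ).im)
    (fun s t => ⟨(hF' s t).1.im, (hF' s t).2.im⟩) hg'
    (fun s t => by
      rw [← Complex.sub_im, hF]
      exact (Complex.imCLM.intervalIntegral_comp_comm (hF' s t)).symm) hg s t
  apply Complex.ext
  · have := Complex.reCLM.intervalIntegral_comp_comm hint
    simp only [Complex.reCLM_apply] at this
    rw [← this]
    simpa using hre
  · have := Complex.imCLM.intervalIntegral_comp_comm hint
    simp only [Complex.imCLM_apply] at this
    rw [← this]
    simpa using him

section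

variable {b d : ℝ} (hbd : b < d) {f g : ℝ → ℂ}

/-- The primitive of `g` over `(b, d)`. -/
def primitiveOn (b d : ℝ) (g : ℝ → ℂ) (t : ℝ) : ℂ := ∫ τ in b..t, (Ioo b d).indicator g τ

lemma intervalIntegrable_indicator (hg : IntegrableOn g (Ioo b d)) (s t : ℝ) :
    IntervalIntegrable ((Ioo b d).indicator g) volume s t :=
  ((integrable_indicator_iff measurableSet_Ioo).2 hg).intervalIntegrable

lemma primitiveOn_sub (hg : IntegrableOn g (Ioo b d)) (s t : ℝ) :
    primitiveOn b d g t - primitiveOn b d g s = ∫ τ in s..t, (Ioo b d).indicator g τ :=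
  intervalIntegral.integral_interval_sub_left (intervalIntegrable_indicator hg _ _)
    (intervalIntegrable_indicator hg _ _)

lemma integral_indicator_Ioo_eq {s t : ℝ} (hs : s ∈ Icc b d) (ht : t ∈ Icc b d) :
    ∫ τ in s..t, (Ioo b d).indicator g τ = ∫ τ in s..t, g τ := by
  refine intervalIntegral.integral_congr_ae ?_
  have h1 : ∀ᵐ τ : ℝ, τ ≠ d := by simp [ae_iff]
  filter_upwards [h1] with τ h1 hτ
  suffices hm : τ ∈ Ioo b d from indicator_of_mem hm g
  constructor
  · rcases le_total s t with h | h
    · rw [uIoc_of_le h] at hτ; exact hs.1.trans_lt hτ.1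
    · rw [uIoc_of_ge h] at hτ; exact ht.1.trans_lt hτ.1
  · refine lt_of_le_of_ne ?_ h1
    rcases le_total s t with h | h
    · rw [uIoc_of_le h] at hτ; exact hτ.2.trans ht.2
    · rw [uIoc_of_ge h] at hτ; exact hτ.2.trans hs.2

include hbd in
/-- The du Bois-Reymond lemma. -/
lemma exists_eq_add_primitiveOn (hf : IntegrableOn f (Ioo b d)) (hg : IntegrableOn g (Ioo b d))
    (h : ∀ ψ : ℝ → ℝ, ContDiff ℝ ∞ ψ → HasCompactSupport ψ → tsupport ψ ⊆ Ioo b d →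
      ∫ t in Ioo b d, f t * (deriv ψ t : ℝ) = -∫ t in Ioo b d, g t * ψ t) :
    ∃ c : ℂ, ∀ᵐ t ∂(volume.restrict (Ioo b d)), f t = c + primitiveOn b d g t := by
  set G := primitiveOn b d g with hG
  have hGc : Continuous G := intervalIntegral.continuous_primitive (intervalIntegrable_indicator hg) b
  have conv : ∀ φ : ℝ → ℂ, ∫ t in Ioo b d, φ t = ∫ t in b..d, φ t := fun φ => by
    rw [intervalIntegral.integral_of_le hbd.le, integral_Ioc_eq_integral_Ioo]
  have intmul : ∀ {φ : ℝ → ℂ} {ψ : ℝ → ℝ}, IntegrableOn φ (Ioo b d) → Continuous ψ →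
      HasCompactSupport ψ → IntegrableOn (fun t => φ t * ψ t) (Ioo b d) := by
    intro φ ψ hφ hψ hψs
    obtain ⟨C, hC⟩ := hψs.exists_bound_of_continuous hψ
    exact hφ.mul_bdd (c := C) (Complex.continuous_ofReal.comp hψ).aestronglyMeasurable
      (Eventually.of_forall fun t => by simpa using hC t)
  have hGi : IntegrableOn G (Ioo b d) :=
    (hGc.integrableOn_Icc (a := b) (b := d)).mono_set Ioo_subset_Icc_self
  -- `f - G` has vanishing weak derivative
  have h0 : ∀ ψ : ℝ → ℝ, ContDiff ℝ ∞ ψ → HasCompactSupport ψ → tsupport ψ ⊆ Ioo b d →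
      ∫ t in Ioo b d, (f t - G t) * (deriv ψ t : ℝ) = 0 := by
    intro ψ h1 h2 h3
    have hd : Continuous (deriv ψ) := h1.continuous_deriv (by simp)
    have hp := complex_mul_sub_mul_eq_integral (F := G) (g := ψ) (intervalIntegrable_indicator hg)
      (fun s t => hd.intervalIntegrable s t) (fun s t => primitiveOn_sub hg s t)
      (fun s t => (intervalIntegral.integral_deriv_eq_sub
        (fun x _ => (h1.differentiable (by simp)).differentiableAt)
        (hd.intervalIntegrable _ _)).symm) b d
    have hb0 : ψ b = 0 := image_eq_zero_of_notMem_tsupport fun hx => (h3 hx).1.ne rfl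
    have hd0 : ψ d = 0 := image_eq_zero_of_notMem_tsupport fun hx => (h3 hx).2.ne rfl
    rw [hb0, hd0, ← conv] at hp
    have hgi := intmul hg h1.continuous h2
    have hGi' := intmul hGi hd h2.deriv
    have e : ∫ t in Ioo b d, ((Ioo b d).indicator g t * ψ t + G t * (deriv ψ t : ℝ)) =
        (∫ t in Ioo b d, g t * ψ t) + ∫ t in Ioo b d, G t * (deriv ψ t : ℝ) := by
      rw [← integral_add hgi hGi']
      refine setIntegral_congr_fun measurableSet_Ioo fun t ht => ?_
      simp only [indicator_of_mem ht]
    rw [e] at hp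
    simp only [sub_mul]
    rw [integral_sub (intmul hf hd h2.deriv) hGi', h ψ h1 h2 h3]
    simp at hp
    linear_combination hp
  let B : ContDiffBump ((b + d) / 2) := ⟨(d - b) / 8, (d - b) / 4, by linarith, by linarith⟩
  set ψ₀ : ℝ → ℝ := B.normed volume with hψ₀
  have p1 : ContDiff ℝ ∞ ψ₀ := B.contDiff_normed
  have p2 : HasCompactSupport ψ₀ := B.hasCompactSupport_normed
  have p3 : tsupport ψ₀ ⊆ Ioo b d := by
    rw [hψ₀, B.tsupport_normed_eq, Real.closedBall_eq_Icc]
    intro x hx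
    have e : B.rOut = (d - b) / 4 := rfl
    rw [e] at hx
    constructor <;> linarith [hx.1, hx.2]
  have p4 : ∫ t, ψ₀ t = 1 := B.integral_normed
  -- As `ψ₀` has integral one, this mean is the only possible value of the constant.
  set c := ∫ t in Ioo b d, (f t - G t) * ψ₀ t with hc
  refine ⟨c, ?_⟩
  have main := isOpen_Ioo.ae_eq_zero_of_integral_contDiff_smul_eq_zero (μ := volume)
    (U := Ioo b d) (f := fun t => f t - G t - c) ?_ ?_
  · rw [ae_restrict_iff' measurableSet_Ioo]
    filter_upwards [main] with t ht hm
    have := ht hm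
    linear_combination this
  · exact ((hf.sub hGi).sub (integrableOn_const (by simp))).locallyIntegrableOn
  · intro ψ h1 h2 h3
    set J := ∫ t, ψ t with hJ
    -- Subtracting a multiple of `ψ₀` removes the mean, so the primitive `χ` of `η` has compact
    -- support in `(b, d)` and is an admissible test function. Testing with `χ' = η` gives `∫ (f -
    -- G) ψ = c ∫ ψ`.
    let η : ℝ → ℝ := fun t => ψ t - J * ψ₀ t
    have η1 : ContDiff ℝ ∞ η := h1.sub (contDiff_const.mul p1)
    have ηi : Integrable η := (h1.continuous.integrable_of_hasCompactSupport h2).sub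
      ((p1.continuous.integrable_of_hasCompactSupport p2).const_mul J)
    have η0 : ∫ t, η t = 0 := by
      simp only [η]
      rw [integral_sub (h1.continuous.integrable_of_hasCompactSupport h2)
        ((p1.continuous.integrable_of_hasCompactSupport p2).const_mul J),
        integral_const_mul, p4, ← hJ]; ring
    -- support in a compact interval
    obtain ⟨s, t, hs, ht, hst⟩ : ∃ s t, b < s ∧ t < d ∧ ∀ x, x ∉ Icc s t → η x = 0 := by
      have hK : IsCompact (tsupport ψ ∪ tsupport ψ₀) := h2.isCompact.union p2.isCompact
      have hKs : tsupport ψ ∪ tsupport ψ₀ ⊆ Ioo b d := union_subset h3 p3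
      have hne : (tsupport ψ ∪ tsupport ψ₀).Nonempty := by
        refine Set.Nonempty.inr ?_
        by_contra! he
        rw [tsupport_eq_empty_iff] at he
        rw [he] at p4; simp at p4
      refine ⟨sInf (tsupport ψ ∪ tsupport ψ₀), sSup (tsupport ψ ∪ tsupport ψ₀),
        (hKs (hK.sInf_mem hne)).1, (hKs (hK.sSup_mem hne)).2, fun x hx => ?_⟩
      have hx' : x ∉ tsupport ψ ∪ tsupport ψ₀ := fun hm =>
        hx ⟨csInf_le hK.bddBelow hm, le_csSup hK.bddAbove hm⟩
      simp only [η]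
      rw [image_eq_zero_of_notMem_tsupport fun h => hx' (Or.inl h),
        image_eq_zero_of_notMem_tsupport fun h => hx' (Or.inr h)]; simp
    let χ : ℝ → ℝ := fun x => ∫ τ in b..x, η τ
    have χd : ∀ x, HasDerivAt χ (η x) x := fun x =>
      intervalIntegral.integral_hasDerivAt_right (η1.continuous.intervalIntegrable _ _)
        η1.continuous.stronglyMeasurable.stronglyMeasurableAtFilter η1.continuous.continuousAt
    have χd' : deriv χ = η := funext fun x => (χd x).deriv
    have χ1 : ContDiff ℝ ∞ χ := contDiff_infty_iff_deriv.2
      ⟨fun x => (χd x).differentiableAt, by rw [χd']; exact η1⟩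
    have χ0 : ∀ x, x ∉ Icc s t → χ x = 0 := by
      intro x hx
      rw [mem_Icc, not_and_or, not_le, not_le] at hx
      have z1 : ∀ y, y < s → χ y = 0 := fun y hy => by
        refine intervalIntegral.integral_zero_ae (Eventually.of_forall fun τ hτ => hst τ fun hm => ?_)
        rcases le_total b y with h | h
        · rw [uIoc_of_le h] at hτ; linarith [hτ.2, hm.1]
        · rw [uIoc_of_ge h] at hτ; linarith [hτ.2, hm.1]
      rcases hx with hx | hx
      · exact z1 x hx
      · by_cases hsx : x < s
        · exact z1 x hsx
        have h5 : ∫ τ, η τ = ∫ τ in Ioc b x, η τ := by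
          rw [setIntegral_eq_integral_of_forall_compl_eq_zero]
          intro τ hτ
          refine hst τ fun hm => hτ ⟨lt_of_lt_of_le hs hm.1, hm.2.trans hx.le⟩
        simp only [χ]
        rw [intervalIntegral.integral_of_le (by linarith), ← h5, η0]
    have χ2 : tsupport χ ⊆ Icc s t :=
      closure_minimal (fun x hx => by by_contra hn; exact hx (χ0 x hn)) isClosed_Icc
    have χ3 : HasCompactSupport χ := isCompact_Icc.of_isClosed_subset (isClosed_tsupport _) χ2
    have h6 := h0 χ χ1 χ3 (χ2.trans fun x hx => ⟨hs.trans_le hx.1, hx.2.trans_lt ht⟩)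
    rw [χd'] at h6
    have i1 : IntegrableOn (fun t => (f t - G t) * ((ψ t : ℝ) : ℂ)) (Ioo b d) :=
      intmul (hf.sub hGi) h1.continuous h2
    have i2 : IntegrableOn (fun t => (f t - G t) * ((ψ₀ t : ℝ) : ℂ)) (Ioo b d) :=
      intmul (hf.sub hGi) p1.continuous p2
    have h7 : ∫ t in Ioo b d, (f t - G t) * ((η t : ℝ) : ℂ) =
        (∫ t in Ioo b d, (f t - G t) * ψ t) - J * c := by
      rw [hc, ← integral_const_mul, ← integral_sub i1 (i2.const_mul _)]
      congr 1; funext τ; simp only [η]; push_cast; ring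
    have h8 : ∫ t in Ioo b d, ψ t = J := by
      rw [hJ, setIntegral_eq_integral_of_forall_compl_eq_zero]
      exact fun τ hτ => image_eq_zero_of_notMem_tsupport fun hm => hτ (h3 hm)
    have h9 : ∫ t, ψ t • (f t - G t - c) = ∫ t in Ioo b d, ψ t • (f t - G t - c) := by
      rw [setIntegral_eq_integral_of_forall_compl_eq_zero]
      intro τ hτ
      rw [image_eq_zero_of_notMem_tsupport fun hm => hτ (h3 hm), zero_smul]
    have i3 : IntegrableOn (fun t => c * ((ψ t : ℝ) : ℂ)) (Ioo b d) :=
      intmul (φ := fun _ => c) (integrableOn_const (by simp)) h1.continuous h2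
    have h10 : ∫ t in Ioo b d, ψ t • (f t - G t - c) =
        (∫ t in Ioo b d, (f t - G t) * ψ t) - ∫ t in Ioo b d, c * ((ψ t : ℝ) : ℂ) := by
      rw [← integral_sub i1 i3]
      congr 1; funext τ; rw [Complex.real_smul]; ring
    rw [h9, h10, integral_const_mul, integral_complex_ofReal, h8]
    rw [h7] at h6
    linear_combination h6

include hbd in
/-- A weakly differentiable function on `(b, d)` with square-integrable derivative has a Hölder
continuous representative, whose end point values are explicit functionals. -/
lemma exists_holder_representative (hf : MemLp f 2 (volume.restrict (Ioo b d)))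
    (hg : MemLp g 2 (volume.restrict (Ioo b d)))
    (h : ∀ ψ : ℝ → ℝ, ContDiff ℝ ∞ ψ → HasCompactSupport ψ → tsupport ψ ⊆ Ioo b d →
      ∫ t in Ioo b d, f t * (deriv ψ t : ℝ) = -∫ t in Ioo b d, g t * ψ t) :
    ∃ F : ℝ → ℂ, Continuous F ∧ (∀ᵐ t ∂(volume.restrict (Ioo b d)), f t = F t) ∧
      (∀ s ∈ Icc b d, ∀ t ∈ Icc b d,
        ‖F t - F s‖ ^ 2 ≤ |t - s| * ∫ τ in Ioo b d, ‖g τ‖ ^ 2) ∧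
      F d = ∫ t in Ioo b d, (f t * ((1 / (d - b) : ℝ) : ℂ) + g t * (((t - b) / (d - b) : ℝ) : ℂ)) ∧
      F b = ∫ t in Ioo b d,
        (f t * ((1 / (d - b) : ℝ) : ℂ) + g t * (((t - d) / (d - b) : ℝ) : ℂ)) := by
  have hf1 : IntegrableOn f (Ioo b d) := hf.integrable (by norm_num)
  have hg1 : IntegrableOn g (Ioo b d) := hg.integrable (by norm_num)
  obtain ⟨c, hc⟩ := exists_eq_add_primitiveOn hbd hf1 hg1 h
  have hL : d - b ≠ 0 := by linarith
  -- Integration by parts against the affine weight `(t - e)/(d - b)`. For `e = b` it vanishes at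
  -- `b` and equals `1` at `d`; for `e = d` it vanishes at `d` and equals `-1` at `b`. Each choice
  -- isolates one end point value as an integral that is continuous in `L²`.
  have hpar : ∀ e : ℝ, (c + primitiveOn b d g d) * (((d - e) / (d - b) : ℝ) : ℂ)
      - (c + primitiveOn b d g b) * (((b - e) / (d - b) : ℝ) : ℂ) =
      ∫ t in Ioo b d, (f t * ((1 / (d - b) : ℝ) : ℂ) + g t * (((t - e) / (d - b) : ℝ) : ℂ)) := by
    intro e
    have := complex_mul_sub_mul_eq_integral (F := fun t => c + primitiveOn b d g t)
      (g := fun t => (t - e) / (d - b)) (g' := fun _ => 1 / (d - b))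
      (intervalIntegrable_indicator hg1)
      (fun s t => intervalIntegrable_const) (fun s t => by
        rw [add_sub_add_left_eq_sub]; exact primitiveOn_sub hg1 s t)
      (fun s t => by rw [intervalIntegral.integral_const, smul_eq_mul]; field_simp; ring) b d
    rw [this, intervalIntegral.integral_of_le hbd.le, integral_Ioc_eq_integral_Ioo]
    refine integral_congr_ae ?_
    filter_upwards [hc, ae_restrict_mem measurableSet_Ioo] with t ht hm
    rw [indicator_of_mem hm, ht]; ring
  refine ⟨fun t => c + primitiveOn b d g t, ?_, hc, fun s hs t ht => ?_, ?_, ?_⟩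
  · exact continuous_const.add
      (intervalIntegral.continuous_primitive (intervalIntegrable_indicator hg1) b)
  · rw [add_sub_add_left_eq_sub, primitiveOn_sub hg1, integral_indicator_Ioo_eq hs ht]
    exact sq_norm_integral_le hg hs ht
  · rw [← hpar b, div_self hL]; simp
  · rw [← hpar d]
    have : (b - d) / (d - b) = -1 := by rw [div_eq_iff hL]; ring
    rw [this]; simp

lemma sq_norm_le_two_mul (x y : ℂ) : ‖x‖ ^ 2 ≤ 2 * ‖y‖ ^ 2 + 2 * ‖x - y‖ ^ 2 := by
  have h1 : ‖x‖ ≤ ‖y‖ + ‖x - y‖ := by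
    have := norm_add_le y (x - y); rwa [add_sub_cancel] at this
  nlinarith [norm_nonneg x, norm_nonneg y, norm_nonneg (x - y), sq_nonneg (‖y‖ - ‖x - y‖)]

/-- Trace inequality at the point `e`, using values in an interval of length `h` near `e`. -/
lemma trace_inequality {F : ℝ → ℂ} (hf : MemLp f 2 (volume.restrict (Ioo b d)))
    (hF : ∀ᵐ t ∂(volume.restrict (Ioo b d)), f t = F t) {Γ : ℝ} (hΓ : 0 ≤ Γ)
    (hH : ∀ s ∈ Icc b d, ∀ t ∈ Icc b d, ‖F t - F s‖ ^ 2 ≤ |t - s| * Γ) {e x h : ℝ}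
    (he : e ∈ Icc b d) (hh : 0 ≤ h) (hJ : Ioo x (x + h) ⊆ Ioo b d)
    (hx : ∀ t ∈ Ioo x (x + h), |t - e| ≤ h) :
    h * ‖F e‖ ^ 2 ≤ 2 * (∫ t in Ioo b d, ‖f t‖ ^ 2) + 2 * h ^ 2 * Γ := by
  have hi := hf.integrable_norm_pow (by norm_num)
  have hi' : IntegrableOn (fun t => ‖f t‖ ^ 2) (Ioo x (x + h)) := IntegrableOn.mono_set hi hJ
  have h1 : ∫ _ in Ioo x (x + h), ‖F e‖ ^ 2 ≤ ∫ t in Ioo x (x + h), (2 * ‖f t‖ ^ 2 + 2 * (h * Γ)) := by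
    refine integral_mono_ae (integrable_const _) ((hi'.const_mul 2).add (integrable_const _)) ?_
    have hF' := ae_restrict_of_ae_restrict_of_subset hJ hF
    filter_upwards [hF', ae_restrict_mem measurableSet_Ioo] with t ht hm
    rw [ht]
    have h2 := hH t (Ioo_subset_Icc_self (hJ hm)) e he
    have h3 := sq_norm_le_two_mul (F e) (F t)
    have h4 : |e - t| * Γ ≤ h * Γ := by
      rw [abs_sub_comm]; exact mul_le_mul_of_nonneg_right (hx t hm) hΓ
    linarith
  rw [integral_add (hi'.const_mul 2) (integrable_const _), integral_const_mul, integral_const,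
    integral_const] at h1
  simp only [measureReal_restrict_apply, MeasurableSet.univ, univ_inter,
    Real.volume_real_Ioo_of_le (show x ≤ x + h by linarith), smul_eq_mul, add_sub_cancel_left] at h1
  have h2 : ∫ t in Ioo x (x + h), ‖f t‖ ^ 2 ≤ ∫ t in Ioo b d, ‖f t‖ ^ 2 :=
    setIntegral_mono_set hi (Eventually.of_forall fun _ => by positivity) hJ.eventuallyLE
  linarith

include hbd in
/-- Poincaré's inequality on an interval. -/
lemma poincare_interval {F : ℝ → ℂ} (hf : MemLp f 2 (volume.restrict (Ioo b d)))
    (hF : ∀ᵐ t ∂(volume.restrict (Ioo b d)), f t = F t) {Γ : ℝ} (hΓ : 0 ≤ Γ)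
    (hH : ∀ s ∈ Icc b d, ∀ t ∈ Icc b d, ‖F t - F s‖ ^ 2 ≤ |t - s| * Γ) :
    ∫ t in Ioo b d, ‖f t‖ ^ 2 ≤ 2 * (d - b) * ‖F d‖ ^ 2 + 2 * (d - b) ^ 2 * Γ := by
  have hi := hf.integrable_norm_pow (by norm_num)
  have h1 : ∫ t in Ioo b d, ‖f t‖ ^ 2 ≤ ∫ _ in Ioo b d, (2 * ‖F d‖ ^ 2 + 2 * ((d - b) * Γ)) := by
    refine integral_mono_ae hi (integrable_const _) ?_
    filter_upwards [hF, ae_restrict_mem measurableSet_Ioo] with t ht hm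
    rw [ht]
    have h2 := hH d (right_mem_Icc.2 hbd.le) t (Ioo_subset_Icc_self hm)
    have h3 := sq_norm_le_two_mul (F t) (F d)
    have h4 : |t - d| * Γ ≤ (d - b) * Γ := by
      refine mul_le_mul_of_nonneg_right ?_ hΓ
      rw [abs_le]; constructor <;> linarith [hm.1, hm.2]
    linarith
  rw [integral_const] at h1
  simp only [measureReal_restrict_apply, MeasurableSet.univ, univ_inter,
    Real.volume_real_Ioo_of_le hbd.le, smul_eq_mul] at h1
  linarith

end

/-! ### Fourier coefficients in the horizontal variable -/

lemma volume_restrict_prod (s t : Set ℝ) :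
    (volume.restrict (s ×ˢ t) : Measure (ℝ × ℝ)) = (volume.restrict s).prod (volume.restrict t) := by
  rw [Measure.prod_restrict, Measure.volume_eq_prod]

/-- The `n`-th horizontal Fourier coefficient on the line `x₂ = t`. -/
def sliceCoeff (M : Medium) (k θ : ℝ) (u : ℝ × ℝ → ℂ) (n : ℤ) (t : ℝ) : ℂ :=
  coeff M k θ (fun x => u (x, t)) n

variable (M : Medium) (k θ : ℝ)

/-- The exponential `e^{-i α_n x}`. -/
def mode (n : ℤ) (x : ℝ) : ℂ := Complex.exp (-(Complex.I * alpha M k θ n * x))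

lemma norm_mode (n : ℤ) (x : ℝ) : ‖mode M k θ n x‖ = 1 := by
  rw [mode, show -(Complex.I * alpha M k θ n * x) = ((-(alpha M k θ n * x) : ℝ) : ℂ) * Complex.I by
    push_cast; ring, Complex.norm_exp_ofReal_mul_I]

lemma continuous_mode (n : ℤ) : Continuous (mode M k θ n) := by
  unfold mode; fun_prop

lemma coeff_eq_setIntegral (f : ℝ → ℂ) (n : ℤ) :
    coeff M k θ f n = (M.p : ℂ)⁻¹ * ∫ x in Ioo 0 M.p, f x * mode M k θ n x := by
  rw [coeff, intervalIntegral.integral_of_le M.p_pos.le, integral_Ioc_eq_integral_Ioo]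
  rfl

lemma coeff_congr_ae {f g : ℝ → ℂ} (h : f =ᵐ[volume.restrict (Ioo 0 M.p)] g) (n : ℤ) :
    coeff M k θ f n = coeff M k θ g n := by
  rw [coeff_eq_setIntegral, coeff_eq_setIntegral]
  congr 1
  exact integral_congr_ae (h.mono fun x hx => by simp only [hx])

/-- Parseval's identity for quasi-periodic Fourier coefficients. -/
lemma hasSum_sq_coeff {f : ℝ → ℂ} (hf : MemLp f 2 (volume.restrict (Ioo 0 M.p))) :
    HasSum (fun n => ‖coeff M k θ f n‖ ^ 2) (M.p⁻¹ * ∫ x in Ioo 0 M.p, ‖f x‖ ^ 2) := by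
  have hp := M.p_pos
  -- Removing the phase `e^{i α_0 x}` leaves the classical Fourier coefficients on `(0, p)`, because
  -- `α_n = α_0 + 2πn/p`.
  set g : ℝ → ℂ := fun x => f x * mode M k θ 0 x with hg
  have hgn : ∀ x, ‖g x‖ = ‖f x‖ := fun x => by rw [hg, norm_mul, norm_mode, mul_one]
  have hgm : MemLp g 2 (volume.restrict (Ioc 0 M.p)) := by
    rw [restrict_Ioo_eq_restrict_Ioc] at hf
    refine hf.of_le (hf.1.mul (continuous_mode M k θ 0).aestronglyMeasurable) ?_
    exact Eventually.of_forall fun x => (hgn x).le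
  have key := hasSum_sq_fourierCoeffOn hp hgm
  rw [sub_zero, smul_eq_mul, intervalIntegral.integral_of_le hp.le, integral_Ioc_eq_integral_Ioo]
    at key
  simp only [hgn] at key
  convert key using 2 with n
  rw [fourierCoeffOn_eq_integral, coeff, sub_zero, one_div, ← Complex.coe_smul, smul_eq_mul,
    Complex.ofReal_inv]
  congr 3
  refine intervalIntegral.integral_congr fun x _ => ?_
  simp only [hg, mode]
  rw [fourier_coe_apply, smul_eq_mul, mul_left_comm, ← Complex.exp_add]
  congr 2
  have : (M.p : ℂ) ≠ 0 := by exact_mod_cast hp.ne'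
  simp only [alpha]
  push_cast
  field_simp
  ring

section Slices

variable {I : Set ℝ} {u : ℝ × ℝ → ℂ}

lemma aestronglyMeasurable_sliceCoeff
    (hu : AEStronglyMeasurable u (volume.restrict (Ioo 0 M.p ×ˢ I))) (n : ℤ) :
    AEStronglyMeasurable (sliceCoeff M k θ u n) (volume.restrict I) := by
  have h1 : sliceCoeff M k θ u n = fun t =>
      (M.p : ℂ)⁻¹ * ∫ x in Ioo 0 M.p, u (x, t) * mode M k θ n x := by
    funext t; exact coeff_eq_setIntegral M k θ _ n
  rw [h1]
  refine AEStronglyMeasurable.const_mul ?_ _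
  rw [volume_restrict_prod] at hu
  have h2 : AEStronglyMeasurable (fun z : ℝ × ℝ => u z * mode M k θ n z.1)
      ((volume.restrict (Ioo 0 M.p)).prod (volume.restrict I)) :=
    hu.mul ((continuous_mode M k θ n).comp continuous_fst).aestronglyMeasurable
  exact h2.prod_swap.integral_prod_right'

lemma ae_memLp_slice (hu : MemLp u 2 (volume.restrict (Ioo 0 M.p ×ˢ I))) :
    ∀ᵐ t ∂(volume.restrict I), MemLp (fun x => u (x, t)) 2 (volume.restrict (Ioo 0 M.p)) := by
  have h1 := hu.integrable_norm_pow (by norm_num)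
  have h0 := hu.1
  rw [volume_restrict_prod] at h1 h0
  filter_upwards [h1.prod_left_ae, h0.prod_swap.prodMk_left] with t ht ht'
  exact (memLp_two_iff_integrable_sq_norm ht').2 ht

lemma integrable_sq_sliceCoeff (hu : MemLp u 2 (volume.restrict (Ioo 0 M.p ×ˢ I))) (n : ℤ) :
    Integrable (fun t => ‖sliceCoeff M k θ u n t‖ ^ 2) (volume.restrict I) := by
  have h1 := hu.integrable_norm_pow (by norm_num)
  rw [volume_restrict_prod] at h1
  refine (h1.integral_prod_right.const_mul M.p⁻¹).mono'
    ((aestronglyMeasurable_sliceCoeff M k θ hu.1 n).norm.pow 2) ?_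
  filter_upwards [ae_memLp_slice M hu] with t ht
  rw [Real.norm_of_nonneg (by positivity)]
  exact le_hasSum (hasSum_sq_coeff M k θ ht) n fun _ _ => by positivity

lemma memLp_sliceCoeff (hu : MemLp u 2 (volume.restrict (Ioo 0 M.p ×ˢ I))) (n : ℤ) :
    MemLp (sliceCoeff M k θ u n) 2 (volume.restrict I) :=
  (memLp_two_iff_integrable_sq_norm (aestronglyMeasurable_sliceCoeff M k θ hu.1 n)).2
    (integrable_sq_sliceCoeff M k θ hu n)

/-- Parseval on almost every horizontal slice, integrated in `x₂`. Bessel's inequality bounds all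
partial sums by one integrable function, so sum and integral may be exchanged. -/
lemma hasSum_integral_sq_sliceCoeff (hu : MemLp u 2 (volume.restrict (Ioo 0 M.p ×ˢ I))) :
    HasSum (fun n => ∫ t in I, ‖sliceCoeff M k θ u n t‖ ^ 2)
      (M.p⁻¹ * ∫ x in Ioo 0 M.p ×ˢ I, ‖u x‖ ^ 2) := by
  have h1 := hu.integrable_norm_pow (by norm_num)
  rw [volume_restrict_prod] at h1
  have hpt : ∀ᵐ t ∂(volume.restrict I), HasSum (fun n => ‖sliceCoeff M k θ u n t‖ ^ 2)
      (M.p⁻¹ * ∫ x in Ioo 0 M.p, ‖u (x, t)‖ ^ 2) := by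
    filter_upwards [ae_memLp_slice M hu] with t ht
    exact hasSum_sq_coeff M k θ ht
  have hi := h1.integral_prod_right.const_mul M.p⁻¹
  have hsum : Summable fun n => ∫ t in I, ‖‖sliceCoeff M k θ u n t‖ ^ 2‖ := by
    refine summable_of_sum_le (c := ∫ t in I, M.p⁻¹ * ∫ x in Ioo 0 M.p, ‖u (x, t)‖ ^ 2)
      (fun n => integral_nonneg fun _ => norm_nonneg _) fun s => ?_
    rw [← integral_finsetSum _ fun n _ => (integrable_sq_sliceCoeff M k θ hu n).norm]
    refine integral_mono_ae (integrable_finsetSum _ fun n _ =>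
      (integrable_sq_sliceCoeff M k θ hu n).norm) hi ?_
    filter_upwards [hpt] with t ht
    simp only [norm_pow, norm_norm]
    exact sum_le_hasSum s (fun _ _ => by positivity) ht
  have := hasSum_integral_of_summable_integral_norm
    (fun n => integrable_sq_sliceCoeff M k θ hu n) hsum
  have e : M.p⁻¹ * ∫ x in Ioo 0 M.p ×ˢ I, ‖u x‖ ^ 2 =
      ∫ t in I, ∑' n, ‖sliceCoeff M k θ u n t‖ ^ 2 := by
    rw [volume_restrict_prod, integral_prod_symm _ h1, ← integral_const_mul]
    refine integral_congr_ae ?_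
    filter_upwards [hpt] with t ht
    exact ht.tsum_eq.symm
  rw [e]
  exact this

/-- Fubini's theorem for the moments `∫ u e^{-i α_n x₁} ψ(x₂)`. -/
lemma setIntegral_mul_mode (hI : IsFiniteMeasure (volume.restrict I))
    (hu : MemLp u 2 (volume.restrict (Ioo 0 M.p ×ˢ I))) (n : ℤ)
    {ψ : ℝ → ℂ} (hψ : AEStronglyMeasurable ψ (volume.restrict I)) {C : ℝ}
    (hC : ∀ᵐ t ∂(volume.restrict I), ‖ψ t‖ ≤ C) :
    ∫ x in Ioo 0 M.p ×ˢ I, u x * (mode M k θ n x.1 * ψ x.2) =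
      M.p * ∫ t in I, sliceCoeff M k θ u n t * ψ t := by
  have hp : (M.p : ℂ) ≠ 0 := by exact_mod_cast M.p_pos.ne'
  rw [volume_restrict_prod] at hu ⊢
  have h1 : Integrable (fun x : ℝ × ℝ => u x * (mode M k θ n x.1 * ψ x.2))
      ((volume.restrict (Ioo 0 M.p)).prod (volume.restrict I)) := by
    refine (hu.integrable (by norm_num)).mul_bdd (c := C) ?_ ?_
    · exact ((continuous_mode M k θ n).comp continuous_fst).aestronglyMeasurable.mul hψ.comp_snd
    · have := Measure.quasiMeasurePreserving_snd (μ := volume.restrict (Ioo 0 M.p))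
        (ν := volume.restrict I) |>.ae hC
      filter_upwards [this] with x hx
      rw [norm_mul, norm_mode, one_mul]; exact hx
  rw [integral_prod_symm _ h1, ← integral_const_mul]
  congr 1; funext t
  simp only [sliceCoeff, coeff_eq_setIntegral]
  rw [mul_assoc, mul_inv_cancel_left₀ hp, ← integral_mul_const]
  congr 1; funext x; ring

end Slices

/-! ### Folding test functions onto the cell -/

variable (M : Medium) (a : ℝ)

/-- The factor picked up by an `a`-quasi-periodic function under a shift by `m` periods. -/
def shiftFactor (m : ℤ) : ℂ := Complex.exp (Complex.I * a * (m * M.p))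

/-- Sum of the translates of `φ` over the cells number `-N, …, N - 1`, weighted such that pairing
with a quasi-periodic function over the strip becomes a pairing over the cell. -/
def fold (N : ℕ) (φ : ℝ × ℝ → ℂ) (x : ℝ × ℝ) : ℂ :=
  ∑ m ∈ Finset.Ico (-(N : ℤ)) N, shiftFactor M a m * φ (x + ((m * M.p : ℝ), 0))

variable {M a}

lemma IsQuasiPeriodic.shift {w : ℝ × ℝ → ℂ} (hw : IsQuasiPeriodic M a w) {x : ℝ × ℝ}
    (hx : x.2 ∈ Ioo M.b M.d) (m : ℤ) :
    w (x + ((m * M.p : ℝ), 0)) = shiftFactor M a m * w x := by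
  have h := (hw x.2 hx).int_mul m x.1
  have e : x + ((m * M.p : ℝ), (0 : ℝ)) = (x.1 + m * M.p, x.2) := by ext <;> simp
  have e2 : Complex.exp (-(Complex.I * a * ((x.1 + m * M.p : ℝ) : ℂ))) =
      Complex.exp (-(Complex.I * a * x.1)) * Complex.exp (-(Complex.I * a * (m * M.p))) := by
    rw [← Complex.exp_add]; congr 1; push_cast; ring
  rw [e2, ← mul_assoc, mul_right_comm] at h
  have h2 := mul_right_cancel₀ (Complex.exp_ne_zero _) h
  rw [e, shiftFactor, ← h2, mul_left_comm, ← Complex.exp_add, add_neg_cancel, Complex.exp_zero,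
    mul_one]

lemma continuous_fold (N : ℕ) {φ : ℝ × ℝ → ℂ} (hφ : Continuous φ) : Continuous (fold M a N φ) := by
  unfold fold; fun_prop

lemma isFiniteMeasure_cell : IsFiniteMeasure (volume.restrict (cell M)) := by
  have : volume (cell M) < ⊤ := by
    rw [cell, Measure.volume_eq_prod, Measure.prod_prod]
    exact ENNReal.mul_lt_top (by simp) (by simp)
  exact ⟨by simpa using this⟩

lemma memLp_cell_of_continuous {φ : ℝ × ℝ → ℂ} (hφ : Continuous φ) :
    MemLp φ 2 (volume.restrict (cell M)) := by
  have := isFiniteMeasure_cell (M := M)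
  obtain ⟨C, hC⟩ := (isCompact_Icc (a := (0 : ℝ)) (b := M.p)).prod
    (isCompact_Icc (a := M.b) (b := M.d)) |>.exists_bound_of_continuousOn hφ.continuousOn
  refine MemLp.of_bound hφ.aestronglyMeasurable C ?_
  filter_upwards [ae_restrict_mem (measurableSet_Ioo.prod measurableSet_Ioo)] with x hx
  exact hC x ⟨Ioo_subset_Icc_self hx.1, Ioo_subset_Icc_self hx.2⟩

lemma measurableSet_cell : MeasurableSet (cell M) := measurableSet_Ioo.prod measurableSet_Ioo

lemma cell_ae_eq : (Ioc 0 M.p ×ˢ Ioo M.b M.d : Set (ℝ × ℝ)) =ᵐ[volume] cell M := by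
  rw [cell, Measure.volume_eq_prod]
  exact Measure.set_prod_ae_eq Ioo_ae_eq_Ioc.symm (ae_eq_refl _)

/-- The strip is cut into cells, each is translated back to `C`, and quasi-periodicity moves the
resulting phase onto the test function. The result involves `w` on the cell only, where it is
square-integrable. -/
lemma integral_mul_eq_integral_fold {w φ : ℝ × ℝ → ℂ} (hw : IsQuasiPeriodic M a w)
    (hw2 : MemLp w 2 (volume.restrict (cell M))) (hφ : Continuous φ)
    (hs : tsupport φ ⊆ strip M) {N : ℕ}
    (hN : ∀ x ∈ tsupport φ, x.1 ∈ Ioo (-(N * M.p)) (N * M.p)) :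
    ∫ x, w x * φ x = ∫ x in cell M, w x * fold M a N φ x := by
  have hp := M.p_pos
  have := isFiniteMeasure_cell (M := M)
  let S : ℤ → Set (ℝ × ℝ) := fun m => Ioc (m * M.p) ((m + 1) * M.p) ×ˢ Ioo M.b M.d
  have hSm : ∀ m, MeasurableSet (S m) := fun m => measurableSet_Ioc.prod measurableSet_Ioo
  have hpre : ∀ m : ℤ, (fun x : ℝ × ℝ => x + ((m * M.p : ℝ), (0 : ℝ))) ⁻¹' S m =
      Ioc 0 M.p ×ˢ Ioo M.b M.d := by
    intro m; ext x
    simp only [S, mem_preimage, mem_prod, mem_Ioc, Prod.fst_add, Prod.snd_add, add_zero]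
    constructor
    · rintro ⟨⟨h1, h2⟩, h3⟩; exact ⟨⟨by linarith, by linarith⟩, h3⟩
    · rintro ⟨⟨h1, h2⟩, h3⟩; exact ⟨⟨by linarith, by linarith⟩, h3⟩
  have hemb : ∀ z : ℝ × ℝ, MeasurableEmbedding fun x : ℝ × ℝ => x + z := fun z =>
    (MeasurableEquiv.addRight z).measurableEmbedding
  have hmp : ∀ z : ℝ × ℝ, MeasurePreserving (fun x : ℝ × ℝ => x + z) volume volume := fun z =>
    measurePreserving_add_right volume z
  have hcomp : ∀ m : ℤ, ∀ x ∈ cell M, w (x + ((m * M.p : ℝ), 0)) * φ (x + ((m * M.p : ℝ), 0)) =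
      w x * (shiftFactor M a m * φ (x + ((m * M.p : ℝ), 0))) := fun m x hx => by
    rw [hw.shift hx.2]; ring
  have hint0 : ∀ m : ℤ, IntegrableOn
      (fun x => w x * (shiftFactor M a m * φ (x + ((m * M.p : ℝ), 0)))) (cell M) := fun m => by
    have h2 : MemLp (fun x => shiftFactor M a m * φ (x + ((m * M.p : ℝ), 0))) 2
      (volume.restrict (cell M)) := memLp_cell_of_continuous (by fun_prop)
    exact hw2.integrable_mul h2
  have hint : ∀ m, IntegrableOn (fun x => w x * φ x) (S m) := fun m => by
    rw [← (hmp _).integrableOn_comp_preimage (hemb ((m * M.p : ℝ), 0)), hpre]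
    rw [integrableOn_congr_set_ae cell_ae_eq]
    exact (integrableOn_congr_fun (hcomp m) measurableSet_cell).2 (hint0 m)
  have hval : ∀ m, ∫ x in S m, w x * φ x =
      ∫ x in cell M, w x * (shiftFactor M a m * φ (x + ((m * M.p : ℝ), 0))) := fun m => by
    rw [← (hmp ((m * M.p : ℝ), 0)).setIntegral_preimage_emb (hemb _), hpre,
      setIntegral_congr_set cell_ae_eq]
    exact setIntegral_congr_fun measurableSet_cell (hcomp m)
  have hU : ∫ x, w x * φ x = ∫ x in ⋃ m ∈ Finset.Ico (-(N : ℤ)) N, S m, w x * φ x := by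
    rw [setIntegral_eq_integral_of_forall_compl_eq_zero]
    intro x hx
    by_contra hne
    have hφx : φ x ≠ 0 := right_ne_zero_of_mul hne
    have hx2 : x.2 ∈ Ioo M.b M.d := (hs (subset_tsupport _ hφx)).2
    have hx1 := hN x (subset_tsupport _ hφx)
    apply hx
    have h1 : ((⌈x.1 / M.p⌉ : ℝ) - 1) < x.1 / M.p := by linarith [Int.ceil_lt_add_one (x.1 / M.p)]
    have h2 : x.1 / M.p ≤ ⌈x.1 / M.p⌉ := Int.le_ceil _
    rw [lt_div_iff₀ hp] at h1
    rw [div_le_iff₀ hp] at h2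
    simp only [mem_iUnion]
    -- The cells are open on the left and closed on the right, so the index is the ceiling minus one
    -- rather than the floor.
    refine ⟨⌈x.1 / M.p⌉ - 1, ?_, ?_, hx2⟩
    · rw [Finset.mem_Ico]
      constructor
      · have h3 : (-(N : ℤ)) < ⌈x.1 / M.p⌉ := Int.lt_ceil.2 (by
          push_cast; rw [lt_div_iff₀ hp]; linarith [hx1.1])
        linarith
      · have h3 : ⌈x.1 / M.p⌉ ≤ (N : ℤ) := Int.ceil_le.2 (by
          push_cast; rw [div_le_iff₀ hp]; linarith [hx1.2])
        linarith
    · push_cast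
      exact ⟨h1, by linarith⟩
  rw [hU, integral_biUnion_finset _ (fun m _ => hSm m) ?_ (fun m _ => hint m)]
  · simp only [fold, Finset.mul_sum]
    rw [integral_finsetSum _ fun m _ => hint0 m]
    exact Finset.sum_congr rfl fun m _ => hval m
  · intro m _ m' _ hmm
    have h3 := Set.pairwise_disjoint_Ioc_zsmul M.p hmm
    simp only [Function.onFun, zsmul_eq_mul] at h3
    push_cast at h3
    exact Set.disjoint_left.2 fun x hx hx' => Set.disjoint_left.1 h3 hx.1 hx'.1

lemma exists_fold_bound {φ : ℝ × ℝ → ℂ} (hs : HasCompactSupport φ) :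
    ∃ N : ℕ, ∀ x ∈ tsupport φ, x.1 ∈ Ioo (-(N * M.p)) (N * M.p) := by
  obtain ⟨R, hR⟩ := hs.isCompact.isBounded.exists_norm_le
  obtain ⟨N, hN⟩ := exists_nat_gt (R / M.p)
  rw [div_lt_iff₀ M.p_pos] at hN
  refine ⟨N, fun x hx => ?_⟩
  have h1 := (norm_fst_le x).trans (hR x hx)
  rw [Real.norm_eq_abs, abs_le] at h1
  constructor <;> linarith [h1.1, h1.2]

variable (M a)

/-- The weak derivative relation, with test functions folded onto the cell. -/
def CellWeak (e : ℝ × ℝ) (u g : ℝ × ℝ → ℂ) : Prop :=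
  ∀ φ : ℝ × ℝ → ℂ, ContDiff ℝ ∞ φ → HasCompactSupport φ → tsupport φ ⊆ strip M → ∀ N : ℕ,
    (∀ x ∈ tsupport φ, x.1 ∈ Ioo (-(N * M.p)) (N * M.p)) →
    ∫ x in cell M, u x * fold M a N (fun x => fderiv ℝ φ x e) x =
      -∫ x in cell M, g x * fold M a N φ x

variable {M a}

lemma IsWeakPartial.cellWeak {e : ℝ × ℝ} {u g : ℝ × ℝ → ℂ} (hq : IsQuasiPeriodic M a u)
    (hu : MemLp u 2 (volume.restrict (cell M))) (h : IsWeakPartial M a e u g) :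
    CellWeak M a e u g := by
  intro φ h1 h2 h3 N hN
  have hsub : tsupport (fun x => fderiv ℝ φ x e) ⊆ tsupport φ := tsupport_fderiv_apply_subset ℝ e
  rw [← integral_mul_eq_integral_fold hq hu
      ((h1.continuous_fderiv (by simp)).clm_apply continuous_const) (hsub.trans h3)
      fun x hx => hN x (hsub hx),
    ← integral_mul_eq_integral_fold h.1 h.2.1 h1.continuous h3 hN]
  exact h.2.2 φ h1 h2 h3

lemma CellWeak.isWeakPartial {e : ℝ × ℝ} {u g : ℝ × ℝ → ℂ} (hqu : IsQuasiPeriodic M a u)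
    (hu : MemLp u 2 (volume.restrict (cell M))) (hqg : IsQuasiPeriodic M a g)
    (hg : MemLp g 2 (volume.restrict (cell M))) (h : CellWeak M a e u g) :
    IsWeakPartial M a e u g := by
  refine ⟨hqg, hg, fun φ h1 h2 h3 => ?_⟩
  obtain ⟨N, hN⟩ := exists_fold_bound (M := M) h2
  have hsub : tsupport (fun x => fderiv ℝ φ x e) ⊆ tsupport φ := tsupport_fderiv_apply_subset ℝ e
  rw [integral_mul_eq_integral_fold hqu hu
      ((h1.continuous_fderiv (by simp)).clm_apply continuous_const) (hsub.trans h3)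
      fun x hx => hN x (hsub hx),
    integral_mul_eq_integral_fold hqg hg h1.continuous h3 hN]
  exact h φ h1 h2 h3 N hN

/-- This is the gain from folding: the relation depends only on almost-everywhere classes on the
cell, so it makes sense for elements of `L²(C)`. -/
lemma CellWeak.congr_ae {e : ℝ × ℝ} {u g u' g' : ℝ × ℝ → ℂ} (h : CellWeak M a e u g)
    (hu : u =ᵐ[volume.restrict (cell M)] u') (hg : g =ᵐ[volume.restrict (cell M)] g') :
    CellWeak M a e u' g' := by
  intro φ h1 h2 h3 N hN
  have e1 : ∫ x in cell M, u' x * fold M a N (fun x => fderiv ℝ φ x e) x =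
      ∫ x in cell M, u x * fold M a N (fun x => fderiv ℝ φ x e) x :=
    integral_congr_ae (hu.mono fun x hx => by simp only [hx])
  have e2 : ∫ x in cell M, g' x * fold M a N φ x = ∫ x in cell M, g x * fold M a N φ x :=
    integral_congr_ae (hg.mono fun x hx => by simp only [hx])
  rw [e1, e2]
  exact h φ h1 h2 h3 N hN

/-! ### Quasi-periodic extension -/

variable (M a) in
/-- The `a`-quasi-periodic extension of a function on the cell. -/
def qpExt (u : ℝ × ℝ → ℂ) (x : ℝ × ℝ) : ℂ :=
  shiftFactor M a ⌊x.1 / M.p⌋ * u (x.1 - ⌊x.1 / M.p⌋ * M.p, x.2)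

lemma qpExt_eq {u : ℝ × ℝ → ℂ} {x : ℝ × ℝ} (hx : x ∈ cell M) : qpExt M a u x = u x := by
  have : ⌊x.1 / M.p⌋ = 0 := by
    rw [Int.floor_eq_zero_iff]
    exact ⟨div_nonneg hx.1.1.le M.p_pos.le, (div_lt_one M.p_pos).2 hx.1.2⟩
  simp [qpExt, this, shiftFactor]

lemma isQuasiPeriodic_qpExt (u : ℝ × ℝ → ℂ) : IsQuasiPeriodic M a (qpExt M a u) := by
  intro x₂ _ x₁
  have hp := M.p_pos.ne'
  have e : (x₁ + M.p) / M.p = x₁ / M.p + 1 := by field_simp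
  simp only [qpExt, e, Int.floor_add_one, shiftFactor]
  have e2 : x₁ + M.p - ((⌊x₁ / M.p⌋ + 1 : ℤ) : ℝ) * M.p = x₁ - ⌊x₁ / M.p⌋ * M.p := by
    push_cast; ring
  rw [e2, mul_right_comm, mul_right_comm (Complex.exp _) _ (Complex.exp _), ← Complex.exp_add,
    ← Complex.exp_add]
  congr 2
  push_cast; ring

lemma qpExt_ae_eq (u : ℝ × ℝ → ℂ) : u =ᵐ[volume.restrict (cell M)] qpExt M a u := by
  filter_upwards [ae_restrict_mem measurableSet_cell] with x hx
  rw [qpExt_eq hx]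

/-! ### Mode-wise consequences of the weak relation -/

section Modes

variable {k θ : ℝ}

/-- A smooth function whose translates by periods sum up to one. -/
def unitCutoff (M : Medium) (x : ℝ) : ℝ :=
  Real.smoothTransition (x / M.p) - Real.smoothTransition (x / M.p - 1)

lemma contDiff_unitCutoff : ContDiff ℝ ∞ (unitCutoff M) := by
  have h : ContDiff ℝ ∞ Real.smoothTransition := Real.smoothTransition.contDiff
  have h1 : ContDiff ℝ ∞ fun x : ℝ => x / M.p := contDiff_id.div_const _
  exact (h.comp h1).sub (h.comp (h1.sub contDiff_const))

lemma tsupport_unitCutoff_subset : tsupport (unitCutoff M) ⊆ Icc 0 (2 * M.p) := by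
  have hp := M.p_pos
  refine closure_minimal (fun x hx => ?_) isClosed_Icc
  by_contra hn
  apply hx
  rw [mem_Icc, not_and_or, not_le, not_le] at hn
  rcases hn with hn | hn
  · have : x / M.p ≤ 0 := div_nonpos_of_nonpos_of_nonneg hn.le hp.le
    rw [unitCutoff, Real.smoothTransition.zero_of_nonpos this,
      Real.smoothTransition.zero_of_nonpos (by linarith), sub_zero]
  · have : 2 ≤ x / M.p := by rw [le_div_iff₀ hp]; exact hn.le
    rw [unitCutoff, Real.smoothTransition.one_of_one_le (by linarith),
      Real.smoothTransition.one_of_one_le (by linarith), sub_self]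

/-- The sum telescopes to `s(x/p + 2) - s(x/p - 4) = 1 - 0`, with `s` the smooth transition. Three
cells on either side are needed because the support reaches `2p`, which must lie in the open
interval `(-Np, Np)`. -/
lemma sum_unitCutoff {x : ℝ} (hx : x ∈ Ioo 0 M.p) :
    ∑ m ∈ Finset.Ico (-((3 : ℕ) : ℤ)) (3 : ℕ), unitCutoff M (x + m * M.p) = 1 := by
  have hp := M.p_pos
  have h0 : 0 < x / M.p := div_pos hx.1 hp
  have h1 : x / M.p < 1 := (div_lt_one hp).2 hx.2
  have e : ∀ m : ℝ, (x + m * M.p) / M.p = x / M.p + m := fun m => by field_simp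
  have hI : Finset.Ico (-((3 : ℕ) : ℤ)) (3 : ℕ) = {-3, -2, -1, 0, 1, 2} := by decide
  rw [hI]
  simp only [unitCutoff, e]
  rw [Finset.sum_insert (by decide), Finset.sum_insert (by decide), Finset.sum_insert (by decide),
    Finset.sum_insert (by decide), Finset.sum_insert (by decide), Finset.sum_singleton]
  push_cast
  have z : ∀ y, y ≤ 0 → Real.smoothTransition y = 0 := fun y => Real.smoothTransition.zero_of_nonpos
  have o : ∀ y, 1 ≤ y → Real.smoothTransition y = 1 := fun y => Real.smoothTransition.one_of_one_le
  rw [z (x / M.p + -3) (by linarith), z (x / M.p + -3 - 1) (by linarith),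
    z (x / M.p + -2) (by linarith), z (x / M.p + -2 - 1) (by linarith),
    z (x / M.p + -1) (by linarith), z (x / M.p + -1 - 1) (by linarith),
    z (x / M.p + 0 - 1) (by linarith), o (x / M.p + 1) (by linarith),
    o (x / M.p + 2) (by linarith), o (x / M.p + 2 - 1) (by linarith)]
  simp

lemma sum_deriv_unitCutoff {x : ℝ} (hx : x ∈ Ioo 0 M.p) :
    ∑ m ∈ Finset.Ico (-((3 : ℕ) : ℤ)) (3 : ℕ), deriv (unitCutoff M) (x + m * M.p) = 0 := by
  have hd : Differentiable ℝ (unitCutoff M) := contDiff_unitCutoff.differentiable (by simp)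
  have h1 : HasDerivAt (fun x => ∑ m ∈ Finset.Ico (-((3 : ℕ) : ℤ)) (3 : ℕ),
      unitCutoff M (x + m * M.p))
      (∑ m ∈ Finset.Ico (-((3 : ℕ) : ℤ)) (3 : ℕ), deriv (unitCutoff M) (x + m * M.p)) x := by
    refine HasDerivAt.fun_sum fun m _ => ?_
    exact (hd (x + m * M.p)).hasDerivAt.comp_add_const x (m * M.p)
  have h2 : HasDerivAt (fun x => ∑ m ∈ Finset.Ico (-((3 : ℕ) : ℤ)) (3 : ℕ),
      unitCutoff M (x + m * M.p)) 0 x := by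
    refine (hasDerivAt_const x (1 : ℝ)).congr_of_eventuallyEq ?_
    filter_upwards [Ioo_mem_nhds hx.1 hx.2] with y hy
    exact sum_unitCutoff hy
  exact h1.unique h2

/-- The test function `χ(x₁) e^{-i α_n x₁} ψ(x₂)`. -/
def modeTest (M : Medium) (k θ : ℝ) (n : ℤ) (ψ : ℝ → ℝ) (x : ℝ × ℝ) : ℂ :=
  unitCutoff M x.1 * mode M k θ n x.1 * ψ x.2

lemma hasDerivAt_mode (n : ℤ) (x : ℝ) :
    HasDerivAt (mode M k θ n) (-(Complex.I * alpha M k θ n) * mode M k θ n x) x := by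
  have h1 : HasDerivAt (fun y : ℝ => -(Complex.I * alpha M k θ n * (y : ℂ)))
      (-(Complex.I * alpha M k θ n * 1)) x :=
    ((Complex.ofRealCLM.hasDerivAt (x := x)).const_mul _).neg
  have := h1.cexp
  rw [mul_one] at this
  rw [mul_comm]
  exact this

variable {n : ℤ} {ψ : ℝ → ℝ}

lemma contDiff_mode : ContDiff ℝ ∞ (mode M k θ n) := by
  unfold mode
  exact Complex.contDiff_exp.comp (contDiff_const.mul Complex.ofRealCLM.contDiff).neg

lemma contDiff_modeTest (hψ : ContDiff ℝ ∞ ψ) : ContDiff ℝ ∞ (modeTest M k θ n ψ) :=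
  ((Complex.ofRealCLM.contDiff.comp (contDiff_unitCutoff.comp contDiff_fst)).mul
    (contDiff_mode.comp contDiff_fst)).mul (Complex.ofRealCLM.contDiff.comp (hψ.comp contDiff_snd))

lemma tsupport_modeTest_subset : tsupport (modeTest M k θ n ψ) ⊆ Icc 0 (2 * M.p) ×ˢ tsupport ψ := by
  refine closure_minimal (fun x hx => ?_) (isClosed_Icc.prod (isClosed_tsupport _))
  rw [Function.mem_support, modeTest] at hx
  refine ⟨tsupport_unitCutoff_subset (subset_tsupport _ fun h => hx ?_),
    subset_tsupport _ fun h => hx ?_⟩ <;> simp [h]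

lemma fderiv_modeTest (hψ : ContDiff ℝ ∞ ψ) (x : ℝ × ℝ) :
    fderiv ℝ (modeTest M k θ n ψ) x (1, 0) =
      (deriv (unitCutoff M) x.1 - Complex.I * alpha M k θ n * unitCutoff M x.1)
        * mode M k θ n x.1 * ψ x.2 ∧
    fderiv ℝ (modeTest M k θ n ψ) x (0, 1) =
      unitCutoff M x.1 * mode M k θ n x.1 * deriv ψ x.2 := by
  have hd := ((contDiff_modeTest (M := M) (k := k) (θ := θ) (n := n) hψ).differentiable
    (by simp) x).hasFDerivAt
  have hu : HasDerivAt (unitCutoff M) (deriv (unitCutoff M) x.1) x.1 :=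
    (contDiff_unitCutoff.differentiable (by simp) _).hasDerivAt
  have hψd : HasDerivAt ψ (deriv ψ x.2) x.2 := (hψ.differentiable (by simp) _).hasDerivAt
  constructor
  · have h1 : HasDerivAt (fun s : ℝ => (s, x.2)) ((1 : ℝ), (0 : ℝ)) x.1 :=
      (hasDerivAt_id x.1).prodMk (hasDerivAt_const _ _)
    have h2 := hd.comp_hasDerivAt x.1 h1
    have h3 : HasDerivAt (fun s : ℝ => (unitCutoff M s : ℂ) * mode M k θ n s * ψ x.2) _ x.1 :=
      (hu.ofReal_comp.mul (hasDerivAt_mode n x.1)).mul_const (ψ x.2 : ℂ)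
    rw [h2.unique h3]
    ring
  · have h1 : HasDerivAt (fun s : ℝ => (x.1, s)) ((0 : ℝ), (1 : ℝ)) x.2 :=
      (hasDerivAt_const _ _).prodMk (hasDerivAt_id x.2)
    have h2 := hd.comp_hasDerivAt x.2 h1
    have h3 : HasDerivAt (fun s : ℝ => (unitCutoff M x.1 : ℂ) * mode M k θ n x.1 * ψ s) _ x.2 :=
      hψd.ofReal_comp.const_mul ((unitCutoff M x.1 : ℂ) * mode M k θ n x.1)
    exact h2.unique h3

/-- Since `α_n - α_0` is a multiple of `2π/p`, the phases cancel up to `e^{-2πi n m} = 1`; every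
mode has the same quasi-periodicity. -/
lemma shiftFactor_mul_mode (m : ℤ) (x : ℝ) :
    shiftFactor M (alpha M k θ 0) m * mode M k θ n (x + m * M.p) = mode M k θ n x := by
  have hp : (M.p : ℂ) ≠ 0 := by exact_mod_cast M.p_pos.ne'
  rw [shiftFactor, mode, mode, ← Complex.exp_add, Complex.exp_eq_exp_iff_exists_int]
  refine ⟨-(n * m), ?_⟩
  simp only [alpha]
  push_cast
  field_simp
  ring

lemma fold_mul_mode (c : ℝ → ℂ) (s : ℝ → ℝ) (x : ℝ × ℝ) :
    fold M (alpha M k θ 0) 3 (fun x => c x.1 * mode M k θ n x.1 * s x.2) x =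
      (∑ m ∈ Finset.Ico (-((3 : ℕ) : ℤ)) (3 : ℕ), c (x.1 + m * M.p)) *
        (mode M k θ n x.1 * s x.2) := by
  rw [fold, Finset.sum_mul]
  refine Finset.sum_congr rfl fun m _ => ?_
  simp only [Prod.fst_add, Prod.snd_add, add_zero]
  rw [← shiftFactor_mul_mode (M := M) (k := k) (θ := θ) (n := n) m x.1]
  ring

/-- Under folding the cutoff sums to one and its derivative to zero, so only the derivative of the
exponential survives. -/
lemma fold_fderiv_fst (hψ : ContDiff ℝ ∞ ψ) {x : ℝ × ℝ} (hx : x ∈ cell M) :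
    fold M (alpha M k θ 0) 3 (fun x => fderiv ℝ (modeTest M k θ n ψ) x (1, 0)) x =
      -(Complex.I * alpha M k θ n) * (mode M k θ n x.1 * ψ x.2) := by
  have e : (fun x => fderiv ℝ (modeTest M k θ n ψ) x (1, 0)) = fun x =>
      (fun y : ℝ => (((deriv (unitCutoff M) y : ℝ) : ℂ) - Complex.I * alpha M k θ n * unitCutoff M y)) x.1
      * mode M k θ n x.1 * ψ x.2 := funext fun x => by rw [(fderiv_modeTest hψ x).1]
  rw [e, fold_mul_mode (M := M) (k := k) (θ := θ) (n := n)
    (fun y : ℝ => (((deriv (unitCutoff M) y : ℝ) : ℂ) - Complex.I * alpha M k θ n * unitCutoff M y)) ψ x]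
  have hs : ∑ m ∈ Finset.Ico (-((3 : ℕ) : ℤ)) (3 : ℕ), (unitCutoff M (x.1 + m * M.p) : ℂ) = 1 := by
    exact_mod_cast sum_unitCutoff (M := M) hx.1
  have hs' : ∑ m ∈ Finset.Ico (-((3 : ℕ) : ℤ)) (3 : ℕ),
      ((deriv (unitCutoff M) (x.1 + m * M.p) : ℝ) : ℂ) = 0 := by
    rw [← Complex.ofReal_sum, sum_deriv_unitCutoff (M := M) hx.1, Complex.ofReal_zero]
  rw [Finset.sum_sub_distrib, ← Finset.mul_sum, hs, hs']
  ring

lemma fold_fderiv_snd (hψ : ContDiff ℝ ∞ ψ) {x : ℝ × ℝ} (hx : x ∈ cell M) :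
    fold M (alpha M k θ 0) 3 (fun x => fderiv ℝ (modeTest M k θ n ψ) x (0, 1)) x =
      mode M k θ n x.1 * (deriv ψ x.2 : ℝ) := by
  have e : (fun x => fderiv ℝ (modeTest M k θ n ψ) x (0, 1)) = fun x =>
      (fun y : ℝ => (unitCutoff M y : ℂ)) x.1 * mode M k θ n x.1 * (deriv ψ x.2 : ℝ) :=
    funext fun x => by rw [(fderiv_modeTest hψ x).2]
  rw [e, fold_mul_mode (M := M) (k := k) (θ := θ) (n := n)
    (fun y : ℝ => (unitCutoff M y : ℂ)) (deriv ψ) x]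
  have hs : ∑ m ∈ Finset.Ico (-((3 : ℕ) : ℤ)) (3 : ℕ), (unitCutoff M (x.1 + m * M.p) : ℂ) = 1 := by
    exact_mod_cast sum_unitCutoff (M := M) hx.1
  rw [hs, one_mul]

variable {u g : ℝ × ℝ → ℂ} (hu : MemLp u 2 (volume.restrict (cell M)))
  (hg : MemLp g 2 (volume.restrict (cell M)))
include hu hg

/-- Testing with `χ(x₁) e^{-iα_n x₁} ψ(x₂)` and applying Fubini leaves a relation between slice
coefficients. The pair `γ, η` covers both directions: `-iα_n, ψ` for the horizontal derivative and
`1, ψ'` for the vertical one. -/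
lemma CellWeak.mode_relation {e : ℝ × ℝ} (h : CellWeak M (alpha M k θ 0) e u g) {γ : ℂ}
    {η : ℝ → ℝ} (hψ : ContDiff ℝ ∞ ψ) (hψc : HasCompactSupport ψ) (hψs : tsupport ψ ⊆ Ioo M.b M.d)
    (hη : Continuous η) (hηc : HasCompactSupport η)
    (hf : ∀ x ∈ cell M, fold M (alpha M k θ 0) 3 (fun x => fderiv ℝ (modeTest M k θ n ψ) x e) x =
      γ * (mode M k θ n x.1 * η x.2)) :
    γ * ∫ t in Ioo M.b M.d, sliceCoeff M k θ u n t * η t =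
      -∫ t in Ioo M.b M.d, sliceCoeff M k θ g n t * ψ t := by
  have hp := M.p_pos
  have hpc : (M.p : ℂ) ≠ 0 := by exact_mod_cast hp.ne'
  have hts := tsupport_modeTest_subset (M := M) (k := k) (θ := θ) (n := n) (ψ := ψ)
  have h1 := h (modeTest M k θ n ψ) (contDiff_modeTest hψ)
    ((isCompact_Icc.prod hψc.isCompact).of_isClosed_subset (isClosed_tsupport _) hts)
    (hts.trans (prod_mono (subset_univ _) hψs)) 3 (fun x hx => by
      have := (hts hx).1
      push_cast
      constructor <;> linarith [this.1, this.2])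
  have e1 : ∫ x in cell M, u x * fold M (alpha M k θ 0) 3
      (fun x => fderiv ℝ (modeTest M k θ n ψ) x e) x =
      γ * ∫ x in cell M, u x * (mode M k θ n x.1 * η x.2) := by
    rw [← integral_const_mul]
    refine setIntegral_congr_fun measurableSet_cell fun x hx => ?_
    simp only [hf x hx]; ring
  have e2 : ∫ x in cell M, g x * fold M (alpha M k θ 0) 3 (modeTest M k θ n ψ) x =
      ∫ x in cell M, g x * (mode M k θ n x.1 * ψ x.2) := by
    refine setIntegral_congr_fun measurableSet_cell fun x hx => ?_
    have := fold_mul_mode (M := M) (k := k) (θ := θ) (n := n) (fun x => (unitCutoff M x : ℂ)) ψ x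
    have hs := sum_unitCutoff (M := M) hx.1
    have hs' : ∑ m ∈ Finset.Ico (-((3 : ℕ) : ℤ)) (3 : ℕ), (unitCutoff M (x.1 + m * M.p) : ℂ) = 1 := by
      exact_mod_cast hs
    rw [hs', one_mul] at this
    rw [← this]; rfl
  rw [e1, e2] at h1
  have hI : IsFiniteMeasure (volume.restrict (Ioo M.b M.d)) := inferInstance
  obtain ⟨C, hC⟩ := hηc.exists_bound_of_continuous hη
  obtain ⟨C', hC'⟩ := hψc.exists_bound_of_continuous hψ.continuous
  rw [cell, setIntegral_mul_mode M k θ hI hu n (C := C) (ψ := fun t => (η t : ℂ))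
      (Complex.continuous_ofReal.comp hη).aestronglyMeasurable
      (Eventually.of_forall fun t => by simpa using hC t),
    setIntegral_mul_mode M k θ hI hg n (C := C') (ψ := fun t => (ψ t : ℂ))
      (Complex.continuous_ofReal.comp hψ.continuous).aestronglyMeasurable
      (Eventually.of_forall fun t => by simpa using hC' t)] at h1
  apply mul_left_cancel₀ hpc
  linear_combination h1

lemma CellWeak.sliceCoeff_fst (h : CellWeak M (alpha M k θ 0) (1, 0) u g) (n : ℤ) :
    sliceCoeff M k θ g n =ᵐ[volume.restrict (Ioo M.b M.d)]
      fun t => Complex.I * alpha M k θ n * sliceCoeff M k θ u n t := by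
  have hui := (memLp_sliceCoeff M k θ (I := Ioo M.b M.d) hu n).integrable (by norm_num)
  have hgi := (memLp_sliceCoeff M k θ (I := Ioo M.b M.d) hg n).integrable (by norm_num)
  set γ : ℂ := Complex.I * alpha M k θ n with hγ
  have main := isOpen_Ioo.ae_eq_zero_of_integral_contDiff_smul_eq_zero (μ := volume)
    (U := Ioo M.b M.d) (f := fun t => sliceCoeff M k θ g n t - γ * sliceCoeff M k θ u n t)
    (IntegrableOn.locallyIntegrableOn (hgi.sub (hui.const_mul γ))) ?_
  · rw [EventuallyEq, ae_restrict_iff' measurableSet_Ioo]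
    filter_upwards [main] with t ht hm
    exact sub_eq_zero.1 (ht hm)
  · intro ψ h1 h2 h3
    have key := h.mode_relation hu hg (n := n) (γ := -γ) h1 h2 h3 h1.continuous h2
      (fun x hx => fold_fderiv_fst h1 hx)
    obtain ⟨C, hC⟩ := h2.exists_bound_of_continuous h1.continuous
    have hb : ∀ {φ : ℝ → ℂ}, Integrable φ (volume.restrict (Ioo M.b M.d)) →
        Integrable (fun t => φ t * ψ t) (volume.restrict (Ioo M.b M.d)) := fun hφ =>
      hφ.mul_bdd (c := C) (Complex.continuous_ofReal.comp h1.continuous).aestronglyMeasurable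
        (Eventually.of_forall fun t => by simpa using hC t)
    have h9 : ∫ t, ψ t • (sliceCoeff M k θ g n t - γ * sliceCoeff M k θ u n t) =
        ∫ t in Ioo M.b M.d, ψ t • (sliceCoeff M k θ g n t - γ * sliceCoeff M k θ u n t) := by
      rw [setIntegral_eq_integral_of_forall_compl_eq_zero]
      intro τ hτ
      rw [image_eq_zero_of_notMem_tsupport fun hm => hτ (h3 hm), zero_smul]
    have h10 : ∫ t in Ioo M.b M.d, ψ t • (sliceCoeff M k θ g n t - γ * sliceCoeff M k θ u n t) =
        (∫ t in Ioo M.b M.d, sliceCoeff M k θ g n t * ψ t) -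
          γ * ∫ t in Ioo M.b M.d, sliceCoeff M k θ u n t * ψ t := by
      rw [← integral_const_mul, ← integral_sub (hb hgi) ((hb hui).const_mul γ)]
      congr 1; funext τ; rw [Complex.real_smul]; ring
    rw [h9, h10]
    linear_combination key

lemma CellWeak.sliceCoeff_snd (h : CellWeak M (alpha M k θ 0) (0, 1) u g) (n : ℤ)
    (ψ : ℝ → ℝ) (h1 : ContDiff ℝ ∞ ψ) (h2 : HasCompactSupport ψ) (h3 : tsupport ψ ⊆ Ioo M.b M.d) :
    ∫ t in Ioo M.b M.d, sliceCoeff M k θ u n t * (deriv ψ t : ℝ) =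
      -∫ t in Ioo M.b M.d, sliceCoeff M k θ g n t * ψ t := by
  have key := h.mode_relation hu hg (n := n) (γ := 1) h1 h2 h3
    (h1.continuous_deriv (by simp)) h2.deriv (fun x hx => by
      rw [one_mul]; exact fold_fderiv_snd h1 hx)
  rw [one_mul] at key
  exact key

end Modes

/-! ### Triples of a function and its weak derivatives -/

/-- `u` is a square-integrable function on the cell with weak partial derivatives `g₁, g₂`. -/
structure IsSobolevTriple (M : Medium) (k θ : ℝ) (u g₁ g₂ : ℝ × ℝ → ℂ) : Prop where
  memLp : MemLp u 2 (volume.restrict (cell M))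
  memLp_fst : MemLp g₁ 2 (volume.restrict (cell M))
  memLp_snd : MemLp g₂ 2 (volume.restrict (cell M))
  weak_fst : CellWeak M (alpha M k θ 0) (1, 0) u g₁
  weak_snd : CellWeak M (alpha M k θ 0) (0, 1) u g₂

/-- The value at an end point (`d` if `e = b` and `b` if `e = d`) of the `n`-th Fourier mode of a
function `u` with vertical derivative `g`. -/
def endCoeff (M : Medium) (k θ : ℝ) (e : ℝ) (u g : ℝ × ℝ → ℂ) (n : ℤ) : ℂ :=
  ∫ t in Ioo M.b M.d, (sliceCoeff M k θ u n t * ((1 / (M.d - M.b) : ℝ) : ℂ)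
    + sliceCoeff M k θ g n t * (((t - e) / (M.d - M.b) : ℝ) : ℂ))

section Estimates

variable {M : Medium} {k θ : ℝ} {u g₁ g₂ : ℝ × ℝ → ℂ}

/-- The squared norm of the `n`-th mode. -/
def modeSq (M : Medium) (k θ : ℝ) (u : ℝ × ℝ → ℂ) (n : ℤ) : ℝ :=
  ∫ t in Ioo M.b M.d, ‖sliceCoeff M k θ u n t‖ ^ 2

lemma modeSq_nonneg (n : ℤ) : 0 ≤ modeSq M k θ u n := integral_nonneg fun _ => by positivity

lemma hasSum_modeSq (hu : MemLp u 2 (volume.restrict (cell M))) :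
    HasSum (modeSq M k θ u) (M.p⁻¹ * ∫ x in cell M, ‖u x‖ ^ 2) :=
  hasSum_integral_sq_sliceCoeff M k θ hu

variable (h : IsSobolevTriple M k θ u g₁ g₂)
include h

lemma IsSobolevTriple.modeSq_fst (n : ℤ) :
    modeSq M k θ g₁ n = alpha M k θ n ^ 2 * modeSq M k θ u n := by
  rw [modeSq, modeSq, ← integral_const_mul]
  refine integral_congr_ae ?_
  filter_upwards [h.weak_fst.sliceCoeff_fst h.memLp h.memLp_fst n] with t ht
  rw [ht, norm_mul, norm_mul, Complex.norm_I, one_mul, mul_pow, Complex.norm_real,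
    Real.norm_eq_abs, sq_abs]

lemma IsSobolevTriple.exists_representative (n : ℤ) :
    ∃ F : ℝ → ℂ, Continuous F ∧
      (∀ᵐ t ∂(volume.restrict (Ioo M.b M.d)), sliceCoeff M k θ u n t = F t) ∧
      (∀ s ∈ Icc M.b M.d, ∀ t ∈ Icc M.b M.d,
        ‖F t - F s‖ ^ 2 ≤ |t - s| * modeSq M k θ g₂ n) ∧
      F M.d = endCoeff M k θ M.b u g₂ n ∧ F M.b = endCoeff M k θ M.d u g₂ n :=
  exists_holder_representative M.b_lt_d (memLp_sliceCoeff M k θ h.memLp n)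
    (memLp_sliceCoeff M k θ h.memLp_snd n) (h.weak_snd.sliceCoeff_snd h.memLp h.memLp_snd n)

/-- The trace theorem into `H^{1/2}`, mode by mode. The trace inequality is used on a slab whose
height is comparable to `1/(|α_n| + 1)` for large `|α_n|`. The factor of order `α_n²` which this
puts in front of `modeSq u` is exactly what the horizontal derivative controls. -/
lemma IsSobolevTriple.endCoeff_le {e : ℝ} (he : e = M.b ∨ e = M.d) (n : ℤ) :
    (|alpha M k θ n| + 1) * ‖endCoeff M k θ e u g₂ n‖ ^ 2 ≤ (3 / (M.d - M.b) + 4) *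
      (modeSq M k θ u n + modeSq M k θ g₁ n + modeSq M k θ g₂ n) := by
  have hL : 0 < M.d - M.b := sub_pos.2 M.b_lt_d
  obtain ⟨F, -, hF, hH, hd, hb⟩ := h.exists_representative n
  have hf := memLp_sliceCoeff M k θ h.memLp n
  set L := M.d - M.b with hLdef
  set κ := |alpha M k θ n| + 1 with hκ
  have hκ1 : 1 ≤ κ := by rw [hκ]; linarith [abs_nonneg (alpha M k θ n)]
  -- Equivalently `1/η = 1/L + κ`, so the slab fits into the cell (`η ≤ L`) and `κ η ≤ 1`.
  set η := L / (1 + κ * L) with hη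
  have hpos : 0 < 1 + κ * L := by positivity
  have hη0 : 0 < η := by positivity
  have hηL : η ≤ L := by rw [hη, div_le_iff₀ hpos]; nlinarith [mul_pos hL hL]
  have hκη : κ * η ≤ 1 := by
    rw [hη, ← mul_div_assoc, div_le_one hpos]; linarith
  have key : η * ‖endCoeff M k θ e u g₂ n‖ ^ 2 ≤
      2 * modeSq M k θ u n + 2 * η ^ 2 * modeSq M k θ g₂ n := by
    rcases he with rfl | rfl
    · rw [← hd]
      refine trace_inequality hf hF (modeSq_nonneg n) hH (x := M.d - η)
        (right_mem_Icc.2 M.b_lt_d.le) hη0.le ?_ ?_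
      · intro t ht; constructor <;> linarith [ht.1, ht.2]
      · intro t ht; rw [abs_le]; constructor <;> linarith [ht.1, ht.2]
    · rw [← hb]
      refine trace_inequality hf hF (modeSq_nonneg n) hH (x := M.b)
        (left_mem_Icc.2 M.b_lt_d.le) hη0.le ?_ ?_
      · intro t ht; constructor <;> linarith [ht.1, ht.2]
      · intro t ht; rw [abs_le]; constructor <;> linarith [ht.1, ht.2]
  have hU := modeSq_nonneg (M := M) (k := k) (θ := θ) (u := u) n
  have hG := modeSq_nonneg (M := M) (k := k) (θ := θ) (u := g₂) n
  have hG1 := h.modeSq_fst n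
  set E := ‖endCoeff M k θ e u g₂ n‖ ^ 2
  set U := modeSq M k θ u n
  set G := modeSq M k θ g₂ n
  rw [hG1]
  have hα : κ ^ 2 ≤ 2 * alpha M k θ n ^ 2 + 2 := by
    rw [hκ, ← sq_abs (alpha M k θ n)]; nlinarith [sq_nonneg (|alpha M k θ n| - 1)]
  have h1 : κ * E ≤ 2 * κ * (1 / L + κ) * U + 2 * (κ * η) * G := by
    have h2 : κ * (η * E) ≤ κ * (2 * U + 2 * η ^ 2 * G) := by gcongr
    have h3 : 1 / L + κ = 1 / η := by rw [hη]; field_simp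
    rw [h3]
    have h4 : κ * E = κ * (η * E) / η := by field_simp
    rw [h4, div_le_iff₀ hη0]
    refine h2.trans (le_of_eq ?_)
    field_simp
  have h5 : 2 * κ * (1 / L + κ) * U ≤ (3 / L + 4) * (U + alpha M k θ n ^ 2 * U) := by
    have h6 : 2 * κ ≤ 3 + 2 * alpha M k θ n ^ 2 := by nlinarith [sq_nonneg (κ - 1)]
    have h7 : 2 * κ * (1 / L + κ) ≤ (3 / L + 4) * (1 + alpha M k θ n ^ 2) := by
      have h8 : 2 * κ * (1 / L) ≤ (3 + 2 * alpha M k θ n ^ 2) * (1 / L) := by gcongr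
      have h9 : 0 ≤ alpha M k θ n ^ 2 * (1 / L) := by positivity
      have : 3 / L = 3 * (1 / L) := by ring
      rw [this]
      nlinarith
    calc _ ≤ (3 / L + 4) * (1 + alpha M k θ n ^ 2) * U := by gcongr
      _ = _ := by ring
  have h10 : 2 * (κ * η) * G ≤ (3 / L + 4) * G := by
    have : 0 ≤ 3 / L := by positivity
    have : 2 * (κ * η) ≤ 3 / L + 4 := by linarith
    gcongr
  calc κ * E ≤ _ := h1
    _ ≤ (3 / L + 4) * (U + alpha M k θ n ^ 2 * U) + (3 / L + 4) * G := add_le_add h5 h10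
    _ = _ := by ring

lemma IsSobolevTriple.summable_endCoeff {e : ℝ} (he : e = M.b ∨ e = M.d) :
    Summable (fun n => (|alpha M k θ n| + 1) * ‖endCoeff M k θ e u g₂ n‖ ^ 2) ∧
    ∑' n, (|alpha M k θ n| + 1) * ‖endCoeff M k θ e u g₂ n‖ ^ 2 ≤
      (3 / (M.d - M.b) + 4) * (M.p⁻¹ * ((∫ x in cell M, ‖u x‖ ^ 2) + (∫ x in cell M, ‖g₁ x‖ ^ 2)
        + ∫ x in cell M, ‖g₂ x‖ ^ 2)) := by
  have hs := (((hasSum_modeSq (k := k) (θ := θ) h.memLp).add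
    (hasSum_modeSq (k := k) (θ := θ) h.memLp_fst)).add
    (hasSum_modeSq (k := k) (θ := θ) h.memLp_snd)).mul_left (3 / (M.d - M.b) + 4)
  have h1 := Summable.of_nonneg_of_le (fun n => by positivity) (h.endCoeff_le he) hs.summable
  refine ⟨h1, (h1.tsum_le_tsum (h.endCoeff_le he) hs.summable).trans (le_of_eq ?_)⟩
  rw [hs.tsum_eq]; ring

/-- Poincaré's inequality on the cell. -/
lemma IsSobolevTriple.poincare {K : ℝ} (hK : 0 < K) (hα : ∀ n ≠ 0, K ≤ |alpha M k θ n|) :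
    ∫ x in cell M, ‖u x‖ ^ 2 ≤ (1 / K ^ 2 + 2 * (M.d - M.b) ^ 2) *
      ((∫ x in cell M, ‖g₁ x‖ ^ 2) + ∫ x in cell M, ‖g₂ x‖ ^ 2)
      + 2 * (M.d - M.b) * M.p * ‖endCoeff M k θ M.b u g₂ 0‖ ^ 2 := by
  have hp := M.p_pos
  have hL : 0 < M.d - M.b := sub_pos.2 M.b_lt_d
  have hs1 := hasSum_modeSq (k := k) (θ := θ) h.memLp
  have hs2 := (((hasSum_modeSq (k := k) (θ := θ) h.memLp_fst).add
    (hasSum_modeSq (k := k) (θ := θ) h.memLp_snd)).mul_left (1 / K ^ 2 + 2 * (M.d - M.b) ^ 2)).add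
    (hasSum_ite_eq (0 : ℤ) (2 * (M.d - M.b) * ‖endCoeff M k θ M.b u g₂ 0‖ ^ 2))
  have hle : ∀ n, modeSq M k θ u n ≤ (1 / K ^ 2 + 2 * (M.d - M.b) ^ 2) *
      (modeSq M k θ g₁ n + modeSq M k θ g₂ n) +
      (if n = 0 then 2 * (M.d - M.b) * ‖endCoeff M k θ M.b u g₂ 0‖ ^ 2 else 0) := by
    intro n
    have hU := modeSq_nonneg (M := M) (k := k) (θ := θ) (u := u) n
    have hG1 := modeSq_nonneg (M := M) (k := k) (θ := θ) (u := g₁) n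
    have hG := modeSq_nonneg (M := M) (k := k) (θ := θ) (u := g₂) n
    -- For `n ≠ 0` the horizontal derivative controls the mode because `|α_n| ≥ K`. For `n = 0` that
    -- control may degenerate, so the vertical derivative and the value at `d` are used.
    by_cases hn : n = 0
    · subst hn
      rw [if_pos rfl]
      obtain ⟨F, -, hF, hH, hd, -⟩ := h.exists_representative 0
      have := poincare_interval M.b_lt_d (memLp_sliceCoeff M k θ h.memLp 0) hF (modeSq_nonneg 0) hH
      rw [hd] at this
      change modeSq M k θ u 0 ≤ _ at this
      have h2 : 0 ≤ 1 / K ^ 2 * (modeSq M k θ g₁ 0 + modeSq M k θ g₂ 0) := by positivity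
      have h3 : 0 ≤ 2 * (M.d - M.b) ^ 2 * modeSq M k θ g₁ 0 := by positivity
      linarith
    · rw [if_neg hn, add_zero]
      have h1 : K ^ 2 ≤ alpha M k θ n ^ 2 := by
        rw [← sq_abs (alpha M k θ n)]; have := hα n hn; gcongr
      have h2 : modeSq M k θ u n ≤ 1 / K ^ 2 * modeSq M k θ g₁ n := by
        rw [h.modeSq_fst, one_div, ← div_eq_inv_mul, le_div_iff₀ (by positivity), mul_comm]
        gcongr
      have h3 : 0 ≤ 1 / K ^ 2 * modeSq M k θ g₂ n := by positivity
      have h4 : 0 ≤ 2 * (M.d - M.b) ^ 2 * (modeSq M k θ g₁ n + modeSq M k θ g₂ n) := by positivity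
      linarith
  have := hasSum_le hle hs1 hs2
  rw [inv_mul_le_iff₀ hp] at this
  refine this.trans (le_of_eq ?_)
  field_simp

end Estimates

/-! ### Traces -/

section Traces

variable {M : Medium} {k θ : ℝ}

lemma memLp_integral_snd {w : ℝ × ℝ → ℂ} (hw : MemLp w 2 (volume.restrict (cell M))) :
    MemLp (fun x => ∫ t in Ioo M.b M.d, w (x, t)) 2 (volume.restrict (Ioo 0 M.p)) := by
  have h1 := hw.integrable_norm_pow (by norm_num)
  have h0 := hw.1
  rw [cell, volume_restrict_prod] at h1 h0
  have hm : AEStronglyMeasurable (fun x => ∫ t in Ioo M.b M.d, w (x, t))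
    (volume.restrict (Ioo 0 M.p)) := h0.integral_prod_right'
  refine (memLp_two_iff_integrable_sq_norm hm).2 ?_
  refine (h1.integral_prod_left.const_mul (M.d - M.b)).mono' (hm.norm.pow 2) ?_
  filter_upwards [h1.prod_right_ae, h0.prodMk_left] with x hx hx'
  have hs : MemLp (fun t => w (x, t)) 2 (volume.restrict (Ioo M.b M.d)) :=
    (memLp_two_iff_integrable_sq_norm hx').2 hx
  have := sq_norm_integral_le hs (left_mem_Icc.2 M.b_lt_d.le) (right_mem_Icc.2 M.b_lt_d.le)
  rw [intervalIntegral.integral_of_le M.b_lt_d.le, integral_Ioc_eq_integral_Ioo,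
    abs_of_pos (sub_pos.2 M.b_lt_d)] at this
  rw [Real.norm_of_nonneg (by positivity)]
  exact this

lemma coeff_integral_snd {w : ℝ × ℝ → ℂ} (hw : MemLp w 2 (volume.restrict (cell M))) (n : ℤ) :
    coeff M k θ (fun x => ∫ t in Ioo M.b M.d, w (x, t)) n =
      ∫ t in Ioo M.b M.d, sliceCoeff M k θ w n t := by
  have := isFiniteMeasure_cell (M := M)
  have h1 := hw.integrable (q := 2) (by norm_num)
  have h2 : Integrable (fun x : ℝ × ℝ => w x * mode M k θ n x.1) (volume.restrict (cell M)) :=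
    h1.mul_bdd (c := 1) ((continuous_mode M k θ n).comp continuous_fst).aestronglyMeasurable
      (Eventually.of_forall fun x => (norm_mode M k θ n x.1).le)
  rw [cell, volume_restrict_prod] at h2
  simp only [sliceCoeff, coeff_eq_setIntegral]
  rw [integral_const_mul]
  congr 1
  have h3 := integral_integral_swap (f := fun x t => w (x, t) * mode M k θ n x) h2
  rw [← h3]
  congr 1; funext x
  rw [integral_mul_const]

/-- Linearity of slice coefficients almost everywhere. -/
lemma ae_sliceCoeff_sub_fst {u : ℝ × ℝ → ℂ} {I : Set ℝ}
    (hu : MemLp u 2 (volume.restrict (Ioo 0 M.p ×ˢ I))) {f : ℝ → ℂ}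
    (hf : MemLp f 2 (volume.restrict (Ioo 0 M.p))) (n : ℤ) :
    ∀ᵐ t ∂(volume.restrict I), sliceCoeff M k θ (fun x => u x - f x.1) n t =
      sliceCoeff M k θ u n t - coeff M k θ f n := by
  have hb : ∀ {φ : ℝ → ℂ}, MemLp φ 2 (volume.restrict (Ioo 0 M.p)) →
      Integrable (fun x => φ x * mode M k θ n x) (volume.restrict (Ioo 0 M.p)) := fun hφ =>
    (hφ.integrable (q := 2) (by norm_num)).mul_bdd (c := 1)
      (continuous_mode M k θ n).aestronglyMeasurable
      (Eventually.of_forall fun x => (norm_mode M k θ n x).le)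
  filter_upwards [ae_memLp_slice M hu] with t ht
  simp only [sliceCoeff, coeff_eq_setIntegral]
  rw [← mul_sub, ← integral_sub (hb ht) (hb hf)]
  congr 2; funext x; ring

/-- The trace as a weighted vertical mean; see `endCoeff` for `e`. -/
def traceFun (M : Medium) (e : ℝ) (u g : ℝ × ℝ → ℂ) (x : ℝ) : ℂ :=
  ∫ t in Ioo M.b M.d, (u (x, t) * ((1 / (M.d - M.b) : ℝ) : ℂ)
    + g (x, t) * (((t - e) / (M.d - M.b) : ℝ) : ℂ))

lemma memLp_trace_integrand {u g : ℝ × ℝ → ℂ} (hu : MemLp u 2 (volume.restrict (cell M)))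
    (hg : MemLp g 2 (volume.restrict (cell M))) (e : ℝ) :
    MemLp (fun x : ℝ × ℝ => u x * ((1 / (M.d - M.b) : ℝ) : ℂ)
      + g x * (((x.2 - e) / (M.d - M.b) : ℝ) : ℂ)) 2 (volume.restrict (cell M)) := by
  refine (hu.mul_const _).add ?_
  obtain ⟨C, hC⟩ := (isCompact_Icc (a := M.b) (b := M.d)).exists_bound_of_continuousOn
    (f := fun t : ℝ => (((t - e) / (M.d - M.b) : ℝ) : ℂ)) (by fun_prop)
  refine MemLp.of_le_mul (c := C) hg (hg.1.mul (by fun_prop)) ?_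
  filter_upwards [ae_restrict_mem measurableSet_cell] with x hx
  rw [norm_mul, mul_comm]
  gcongr
  exact hC _ (Ioo_subset_Icc_self hx.2)

lemma memLp_traceFun {u g : ℝ × ℝ → ℂ} (hu : MemLp u 2 (volume.restrict (cell M)))
    (hg : MemLp g 2 (volume.restrict (cell M))) (e : ℝ) :
    MemLp (traceFun M e u g) 2 (volume.restrict (Ioo 0 M.p)) :=
  memLp_integral_snd (memLp_trace_integrand hu hg e)

lemma coeff_traceFun {u g : ℝ × ℝ → ℂ} (hu : MemLp u 2 (volume.restrict (cell M)))
    (hg : MemLp g 2 (volume.restrict (cell M))) (e : ℝ) (n : ℤ) :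
    coeff M k θ (traceFun M e u g) n = endCoeff M k θ e u g n := by
  have h1 := coeff_integral_snd (k := k) (θ := θ) (memLp_trace_integrand hu hg e) n
  rw [show traceFun M e u g = _ from rfl, endCoeff]
  refine h1.trans (integral_congr_ae ?_)
  have hb : ∀ {φ : ℝ → ℂ}, MemLp φ 2 (volume.restrict (Ioo 0 M.p)) →
      Integrable (fun x => φ x * mode M k θ n x) (volume.restrict (Ioo 0 M.p)) := fun hφ =>
    (hφ.integrable (q := 2) (by norm_num)).mul_bdd (c := 1)
      (continuous_mode M k θ n).aestronglyMeasurable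
      (Eventually.of_forall fun x => (norm_mode M k θ n x).le)
  filter_upwards [ae_memLp_slice M hu, ae_memLp_slice M hg] with t ht ht'
  simp only [sliceCoeff, coeff_eq_setIntegral]
  have e1 : ∀ x, (u (x, t) * ((1 / (M.d - M.b) : ℝ) : ℂ)
      + g (x, t) * (((t - e) / (M.d - M.b) : ℝ) : ℂ)) * mode M k θ n x =
      (u (x, t) * mode M k θ n x) * ((1 / (M.d - M.b) : ℝ) : ℂ) +
      (g (x, t) * mode M k θ n x) * (((t - e) / (M.d - M.b) : ℝ) : ℂ) := fun x => by ring
  simp only [e1]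
  rw [integral_add ((hb ht).mul_const _) ((hb ht').mul_const _), integral_mul_const,
    integral_mul_const]
  ring

lemma memLp_comp_fst {f : ℝ → ℂ} (hf : MemLp f 2 (volume.restrict (Ioo 0 M.p))) :
    MemLp (fun x : ℝ × ℝ => f x.1) 2 (volume.restrict (cell M)) := by
  rw [cell, volume_restrict_prod]
  exact hf.comp_fst _

/-- On a slab of height `r` every mode stays within `r · modeSq g₂`, in squared modulus, of its end
point value. Integrating over the slab and summing by Parseval bounds the normalised defect by `r
‖g₂‖²`. -/
lemma IsSobolevTriple.tendsto_trace {u g₁ g₂ : ℝ × ℝ → ℂ} (h : IsSobolevTriple M k θ u g₁ g₂)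
    {I : ℝ → Set ℝ} {e e' : ℝ} (hee : (e = M.b ∧ e' = M.d) ∨ (e = M.d ∧ e' = M.b))
    (hI : ∀ h, 0 < h → h < M.d - M.b → MeasurableSet (I h) ∧ I h ⊆ Ioo M.b M.d ∧
      volume.real (I h) = h ∧ ∀ t ∈ I h, |t - e'| ≤ h) :
    IsTrace M I u (traceFun M e u g₂) := by
  have hp := M.p_pos
  have hL : 0 < M.d - M.b := sub_pos.2 M.b_lt_d
  have htr := memLp_traceFun h.memLp h.memLp_snd e
  refine ⟨htr, ?_⟩
  set G := ∫ x in cell M, ‖g₂ x‖ ^ 2 with hG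
  have hub : ∀ᶠ r in 𝓝[>] (0 : ℝ),
      r⁻¹ * ∫ x in Ioo 0 M.p ×ˢ I r, ‖u x - traceFun M e u g₂ x.1‖ ^ 2 ≤ r * G := by
    filter_upwards [Ioo_mem_nhdsGT hL] with r hr
    obtain ⟨i1, i2, i3, i4⟩ := hI r hr.1 hr.2
    have hsub : (Ioo 0 M.p ×ˢ I r : Set (ℝ × ℝ)) ⊆ cell M := prod_mono le_rfl i2
    have hmono := Measure.restrict_mono (μ := (volume : Measure (ℝ × ℝ))) hsub le_rfl
    have hw : MemLp (fun x : ℝ × ℝ => u x - traceFun M e u g₂ x.1) 2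
        (volume.restrict (Ioo 0 M.p ×ˢ I r)) :=
      (h.memLp.sub (memLp_comp_fst htr)).mono_measure hmono
    have hs := hasSum_integral_sq_sliceCoeff M k θ hw
    have hs2 := (hasSum_modeSq (k := k) (θ := θ) h.memLp_snd).mul_left (r * r)
    have hle : ∀ n, ∫ t in I r,
        ‖sliceCoeff M k θ (fun x : ℝ × ℝ => u x - traceFun M e u g₂ x.1) n t‖ ^ 2 ≤
        r * r * modeSq M k θ g₂ n := by
      intro n
      obtain ⟨F, -, hF, hH, hd, hb⟩ := h.exists_representative n
      have hFe : F e' = endCoeff M k θ e u g₂ n ∧ e' ∈ Icc M.b M.d := by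
        rcases hee with ⟨rfl, rfl⟩ | ⟨rfl, rfl⟩
        · exact ⟨hd, right_mem_Icc.2 M.b_lt_d.le⟩
        · exact ⟨hb, left_mem_Icc.2 M.b_lt_d.le⟩
      have hfin : volume (I r) ≠ ⊤ := measure_ne_top_of_subset i2 (by simp)
      have hbound : ∫ t in I r,
          ‖sliceCoeff M k θ (fun x : ℝ × ℝ => u x - traceFun M e u g₂ x.1) n t‖ ^ 2 ≤
          ∫ _ in I r, r * modeSq M k θ g₂ n := by
        refine integral_mono_ae (integrable_sq_sliceCoeff M k θ hw n)
          (integrableOn_const hfin) ?_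
        filter_upwards [ae_sliceCoeff_sub_fst (k := k) (θ := θ) (h.memLp.mono_measure hmono) htr n,
          ae_restrict_of_ae_restrict_of_subset i2 hF, ae_restrict_mem i1] with t ht htF hm
        rw [ht, htF, coeff_traceFun h.memLp h.memLp_snd, ← hFe.1]
        refine (hH e' hFe.2 t (Ioo_subset_Icc_self (i2 hm))).trans ?_
        exact mul_le_mul_of_nonneg_right (i4 t hm) (modeSq_nonneg n)
      rw [setIntegral_const, i3, smul_eq_mul, ← mul_assoc] at hbound
      exact hbound
    have := hasSum_le hle hs hs2
    rw [inv_mul_le_iff₀ hp] at this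
    rw [inv_mul_le_iff₀ hr.1]
    refine this.trans (le_of_eq ?_)
    rw [← hG]
    field_simp
  refine tendsto_of_tendsto_of_tendsto_of_le_of_le' tendsto_const_nhds (h := fun r : ℝ => r * G)
    ?_ ?_ hub
  · have : Tendsto (fun r : ℝ => r * G) (𝓝 0) (𝓝 (0 * G)) :=
      (continuous_id.mul continuous_const).tendsto 0
    rw [zero_mul] at this
    exact this.mono_left nhdsWithin_le_nhds
  · filter_upwards [self_mem_nhdsWithin] with r hr
    have hr' : (0 : ℝ) < r := hr
    have : 0 ≤ ∫ x in Ioo 0 M.p ×ˢ I r, ‖u x - traceFun M e u g₂ x.1‖ ^ 2 :=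
      integral_nonneg fun _ => by positivity
    positivity

/-- The slab mean of `|f - f'|²` does not depend on the height, while the triangle inequality
dominates it by two means that tend to zero. -/
lemma IsTrace.unique {u : ℝ × ℝ → ℂ} (hu : MemLp u 2 (volume.restrict (cell M)))
    {I : ℝ → Set ℝ} (hI : ∀ h, 0 < h → h < M.d - M.b → MeasurableSet (I h) ∧ I h ⊆ Ioo M.b M.d ∧
      volume.real (I h) = h) {f f' : ℝ → ℂ} (hf : IsTrace M I u f) (hf' : IsTrace M I u f') :
    f =ᵐ[volume.restrict (Ioo 0 M.p)] f' := by
  have hL : 0 < M.d - M.b := sub_pos.2 M.b_lt_d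
  set D := ∫ x in Ioo 0 M.p, ‖f x - f' x‖ ^ 2 with hD
  have hDi := (hf.1.sub hf'.1).integrable_norm_pow (p := 2) (by norm_num)
  have hlim : Tendsto (fun h : ℝ => 2 * (h⁻¹ * ∫ x in Ioo 0 M.p ×ˢ I h, ‖u x - f x.1‖ ^ 2) +
      2 * (h⁻¹ * ∫ x in Ioo 0 M.p ×ˢ I h, ‖u x - f' x.1‖ ^ 2)) (𝓝[>] 0) (𝓝 0) := by
    simpa using (hf.2.const_mul 2).add (hf'.2.const_mul 2)
  have hle : ∀ᶠ r in 𝓝[>] (0 : ℝ), D ≤ 2 * (r⁻¹ * ∫ x in Ioo 0 M.p ×ˢ I r, ‖u x - f x.1‖ ^ 2) +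
      2 * (r⁻¹ * ∫ x in Ioo 0 M.p ×ˢ I r, ‖u x - f' x.1‖ ^ 2) := by
    filter_upwards [Ioo_mem_nhdsGT hL] with r hr
    obtain ⟨i1, i2, i3⟩ := hI r hr.1 hr.2
    have hsub : (Ioo 0 M.p ×ˢ I r : Set (ℝ × ℝ)) ⊆ cell M := prod_mono le_rfl i2
    have hmono := Measure.restrict_mono (μ := (volume : Measure (ℝ × ℝ))) hsub le_rfl
    have j1 : Integrable (fun x : ℝ × ℝ => ‖u x - f x.1‖ ^ 2)
        (volume.restrict (Ioo 0 M.p ×ˢ I r)) :=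
      ((hu.sub (memLp_comp_fst hf.1)).mono_measure hmono).integrable_norm_pow (p := 2) (by norm_num)
    have j2 : Integrable (fun x : ℝ × ℝ => ‖u x - f' x.1‖ ^ 2)
        (volume.restrict (Ioo 0 M.p ×ˢ I r)) :=
      ((hu.sub (memLp_comp_fst hf'.1)).mono_measure hmono).integrable_norm_pow (p := 2) (by norm_num)
    have j3 : Integrable (fun x : ℝ × ℝ => ‖f x.1 - f' x.1‖ ^ 2)
        (volume.restrict (Ioo 0 M.p ×ˢ I r)) :=
      (((memLp_comp_fst hf.1).sub (memLp_comp_fst hf'.1)).mono_measure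
        hmono).integrable_norm_pow (p := 2) (by norm_num)
    have e1 : ∫ x in Ioo 0 M.p ×ˢ I r, ‖f x.1 - f' x.1‖ ^ 2 = D * r := by
      have := setIntegral_prod_mul (μ := (volume : Measure ℝ)) (ν := (volume : Measure ℝ))
        (fun x => ‖f x - f' x‖ ^ 2) (fun _ => (1 : ℝ)) (Ioo 0 M.p) (I r)
      simp only [mul_one, setIntegral_const, i3, smul_eq_mul] at this
      exact this
    have e2 : D * r ≤ 2 * (∫ x in Ioo 0 M.p ×ˢ I r, ‖u x - f x.1‖ ^ 2) +
        2 * ∫ x in Ioo 0 M.p ×ˢ I r, ‖u x - f' x.1‖ ^ 2 := by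
      rw [← e1, ← integral_const_mul, ← integral_const_mul,
        ← integral_add (j1.const_mul 2) (j2.const_mul 2)]
      refine integral_mono j3 ((j1.const_mul 2).add (j2.const_mul 2)) fun x => ?_
      have h1 : ‖f x.1 - f' x.1‖ ≤ ‖u x - f x.1‖ + ‖u x - f' x.1‖ := by
        rw [norm_sub_rev (u x) (f x.1)]
        have := norm_add_le (f x.1 - u x) (u x - f' x.1)
        rwa [sub_add_sub_cancel] at this
      show ‖f x.1 - f' x.1‖ ^ 2 ≤ 2 * ‖u x - f x.1‖ ^ 2 + 2 * ‖u x - f' x.1‖ ^ 2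
      nlinarith [norm_nonneg (f x.1 - f' x.1), sq_nonneg (‖u x - f x.1‖ - ‖u x - f' x.1‖)]
    have hr0 : 0 < r := hr.1
    calc D = r⁻¹ * (D * r) := by field_simp
      _ ≤ r⁻¹ * (2 * (∫ x in Ioo 0 M.p ×ˢ I r, ‖u x - f x.1‖ ^ 2) +
        2 * ∫ x in Ioo 0 M.p ×ˢ I r, ‖u x - f' x.1‖ ^ 2) := by gcongr
      _ = _ := by ring
  have hD0 : D ≤ 0 := ge_of_tendsto hlim hle
  have hD1 : D = 0 := le_antisymm hD0 (integral_nonneg fun _ => by positivity)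
  have := (integral_eq_zero_iff_of_nonneg (fun _ => by positivity) hDi).1 hD1
  filter_upwards [this] with x hx
  have : ‖f x - f' x‖ ^ 2 = 0 := hx
  exact sub_eq_zero.1 (norm_eq_zero.1 (pow_eq_zero_iff two_ne_zero |>.1 this))

lemma top_slab {h : ℝ} (h0 : 0 < h) (h1 : h < M.d - M.b) :
    MeasurableSet (Ioo (M.d - h) M.d) ∧ Ioo (M.d - h) M.d ⊆ Ioo M.b M.d ∧
      volume.real (Ioo (M.d - h) M.d) = h ∧ ∀ t ∈ Ioo (M.d - h) M.d, |t - M.d| ≤ h := by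
  refine ⟨measurableSet_Ioo, Ioo_subset_Ioo (by linarith) le_rfl, ?_, fun t ht => ?_⟩
  · rw [Real.volume_real_Ioo_of_le (by linarith)]; ring
  · rw [abs_le]; constructor <;> linarith [ht.1, ht.2]

lemma bottom_slab {h : ℝ} (h0 : 0 < h) (h1 : h < M.d - M.b) :
    MeasurableSet (Ioo M.b (M.b + h)) ∧ Ioo M.b (M.b + h) ⊆ Ioo M.b M.d ∧
      volume.real (Ioo M.b (M.b + h)) = h ∧ ∀ t ∈ Ioo M.b (M.b + h), |t - M.b| ≤ h := by
  refine ⟨measurableSet_Ioo, Ioo_subset_Ioo le_rfl (by linarith), ?_, fun t ht => ?_⟩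
  · rw [Real.volume_real_Ioo_of_le (by linarith)]; ring
  · rw [abs_le]; constructor <;> linarith [ht.1, ht.2]

/-! ### Fourier coefficients of the traces obtained by choice. -/

variable {u g₁ g₂ : ℝ × ℝ → ℂ} (h : IsSobolevTriple M k θ u g₁ g₂)
include h

lemma IsSobolevTriple.topTrace_ae : topTrace M u =ᵐ[volume.restrict (Ioo 0 M.p)]
    traceFun M M.b u g₂ := by
  have h1 : IsTrace M (fun h => Ioo (M.d - h) M.d) u (traceFun M M.b u g₂) :=
    h.tendsto_trace (Or.inl ⟨rfl, rfl⟩) fun _ a b => top_slab a b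
  have h2 : ∃ f, IsTrace M (fun h => Ioo (M.d - h) M.d) u f := ⟨_, h1⟩
  rw [topTrace, dif_pos h2]
  refine IsTrace.unique h.memLp (fun _ a b => ?_) h2.choose_spec h1
  obtain ⟨a1, a2, a3, -⟩ := top_slab a b
  exact ⟨a1, a2, a3⟩

lemma IsSobolevTriple.bottomTrace_ae : bottomTrace M u =ᵐ[volume.restrict (Ioo 0 M.p)]
    traceFun M M.d u g₂ := by
  have h1 : IsTrace M (fun h => Ioo M.b (M.b + h)) u (traceFun M M.d u g₂) :=
    h.tendsto_trace (Or.inr ⟨rfl, rfl⟩) fun _ a b => bottom_slab a b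
  have h2 : ∃ f, IsTrace M (fun h => Ioo M.b (M.b + h)) u f := ⟨_, h1⟩
  rw [bottomTrace, dif_pos h2]
  refine IsTrace.unique h.memLp (fun _ a b => ?_) h2.choose_spec h1
  obtain ⟨a1, a2, a3, -⟩ := bottom_slab a b
  exact ⟨a1, a2, a3⟩

lemma IsSobolevTriple.coeff_topTrace (n : ℤ) :
    coeff M k θ (topTrace M u) n = endCoeff M k θ M.b u g₂ n := by
  rw [coeff_congr_ae M k θ h.topTrace_ae, coeff_traceFun h.memLp h.memLp_snd]

lemma IsSobolevTriple.coeff_bottomTrace (n : ℤ) :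
    coeff M k θ (bottomTrace M u) n = endCoeff M k θ M.d u g₂ n := by
  rw [coeff_congr_ae M k θ h.bottomTrace_ae, coeff_traceFun h.memLp h.memLp_snd]

end Traces

/-! ### The Lax–Milgram theorem for complex Hilbert spaces -/

open scoped InnerProductSpace in
-- Coercivity of `c B` bounds the operator `T` of `B` from below, so `T` is injective with closed
-- range. A vector `w` orthogonal to the range has `B w w = 0` and hence vanishes, so `T` is onto.
-- The rotation `c` enters the coercivity only, not the equation solved.
lemma exists_unique_of_coercive {H : Type*} [NormedAddCommGroup H] [InnerProductSpace ℂ H]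
    [CompleteSpace H] (B : H →L⋆[ℂ] H →L[ℂ] ℂ) (c : ℂ) {δ : ℝ} (hδ : 0 < δ)
    (hB : ∀ x, δ * ‖x‖ ^ 2 ≤ (c * B x x).re) (f : H) :
    ∃ u, (∀ v, B v u = ⟪v, f⟫_ℂ) ∧ ∀ u', (∀ v, B v u' = ⟪v, f⟫_ℂ) → u' = u := by
  set T : H →L[ℂ] H :=
    ContinuousLinearMap.adjoint (InnerProductSpace.continuousLinearMapOfBilin B) with hT
  have hTB : ∀ v u, ⟪v, T u⟫_ℂ = B v u := fun v u => by
    rw [hT, ContinuousLinearMap.adjoint_inner_right,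
      InnerProductSpace.continuousLinearMapOfBilin_apply]
  have hzero : ∀ x, B x x = 0 → x = 0 := fun x hx => by
    have := hB x
    rw [hx, mul_zero, Complex.zero_re] at this
    have h2 : ‖x‖ ^ 2 ≤ 0 := by
      by_contra! h3
      have := mul_pos hδ h3
      linarith
    exact norm_eq_zero.1 (pow_eq_zero_iff two_ne_zero |>.1 (le_antisymm h2 (by positivity)))
  have hbelow : ∀ x, ‖x‖ ≤ (‖c‖ / δ) * ‖T x‖ := fun x => by
    rcases eq_or_ne x 0 with rfl | hx
    · simp
    have hx' : 0 < ‖x‖ := norm_pos_iff.2 hx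
    have h1 := (hB x).trans (Complex.re_le_norm _)
    rw [norm_mul, ← hTB] at h1
    have h2 : ‖c‖ * ‖⟪x, T x⟫_ℂ‖ ≤ ‖c‖ * (‖x‖ * ‖T x‖) := by
      gcongr; exact norm_inner_le_norm _ _
    rw [div_mul_eq_mul_div, le_div_iff₀ hδ]
    have h3 : ‖x‖ * (‖x‖ * δ) ≤ ‖x‖ * (‖c‖ * ‖T x‖) := by nlinarith
    exact le_of_mul_le_mul_left h3 hx'
  have hanti : AntilipschitzWith (‖c‖ / δ).toNNReal T :=
    ContinuousLinearMap.antilipschitz_of_bound T fun x => by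
      rw [Real.coe_toNNReal _ (by positivity)]; exact hbelow x
  have hclosed : IsClosed (T.range : Set H) := hanti.isClosed_range T.uniformContinuous
  have htop : T.range = ⊤ := by
    have := hclosed.completeSpace_coe
    rw [← T.range.orthogonal_orthogonal, Submodule.eq_top_iff']
    intro v w hw
    have hw0 : w = 0 := by
      apply hzero
      rw [← hTB, ← inner_conj_symm]
      rw [hw (T w) ⟨w, rfl⟩, map_zero]
    rw [hw0, inner_zero_left]
  obtain ⟨u, hu⟩ : f ∈ T.range := htop ▸ Submodule.mem_top
  refine ⟨u, fun v => ?_, fun u' hu' => ?_⟩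
  · rw [← hTB]; exact congrArg _ hu
  · apply hanti.injective
    refine ext_inner_left ℂ fun v => ?_
    rw [hTB, hTB, hu', ← hTB]
    exact congrArg _ hu.symm

/-! ### The Hilbert space -/

/-- `L²` of the cell. -/
abbrev CellL2 (M : Medium) := Lp ℂ 2 (volume.restrict (cell M))

lemma exists_pairing {α : Type*} [MeasurableSpace α] {μ : Measure α} {Φ : α → ℂ}
    (hΦ : MemLp Φ 2 μ) : ∃ L : Lp ℂ 2 μ →L[ℂ] ℂ, ∀ u, L u = ∫ x, u x * Φ x ∂μ := by
  have h : MemLp (fun x => conj (Φ x)) 2 μ := hΦ.star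
  refine ⟨innerSL ℂ (h.toLp _), fun u => ?_⟩
  rw [innerSL_apply_apply, L2.inner_def]
  refine integral_congr_ae ?_
  filter_upwards [h.coeFn_toLp] with x hx
  rw [hx, RCLike.inner_apply, Complex.conj_conj]

lemma exists_mulCLM {α : Type*} [MeasurableSpace α] {μ : Measure α} {c : α → ℂ}
    (hc : AEStronglyMeasurable c μ) {C : ℝ} (hC : ∀ᵐ x ∂μ, ‖c x‖ ≤ C) :
    ∃ Q : Lp ℂ 2 μ →L[ℂ] Lp ℂ 2 μ, ∀ u : Lp ℂ 2 μ, Q u =ᵐ[μ] fun x => c x * u x := by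
  have hm : ∀ u : Lp ℂ 2 μ, MemLp (fun x => c x * u x) 2 μ := fun u => by
    refine MemLp.of_le_mul (c := C) (Lp.memLp u) (hc.mul (Lp.memLp u).1) ?_
    filter_upwards [hC] with x hx
    rw [norm_mul]; gcongr
  let Q : Lp ℂ 2 μ →ₗ[ℂ] Lp ℂ 2 μ :=
    { toFun := fun u => (hm u).toLp _
      map_add' := fun u v => by
        apply Lp.ext
        filter_upwards [(hm (u + v)).coeFn_toLp, (hm u).coeFn_toLp, (hm v).coeFn_toLp,
          Lp.coeFn_add u v, Lp.coeFn_add ((hm u).toLp _) ((hm v).toLp _)] with x h1 h2 h3 h4 h5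
        rw [h1, h5, Pi.add_apply, h2, h3, h4, Pi.add_apply, mul_add]
      map_smul' := fun r u => by
        apply Lp.ext
        filter_upwards [(hm (r • u)).coeFn_toLp, (hm u).coeFn_toLp,
          Lp.coeFn_smul r u, Lp.coeFn_smul r ((hm u).toLp _)] with x h1 h2 h3 h4
        rw [h1, RingHom.id_apply, h4, Pi.smul_apply, h2, h3, Pi.smul_apply, smul_eq_mul,
          smul_eq_mul, mul_left_comm] }
  refine ⟨Q.mkContinuous C fun u => ?_, fun u => (hm u).coeFn_toLp⟩
  refine Lp.norm_le_mul_norm_of_ae_le_mul ?_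
  filter_upwards [(hm u).coeFn_toLp, hC] with x h1 h2
  change ‖((hm u).toLp _ : α → ℂ) x‖ ≤ _
  rw [h1, norm_mul]; gcongr

section Space

variable (M : Medium) (k θ : ℝ)

/-- For each folded test function the relation is the vanishing of a continuous linear functional of
the pair. Linearity and closedness of the Sobolev space both follow from this. -/
lemma exists_cellWeak_functionals (a : ℝ) (e : ℝ × ℝ) :
    ∃ (ι : Type) (L₁ L₂ : ι → CellL2 M →L[ℂ] ℂ), ∀ u g : CellL2 M,
      CellWeak M a e u g ↔ ∀ i, L₁ i u + L₂ i g = 0 := by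
  let ι := { φN : (ℝ × ℝ → ℂ) × ℕ // ContDiff ℝ ∞ φN.1 ∧ HasCompactSupport φN.1 ∧
    tsupport φN.1 ⊆ strip M ∧ ∀ x ∈ tsupport φN.1, x.1 ∈ Ioo (-(φN.2 * M.p)) (φN.2 * M.p) }
  have h1 : ∀ i : ι, MemLp (fold M a i.1.2 fun x => fderiv ℝ i.1.1 x e) 2
      (volume.restrict (cell M)) := fun i => memLp_cell_of_continuous
    (continuous_fold _ ((i.2.1.continuous_fderiv (by simp)).clm_apply continuous_const))
  have h2 : ∀ i : ι, MemLp (fold M a i.1.2 i.1.1) 2 (volume.restrict (cell M)) := fun i =>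
    memLp_cell_of_continuous (continuous_fold _ i.2.1.continuous)
  choose L₁ hL₁ using fun i => exists_pairing (h1 i)
  choose L₂ hL₂ using fun i => exists_pairing (h2 i)
  refine ⟨ι, L₁, L₂, fun u g => ⟨fun h i => ?_, fun h φ c1 c2 c3 N c4 => ?_⟩⟩
  · rw [hL₁, hL₂, h i.1.1 i.2.1 i.2.2.1 i.2.2.2.1 i.1.2 i.2.2.2.2, neg_add_cancel]
  · have := h ⟨(φ, N), c1, c2, c3, c4⟩
    rw [hL₁, hL₂] at this
    exact eq_neg_of_add_eq_zero_left this

/-- The Hilbert space of square-integrable functions on the cell with square-integrable weak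
derivatives, as a space of triples. -/
def sobolevSpace : Submodule ℂ (PiLp 2 fun _ : Fin 3 => CellL2 M) where
  carrier := {x | CellWeak M (alpha M k θ 0) (1, 0) (x 0) (x 1) ∧
    CellWeak M (alpha M k θ 0) (0, 1) (x 0) (x 2)}
  add_mem' {x y} hx hy := by
    obtain ⟨ι₁, L₁, L₂, h₁⟩ := exists_cellWeak_functionals M (alpha M k θ 0) (1, 0)
    obtain ⟨ι₂, L₃, L₄, h₂⟩ := exists_cellWeak_functionals M (alpha M k θ 0) (0, 1)
    simp only [mem_ofPred_eq, h₁, h₂] at hx hy ⊢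
    refine ⟨fun i => ?_, fun i => ?_⟩
    · simp only [PiLp.add_apply, map_add]; linear_combination hx.1 i + hy.1 i
    · simp only [PiLp.add_apply, map_add]; linear_combination hx.2 i + hy.2 i
  zero_mem' := by
    obtain ⟨ι₁, L₁, L₂, h₁⟩ := exists_cellWeak_functionals M (alpha M k θ 0) (1, 0)
    obtain ⟨ι₂, L₃, L₄, h₂⟩ := exists_cellWeak_functionals M (alpha M k θ 0) (0, 1)
    simp only [mem_ofPred_eq, h₁, h₂]
    simp
  smul_mem' r x hx := by
    obtain ⟨ι₁, L₁, L₂, h₁⟩ := exists_cellWeak_functionals M (alpha M k θ 0) (1, 0)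
    obtain ⟨ι₂, L₃, L₄, h₂⟩ := exists_cellWeak_functionals M (alpha M k θ 0) (0, 1)
    simp only [mem_ofPred_eq, h₁, h₂] at hx ⊢
    refine ⟨fun i => ?_, fun i => ?_⟩
    · simp only [PiLp.smul_apply, map_smul, smul_eq_mul]; linear_combination r * hx.1 i
    · simp only [PiLp.smul_apply, map_smul, smul_eq_mul]; linear_combination r * hx.2 i

lemma isClosed_sobolevSpace : IsClosed (sobolevSpace M k θ : Set (PiLp 2 fun _ : Fin 3 => CellL2 M)) := by
  obtain ⟨ι₁, L₁, L₂, h₁⟩ := exists_cellWeak_functionals M (alpha M k θ 0) (1, 0)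
  obtain ⟨ι₂, L₃, L₄, h₂⟩ := exists_cellWeak_functionals M (alpha M k θ 0) (0, 1)
  have : (sobolevSpace M k θ : Set (PiLp 2 fun _ : Fin 3 => CellL2 M)) =
      {x | (∀ i, L₁ i (x 0) + L₂ i (x 1) = 0) ∧ ∀ i, L₃ i (x 0) + L₄ i (x 2) = 0} := by
    ext x
    change (_ ∧ _) ↔ _
    rw [h₁, h₂]; rfl
  rw [this]
  have hc : ∀ j : Fin 3, Continuous fun x : PiLp 2 fun _ : Fin 3 => CellL2 M => x j := fun j =>
    PiLp.continuous_apply 2 _ j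
  refine IsClosed.and ?_ ?_
  · simp only [ofPred_forall]
    exact isClosed_iInter fun i => isClosed_eq
      (((L₁ i).continuous.comp (hc 0)).add ((L₂ i).continuous.comp (hc 1))) continuous_const
  · simp only [ofPred_forall]
    exact isClosed_iInter fun i => isClosed_eq
      (((L₃ i).continuous.comp (hc 0)).add ((L₄ i).continuous.comp (hc 2))) continuous_const

instance : CompleteSpace (sobolevSpace M k θ) :=
  (isClosed_sobolevSpace M k θ).completeSpace_coe

variable {M k θ}

/-- The component `j` of an element of the Sobolev space. -/
def comp (j : Fin 3) : sobolevSpace M k θ →L[ℂ] CellL2 M :=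
  (PiLp.proj 2 (fun _ : Fin 3 => CellL2 M) j).comp (sobolevSpace M k θ).subtypeL

lemma norm_comp_le (j : Fin 3) (x : sobolevSpace M k θ) : ‖comp j x‖ ≤ ‖x‖ :=
  PiLp.norm_apply_le x.1 j

lemma norm_sq_eq (x : sobolevSpace M k θ) :
    ‖x‖ ^ 2 = ‖comp 0 x‖ ^ 2 + ‖comp 1 x‖ ^ 2 + ‖comp 2 x‖ ^ 2 := by
  change ‖x.1‖ ^ 2 = _
  rw [PiLp.norm_sq_eq_of_L2, Fin.sum_univ_three]
  rfl

lemma isSobolevTriple_comp (x : sobolevSpace M k θ) :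
    IsSobolevTriple M k θ (comp 0 x) (comp 1 x) (comp 2 x) :=
  ⟨Lp.memLp _, Lp.memLp _, Lp.memLp _, x.2.1, x.2.2⟩

lemma norm_sq_cellL2 (u : CellL2 M) : ‖u‖ ^ 2 = ∫ x in cell M, ‖u x‖ ^ 2 := by
  have h := L2.inner_def (𝕜 := ℂ) u u
  rw [inner_self_eq_norm_sq_to_K] at h
  have h2 : ∫ x in cell M, (inner ℂ (u x) (u x) : ℂ) = ((∫ x in cell M, ‖u x‖ ^ 2 : ℝ) : ℂ) := by
    rw [← integral_complex_ofReal]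
    congr 1; funext x
    rw [inner_self_eq_norm_sq_to_K]; push_cast; rfl
  apply Complex.ofReal_injective
  rw [← h2, ← h]
  push_cast
  rfl

/-! ### End point functionals -/

/-- As a pairing over the cell, the end point value is visibly continuous on `L²` and insensitive to
null sets. -/
lemma endCoeff_eq_integral_cell {u g : ℝ × ℝ → ℂ} (hu : MemLp u 2 (volume.restrict (cell M)))
    (hg : MemLp g 2 (volume.restrict (cell M))) (e : ℝ) (n : ℤ) :
    endCoeff M k θ e u g n = (M.p : ℂ)⁻¹ *
      ((∫ x in cell M, u x * (mode M k θ n x.1 * ((1 / (M.d - M.b) : ℝ) : ℂ))) +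
        ∫ x in cell M, g x * (mode M k θ n x.1 * (((x.2 - e) / (M.d - M.b) : ℝ) : ℂ))) := by
  have hpc : (M.p : ℂ) ≠ 0 := by exact_mod_cast M.p_pos.ne'
  have hI : IsFiniteMeasure (volume.restrict (Ioo M.b M.d)) := inferInstance
  obtain ⟨C, hC⟩ := (isCompact_Icc (a := M.b) (b := M.d)).exists_bound_of_continuousOn
    (f := fun t : ℝ => (((t - e) / (M.d - M.b) : ℝ) : ℂ)) (by fun_prop)
  have hC' : ∀ᵐ t ∂(volume.restrict (Ioo M.b M.d)), ‖(((t - e) / (M.d - M.b) : ℝ) : ℂ)‖ ≤ C := by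
    filter_upwards [ae_restrict_mem measurableSet_Ioo] with t ht
    exact hC t (Ioo_subset_Icc_self ht)
  have hm : AEStronglyMeasurable (fun t : ℝ => (((t - e) / (M.d - M.b) : ℝ) : ℂ))
    (volume.restrict (Ioo M.b M.d)) := Continuous.aestronglyMeasurable (by fun_prop)
  rw [cell, setIntegral_mul_mode M k θ hI hu n
      (ψ := fun _ => ((1 / (M.d - M.b) : ℝ) : ℂ)) aestronglyMeasurable_const
      (Eventually.of_forall fun _ => le_rfl),
    setIntegral_mul_mode M k θ hI hg n
      (ψ := fun t => (((t - e) / (M.d - M.b) : ℝ) : ℂ)) hm hC',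
    ← mul_add, inv_mul_cancel_left₀ hpc, endCoeff]
  have hui := (memLp_sliceCoeff M k θ (I := Ioo M.b M.d) hu n).integrable (by norm_num)
  have hgi := (memLp_sliceCoeff M k θ (I := Ioo M.b M.d) hg n).integrable (by norm_num)
  exact integral_add (hui.mul_const _) (hgi.mul_bdd (c := C) hm hC')

lemma endCoeff_congr_ae {u g u' g' : ℝ × ℝ → ℂ} (hu : MemLp u 2 (volume.restrict (cell M)))
    (hg : MemLp g 2 (volume.restrict (cell M))) (huu : u =ᵐ[volume.restrict (cell M)] u')
    (hgg : g =ᵐ[volume.restrict (cell M)] g') (e : ℝ) (n : ℤ) :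
    endCoeff M k θ e u g n = endCoeff M k θ e u' g' n := by
  rw [endCoeff_eq_integral_cell hu hg, endCoeff_eq_integral_cell (hu.ae_eq huu) (hg.ae_eq hgg)]
  congr 2
  · exact integral_congr_ae (huu.mono fun x hx => by simp only [hx])
  · exact integral_congr_ae (hgg.mono fun x hx => by simp only [hx])

lemma exists_endCoeff_functional (e : ℝ) (n : ℤ) : ∃ E : sobolevSpace M k θ →L[ℂ] ℂ,
    ∀ x, E x = endCoeff M k θ e (comp 0 x) (comp 2 x) n := by
  have hm : Continuous fun x : ℝ × ℝ => mode M k θ n x.1 := (continuous_mode M k θ n).comp continuous_fst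
  obtain ⟨L₁, h₁⟩ := exists_pairing (memLp_cell_of_continuous (M := M)
    (φ := fun x => mode M k θ n x.1 * ((1 / (M.d - M.b) : ℝ) : ℂ)) (by fun_prop))
  obtain ⟨L₂, h₂⟩ := exists_pairing (memLp_cell_of_continuous (M := M)
    (φ := fun x => mode M k θ n x.1 * (((x.2 - e) / (M.d - M.b) : ℝ) : ℂ)) (by fun_prop))
  refine ⟨(M.p : ℂ)⁻¹ • (L₁.comp (comp 0) + L₂.comp (comp 2)), fun x => ?_⟩
  rw [endCoeff_eq_integral_cell (Lp.memLp _) (Lp.memLp _), ← h₁, ← h₂]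
  rfl

/-- The `n`-th Fourier coefficient of the trace, as a functional on the Sobolev space. -/
def endFunctional (e : ℝ) (n : ℤ) : sobolevSpace M k θ →L[ℂ] ℂ :=
  (exists_endCoeff_functional e n).choose

lemma endFunctional_apply (e : ℝ) (n : ℤ) (x : sobolevSpace M k θ) :
    endFunctional e n x = endCoeff M k θ e (comp 0 x) (comp 2 x) n :=
  (exists_endCoeff_functional e n).choose_spec x

lemma summable_endFunctional {e : ℝ} (he : e = M.b ∨ e = M.d) (x : sobolevSpace M k θ) :
    Summable (fun n => (|alpha M k θ n| + 1) * ‖endFunctional e n x‖ ^ 2) ∧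
    ∑' n, (|alpha M k θ n| + 1) * ‖endFunctional e n x‖ ^ 2 ≤
      (3 / (M.d - M.b) + 4) * M.p⁻¹ * ‖x‖ ^ 2 := by
  have := (isSobolevTriple_comp x).summable_endCoeff he
  simp only [endFunctional_apply]
  refine ⟨this.1, this.2.trans (le_of_eq ?_)⟩
  rw [norm_sq_eq, norm_sq_cellL2, norm_sq_cellL2, norm_sq_cellL2]; ring

/-- The boundary sesquilinear form of a Fourier multiplier of order one. -/
lemma exists_multiplierForm {e : ℝ} (he : e = M.b ∨ e = M.d) {σ : ℤ → ℂ} {C : ℝ} (hC0 : 0 ≤ C)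
    (hσ : ∀ n, ‖σ n‖ ≤ C * (|alpha M k θ n| + 1)) :
    ∃ S : sobolevSpace M k θ →L⋆[ℂ] sobolevSpace M k θ →L[ℂ] ℂ, ∀ v u,
      HasSum (fun n => (M.p : ℂ) * (σ n * endFunctional e n u * conj (endFunctional e n v)))
        (S v u) := by
  have hp := M.p_pos
  have hL : 0 < M.d - M.b := sub_pos.2 M.b_lt_d
  set κ : ℤ → ℝ := fun n => |alpha M k θ n| + 1 with hκ
  have hκ0 : ∀ n, 0 < κ n := fun n => by simp only [κ]; positivity
  set K := (3 / (M.d - M.b) + 4) * M.p⁻¹ with hK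
  have hK0 : 0 ≤ K := by positivity
  have hsq : ∀ (n : ℤ) (x : sobolevSpace M k θ), (Real.sqrt (κ n) * ‖endFunctional e n x‖) ^ (2 : ℝ)
      = κ n * ‖endFunctional e n x‖ ^ 2 := fun n x => by
    rw [Real.rpow_two, mul_pow, Real.sq_sqrt (hκ0 n).le]
  -- A multiplier of order one is split evenly: Cauchy–Schwarz with weight `√κ` on each factor, so
  -- that both sums are covered by the trace estimate.
  have hCS : ∀ v u : sobolevSpace M k θ,
      Summable (fun n => κ n * (‖endFunctional e n u‖ * ‖endFunctional e n v‖)) ∧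
      ∑' n, κ n * (‖endFunctional e n u‖ * ‖endFunctional e n v‖) ≤ K * ‖v‖ * ‖u‖ := by
    intro v u
    obtain ⟨s1, t1⟩ := summable_endFunctional he u
    obtain ⟨s2, t2⟩ := summable_endFunctional he v
    have hh := Real.summable_and_inner_le_Lp_mul_Lq_tsum_of_nonneg (p := 2) (q := 2)
      (f := fun n => Real.sqrt (κ n) * ‖endFunctional e n u‖)
      (g := fun n => Real.sqrt (κ n) * ‖endFunctional e n v‖)
      (by constructor <;> norm_num) (fun n => by positivity) (fun n => by positivity)
      (by simpa only [hsq] using s1) (by simpa only [hsq] using s2)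
    have e1 : (fun n => Real.sqrt (κ n) * ‖endFunctional e n u‖ *
        (Real.sqrt (κ n) * ‖endFunctional e n v‖)) =
        fun n => κ n * (‖endFunctional e n u‖ * ‖endFunctional e n v‖) := funext fun n => by
      rw [mul_mul_mul_comm, Real.mul_self_sqrt (hκ0 n).le]
    simp only [hsq] at hh
    rw [e1] at hh
    refine ⟨hh.1, hh.2.trans ?_⟩
    rw [← Real.sqrt_eq_rpow, ← Real.sqrt_eq_rpow]
    calc _ ≤ Real.sqrt (K * ‖u‖ ^ 2) * Real.sqrt (K * ‖v‖ ^ 2) := by gcongr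
      _ = K * ‖v‖ * ‖u‖ := by
        rw [Real.sqrt_mul hK0, Real.sqrt_mul hK0, Real.sqrt_sq (norm_nonneg _),
          Real.sqrt_sq (norm_nonneg _), mul_mul_mul_comm, Real.mul_self_sqrt hK0]
        ring
  have hbd : ∀ (v u : sobolevSpace M k θ) n,
      ‖(M.p : ℂ) * (σ n * endFunctional e n u * conj (endFunctional e n v))‖ ≤
      M.p * C * (κ n * (‖endFunctional e n u‖ * ‖endFunctional e n v‖)) := fun v u n => by
    rw [norm_mul, norm_mul, norm_mul, RCLike.norm_conj, Complex.norm_real, Real.norm_of_nonneg hp.le]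
    calc _ ≤ M.p * (C * κ n * ‖endFunctional e n u‖ * ‖endFunctional e n v‖) := by
          gcongr; exact hσ n
      _ = _ := by ring
  have hsum : ∀ v u : sobolevSpace M k θ, Summable fun n =>
      (M.p : ℂ) * (σ n * endFunctional e n u * conj (endFunctional e n v)) := fun v u =>
    Summable.of_norm_bounded ((hCS v u).1.mul_left _) (hbd v u)
  let S₀ : sobolevSpace M k θ →ₛₗ[starRingEnd ℂ] sobolevSpace M k θ →ₗ[ℂ] ℂ :=
    LinearMap.mk₂'ₛₗ (starRingEnd ℂ) (RingHom.id ℂ)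
      (fun v u => ∑' n, (M.p : ℂ) * (σ n * endFunctional e n u * conj (endFunctional e n v)))
      (fun v v' u => by
        rw [← (hsum v u).tsum_add (hsum v' u)]
        congr 1; funext n; rw [map_add, map_add]; ring)
      (fun r v u => by
        rw [smul_eq_mul, ← tsum_mul_left]
        congr 1; funext n; rw [map_smul, smul_eq_mul, map_mul]; ring)
      (fun v u u' => by
        rw [← (hsum v u).tsum_add (hsum v u')]
        congr 1; funext n; rw [map_add]; ring)
      (fun r v u => by
        rw [RingHom.id_apply, smul_eq_mul, ← tsum_mul_left]
        congr 1; funext n; rw [map_smul, smul_eq_mul]; ring)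
  refine ⟨S₀.mkContinuous₂ (M.p * C * K) fun v u => ?_, fun v u => (hsum v u).hasSum⟩
  change ‖∑' n, _‖ ≤ _
  have hs := ((hCS v u).1.mul_left (M.p * C))
  refine (tsum_of_norm_bounded hs.hasSum (hbd v u)).trans ?_
  rw [tsum_mul_left]
  calc _ ≤ M.p * C * (K * ‖v‖ * ‖u‖) := by gcongr; exact (hCS v u).2
    _ = _ := by ring

end Space

/-! ### Functions in `H¹` and elements of the Hilbert space -/

section Correspondence

variable {M : Medium} {k θ : ℝ}

lemma IsWeakPartial.ae_eq {a : ℝ} {e : ℝ × ℝ} {u g g' : ℝ × ℝ → ℂ} (h : IsWeakPartial M a e u g)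
    (h' : IsWeakPartial M a e u g') : g =ᵐ[volume.restrict (cell M)] g' := by
  have := isFiniteMeasure_cell (M := M)
  have hi := h.2.1.integrable (q := 2) (by norm_num)
  have hi' := h'.2.1.integrable (q := 2) (by norm_num)
  have hopen : IsOpen (cell M) := isOpen_Ioo.prod isOpen_Ioo
  have main := hopen.ae_eq_zero_of_integral_contDiff_smul_eq_zero (μ := volume)
    (f := fun x => g x - g' x) (IntegrableOn.locallyIntegrableOn (hi.sub hi')) ?_
  · rw [EventuallyEq, ae_restrict_iff' measurableSet_cell]
    filter_upwards [main] with x hx hm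
    exact sub_eq_zero.1 (hx hm)
  · intro φ c1 c2 c3
    have d1 : ContDiff ℝ ∞ fun x => (φ x : ℂ) := Complex.ofRealCLM.contDiff.comp c1
    have d2 : HasCompactSupport fun x => (φ x : ℂ) := c2.comp_left (g := fun r : ℝ => (r : ℂ)) rfl
    have d3 : tsupport (fun x => (φ x : ℂ)) ⊆ tsupport φ :=
      tsupport_comp_subset (g := fun r : ℝ => (r : ℂ)) rfl φ
    have hs : cell M ⊆ strip M := prod_mono (subset_univ _) le_rfl
    have e1 := h.2.2 _ d1 d2 (d3.trans (c3.trans hs))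
    have e2 := h'.2.2 _ d1 d2 (d3.trans (c3.trans hs))
    have hr : ∀ w : ℝ × ℝ → ℂ, ∫ x, w x * φ x = ∫ x in cell M, w x * φ x := fun w => by
      rw [setIntegral_eq_integral_of_forall_compl_eq_zero]
      intro x hx
      rw [image_eq_zero_of_notMem_tsupport fun hm => hx (c3 hm), Complex.ofReal_zero, mul_zero]
    obtain ⟨C, hC⟩ := c2.exists_bound_of_continuous c1.continuous
    have hb : ∀ {w : ℝ × ℝ → ℂ}, Integrable w (volume.restrict (cell M)) →
        Integrable (fun x => w x * φ x) (volume.restrict (cell M)) := fun hw =>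
      hw.mul_bdd (c := C) d1.continuous.aestronglyMeasurable
        (Eventually.of_forall fun x => by simpa using hC x)
    have e3 : ∫ x, φ x • (g x - g' x) = ∫ x, (g x - g' x) * φ x := by
      congr 1; funext x; rw [Complex.real_smul, mul_comm]
    rw [e3, hr]
    simp only [sub_mul]
    rw [integral_sub (hb hi) (hb hi'), ← hr, ← hr]
    linear_combination e1 - e2

lemma MemH1.isWeakPartial_fst {a : ℝ} {u : ℝ × ℝ → ℂ} (hu : MemH1 M a u) :
    IsWeakPartial M a (1, 0) u (weakPartial M a (1, 0) u) := by
  rw [weakPartial, dif_pos hu.2.2.1]; exact hu.2.2.1.choose_spec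

lemma MemH1.isWeakPartial_snd {a : ℝ} {u : ℝ × ℝ → ℂ} (hu : MemH1 M a u) :
    IsWeakPartial M a (0, 1) u (weakPartial M a (0, 1) u) := by
  rw [weakPartial, dif_pos hu.2.2.2]; exact hu.2.2.2.choose_spec

lemma MemH1.isSobolevTriple {u : ℝ × ℝ → ℂ} (hu : MemH1 M (alpha M k θ 0) u) :
    IsSobolevTriple M k θ u (weakPartial M (alpha M k θ 0) (1, 0) u)
      (weakPartial M (alpha M k θ 0) (0, 1) u) :=
  ⟨hu.2.1, hu.isWeakPartial_fst.2.1, hu.isWeakPartial_snd.2.1,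
    hu.isWeakPartial_fst.cellWeak hu.1 hu.2.1, hu.isWeakPartial_snd.cellWeak hu.1 hu.2.1⟩

/-- The element of the Hilbert space defined by a triple. -/
def IsSobolevTriple.toSpace {u g₁ g₂ : ℝ × ℝ → ℂ} (h : IsSobolevTriple M k θ u g₁ g₂) :
    sobolevSpace M k θ :=
  ⟨WithLp.toLp 2 ![h.memLp.toLp u, h.memLp_fst.toLp g₁, h.memLp_snd.toLp g₂],
    h.weak_fst.congr_ae h.memLp.coeFn_toLp.symm h.memLp_fst.coeFn_toLp.symm,
    h.weak_snd.congr_ae h.memLp.coeFn_toLp.symm h.memLp_snd.coeFn_toLp.symm⟩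

lemma IsSobolevTriple.comp_zero_toSpace {u g₁ g₂ : ℝ × ℝ → ℂ} (h : IsSobolevTriple M k θ u g₁ g₂) :
    comp 0 h.toSpace = h.memLp.toLp u := rfl

lemma IsSobolevTriple.endFunctional_toSpace {u g₁ g₂ : ℝ × ℝ → ℂ}
    (h : IsSobolevTriple M k θ u g₁ g₂) (e : ℝ) (n : ℤ) :
    endFunctional e n h.toSpace = endCoeff M k θ e u g₂ n := by
  rw [endFunctional_apply]
  exact endCoeff_congr_ae (Lp.memLp _) (Lp.memLp _) h.memLp.coeFn_toLp h.memLp_snd.coeFn_toLp e n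

lemma sobolevSpace_ext {x y : sobolevSpace M k θ} (h : ∀ j, comp j x = comp j y) : x = y :=
  Subtype.ext (PiLp.ext h)

/-- The quasi-periodic extensions of the components satisfy the weak relations on the whole strip,
and the weak derivatives obtained by choice agree with them almost everywhere. Consequently testing
against `H¹` functions and testing against the Hilbert space are equivalent. -/
lemma exists_memH1 (x : sobolevSpace M k θ) :
    ∃ (u : ℝ × ℝ → ℂ) (hu : MemH1 M (alpha M k θ 0) u), hu.isSobolevTriple.toSpace = x := by
  have h := isSobolevTriple_comp x
  set a := alpha M k θ 0
  have h0 := qpExt_ae_eq (M := M) (a := a) (comp 0 x)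
  have h1 := qpExt_ae_eq (M := M) (a := a) (comp 1 x)
  have h2 := qpExt_ae_eq (M := M) (a := a) (comp 2 x)
  have m0 := h.memLp.ae_eq h0
  have w1 : IsWeakPartial M a (1, 0) (qpExt M a (comp 0 x)) (qpExt M a (comp 1 x)) :=
    (h.weak_fst.congr_ae h0 h1).isWeakPartial (isQuasiPeriodic_qpExt _) m0
      (isQuasiPeriodic_qpExt _) (h.memLp_fst.ae_eq h1)
  have w2 : IsWeakPartial M a (0, 1) (qpExt M a (comp 0 x)) (qpExt M a (comp 2 x)) :=
    (h.weak_snd.congr_ae h0 h2).isWeakPartial (isQuasiPeriodic_qpExt _) m0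
      (isQuasiPeriodic_qpExt _) (h.memLp_snd.ae_eq h2)
  have hu : MemH1 M a (qpExt M a (comp 0 x)) := ⟨isQuasiPeriodic_qpExt _, m0, ⟨_, w1⟩, ⟨_, w2⟩⟩
  refine ⟨_, hu, sobolevSpace_ext fun j => ?_⟩
  apply Lp.ext
  fin_cases j
  · exact hu.isSobolevTriple.memLp.coeFn_toLp.trans h0.symm
  · exact hu.isSobolevTriple.memLp_fst.coeFn_toLp.trans
      ((hu.isWeakPartial_fst.ae_eq w1).trans h1.symm)
  · exact hu.isSobolevTriple.memLp_snd.coeFn_toLp.trans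
      ((hu.isWeakPartial_snd.ae_eq w2).trans h2.symm)

end Correspondence

/-! ### The sesquilinear form on the Hilbert space -/

section Form

variable {M : Medium} {k θ : ℝ}

lemma aestronglyMeasurable_q₀ : AEStronglyMeasurable M.q₀ (volume.restrict (cell M)) :=
  M.q₀_meas.mono_measure (Measure.restrict_mono (prod_mono (subset_univ _) le_rfl) le_rfl)

open scoped InnerProductSpace in
lemma exists_volumeForm (M : Medium) (k θ : ℝ) :
    ∃ S : sobolevSpace M k θ →L⋆[ℂ] sobolevSpace M k θ →L[ℂ] ℂ, ∀ v u,
      S v u = ∫ x in cell M, (comp 1 u x * conj (comp 1 v x) + comp 2 u x * conj (comp 2 v x)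
        - (k : ℂ) ^ 2 * M.q₀ x * comp 0 u x * conj (comp 0 v x)) := by
  obtain ⟨B, hB⟩ := M.q₀_bounded
  obtain ⟨Q, hQ⟩ := exists_mulCLM (μ := volume.restrict (cell M))
    (c := fun x => (k : ℂ) ^ 2 * M.q₀ x) (C := k ^ 2 * B) (aestronglyMeasurable_q₀.const_mul _) (by
      filter_upwards [ae_restrict_mem measurableSet_cell] with x hx
      rw [norm_mul, norm_pow, Complex.norm_real, Real.norm_eq_abs, sq_abs]
      gcongr
      exact hB x ⟨mem_univ _, hx.2⟩)
  let S₀ : sobolevSpace M k θ →ₛₗ[starRingEnd ℂ] sobolevSpace M k θ →ₗ[ℂ] ℂ :=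
    LinearMap.mk₂'ₛₗ (starRingEnd ℂ) (RingHom.id ℂ)
      (fun v u => ⟪comp 1 v, comp 1 u⟫_ℂ + ⟪comp 2 v, comp 2 u⟫_ℂ - ⟪comp 0 v, Q (comp 0 u)⟫_ℂ)
      (fun v v' u => by simp only [map_add, inner_add_left]; ring)
      (fun r v u => by simp only [map_smul, inner_smul_left, smul_eq_mul]; ring)
      (fun v u u' => by simp only [map_add, inner_add_right]; ring)
      (fun r v u => by simp only [map_smul, inner_smul_right, smul_eq_mul, RingHom.id_apply]; ring)
  refine ⟨S₀.mkContinuous₂ (2 + ‖Q‖) fun v u => ?_, fun v u => ?_⟩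
  · change ‖⟪comp 1 v, comp 1 u⟫_ℂ + ⟪comp 2 v, comp 2 u⟫_ℂ - ⟪comp 0 v, Q (comp 0 u)⟫_ℂ‖ ≤ _
    have h : ∀ j, ‖⟪comp j v, comp j u⟫_ℂ‖ ≤ ‖v‖ * ‖u‖ := fun j =>
      (norm_inner_le_norm _ _).trans (mul_le_mul (norm_comp_le j v) (norm_comp_le j u)
        (norm_nonneg _) (norm_nonneg _))
    have h' : ‖⟪comp 0 v, Q (comp 0 u)⟫_ℂ‖ ≤ ‖v‖ * (‖Q‖ * ‖u‖) :=
      (norm_inner_le_norm _ _).trans (mul_le_mul (norm_comp_le 0 v)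
        ((Q.le_opNorm _).trans (by gcongr; exact norm_comp_le 0 u)) (norm_nonneg _) (norm_nonneg _))
    calc _ ≤ ‖⟪comp 1 v, comp 1 u⟫_ℂ‖ + ‖⟪comp 2 v, comp 2 u⟫_ℂ‖ + ‖⟪comp 0 v, Q (comp 0 u)⟫_ℂ‖ :=
          (norm_sub_le _ _).trans (by gcongr; exact norm_add_le _ _)
      _ ≤ ‖v‖ * ‖u‖ + ‖v‖ * ‖u‖ + ‖v‖ * (‖Q‖ * ‖u‖) := by
          gcongr
          · exact h 1
          · exact h 2
      _ = _ := by ring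
  · change ⟪comp 1 v, comp 1 u⟫_ℂ + ⟪comp 2 v, comp 2 u⟫_ℂ - ⟪comp 0 v, Q (comp 0 u)⟫_ℂ = _
    rw [L2.inner_def, L2.inner_def, L2.inner_def,
      ← integral_add (L2.integrable_inner _ _) (L2.integrable_inner _ _),
      ← integral_sub ((L2.integrable_inner _ _).add (L2.integrable_inner _ _))
        (L2.integrable_inner _ _)]
    refine integral_congr_ae ?_
    filter_upwards [hQ (comp 0 u)] with x hx
    simp only [RCLike.inner_apply, hx]

lemma IsSobolevTriple.volume_integral_toSpace {u g₁ g₂ v h₁ h₂ : ℝ × ℝ → ℂ}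
    (tu : IsSobolevTriple M k θ u g₁ g₂) (tv : IsSobolevTriple M k θ v h₁ h₂) :
    ∫ x in cell M, (comp 1 tu.toSpace x * conj (comp 1 tv.toSpace x)
        + comp 2 tu.toSpace x * conj (comp 2 tv.toSpace x)
        - (k : ℂ) ^ 2 * M.q₀ x * comp 0 tu.toSpace x * conj (comp 0 tv.toSpace x)) =
      ∫ x in cell M, (g₁ x * conj (h₁ x) + g₂ x * conj (h₂ x)
        - (k : ℂ) ^ 2 * M.q₀ x * u x * conj (v x)) := by
  refine integral_congr_ae ?_
  have a0 : ∀ᵐ x ∂(volume.restrict (cell M)), comp 0 tu.toSpace x = u x := tu.memLp.coeFn_toLp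
  have a1 : ∀ᵐ x ∂(volume.restrict (cell M)), comp 1 tu.toSpace x = g₁ x := tu.memLp_fst.coeFn_toLp
  have a2 : ∀ᵐ x ∂(volume.restrict (cell M)), comp 2 tu.toSpace x = g₂ x := tu.memLp_snd.coeFn_toLp
  have b0 : ∀ᵐ x ∂(volume.restrict (cell M)), comp 0 tv.toSpace x = v x := tv.memLp.coeFn_toLp
  have b1 : ∀ᵐ x ∂(volume.restrict (cell M)), comp 1 tv.toSpace x = h₁ x := tv.memLp_fst.coeFn_toLp
  have b2 : ∀ᵐ x ∂(volume.restrict (cell M)), comp 2 tv.toSpace x = h₂ x := tv.memLp_snd.coeFn_toLp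
  filter_upwards [a0, a1, a2, b0, b1, b2] with x a0 a1 a2 b0 b1 b2
  rw [a0, a1, a2, b0, b1, b2]

set_option maxHeartbeats 1000000 in
/-- The sesquilinear form, antilinear in the first argument. -/
lemma exists_form {U : ℤ → ℝ → ℂ} {C : ℝ} (hC : 0 ≤ C)
    (hup : ∀ n, ‖upMultiplier M k θ n‖ ≤ C * (|alpha M k θ n| + 1))
    (hdown : ∀ n, ‖downMultiplier M U n‖ ≤ C * (|alpha M k θ n| + 1)) :
    ∃ B S₁ S₂ : sobolevSpace M k θ →L⋆[ℂ] sobolevSpace M k θ →L[ℂ] ℂ,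
      (∀ v u, B v u = (∫ x in cell M,
        (comp 1 u x * conj (comp 1 v x) + comp 2 u x * conj (comp 2 v x)
        - (k : ℂ) ^ 2 * M.q₀ x * comp 0 u x * conj (comp 0 v x))) - S₁ v u - S₂ v u) ∧
      (∀ v u, HasSum (fun n => (M.p : ℂ) * (upMultiplier M k θ n * endFunctional M.b n u
        * conj (endFunctional M.b n v))) (S₁ v u)) ∧
      (∀ v u, HasSum (fun n => (M.p : ℂ) * (downMultiplier M U n * endFunctional M.d n u
        * conj (endFunctional M.d n v))) (S₂ v u)) ∧
      ∀ u v (hu : MemH1 M (alpha M k θ 0) u) (hv : MemH1 M (alpha M k θ 0) v),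
        Summable (pairingTerm M k θ (upMultiplier M k θ) (topTrace M u) (topTrace M v)) ∧
        Summable (pairingTerm M k θ (downMultiplier M U) (bottomTrace M u) (bottomTrace M v)) ∧
        form M k θ U u v = B hv.isSobolevTriple.toSpace hu.isSobolevTriple.toSpace := by
  obtain ⟨S₀, h₀⟩ := exists_volumeForm M k θ
  obtain ⟨S₁, h₁⟩ := exists_multiplierForm (M := M) (k := k) (θ := θ) (Or.inl rfl) hC hup
  obtain ⟨S₂, h₂⟩ := exists_multiplierForm (M := M) (k := k) (θ := θ) (Or.inr rfl) hC hdown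
  refine ⟨S₀ - S₁ - S₂, S₁, S₂, fun v u => ?_, h₁, h₂, fun u v hu hv => ?_⟩
  · rw [← h₀]; rfl
  · have tu := hu.isSobolevTriple
    have tv := hv.isSobolevTriple
    have e1 : pairingTerm M k θ (upMultiplier M k θ) (topTrace M u) (topTrace M v) =
        fun n => (M.p : ℂ) * (upMultiplier M k θ n * endFunctional M.b n tu.toSpace
          * conj (endFunctional M.b n tv.toSpace)) := funext fun n => by
      rw [pairingTerm, tu.coeff_topTrace, tv.coeff_topTrace, tu.endFunctional_toSpace,
        tv.endFunctional_toSpace]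
    have e2 : pairingTerm M k θ (downMultiplier M U) (bottomTrace M u) (bottomTrace M v) =
        fun n => (M.p : ℂ) * (downMultiplier M U n * endFunctional M.d n tu.toSpace
          * conj (endFunctional M.d n tv.toSpace)) := funext fun n => by
      rw [pairingTerm, tu.coeff_bottomTrace, tv.coeff_bottomTrace, tu.endFunctional_toSpace,
        tv.endFunctional_toSpace]
    have s1 : HasSum (pairingTerm M k θ (upMultiplier M k θ) (topTrace M u) (topTrace M v))
        (S₁ tv.toSpace tu.toSpace) := by rw [e1]; exact h₁ _ _
    have s2 : HasSum (pairingTerm M k θ (downMultiplier M U) (bottomTrace M u) (bottomTrace M v))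
        (S₂ tv.toSpace tu.toSpace) := by rw [e2]; exact h₂ _ _
    refine ⟨s1.summable, s2.summable, ?_⟩
    change _ = S₀ tv.toSpace tu.toSpace - S₁ tv.toSpace tu.toSpace - S₂ tv.toSpace tu.toSpace
    rw [form, s1.tsum_eq, s2.tsum_eq, h₀, tu.volume_integral_toSpace tv]

/-- On the line `x₂ = d` the incident wave is a multiple of `e^{iα_0 x₁}`, so only the zeroth
Fourier coefficient of `v` is seen. Continuity of the functional is then that of `endFunctional`. -/
lemma rhs_eq {v : ℝ × ℝ → ℂ} (hv : MemH1 M (alpha M k θ 0) v) :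
    rhs M k θ v = -(2 * Complex.I * ((k * Real.cos θ : ℝ) : ℂ)
      * Complex.exp (-(Complex.I * ((k * Real.cos θ : ℝ) : ℂ) * M.d)) * M.p)
      * conj (endFunctional M.b 0 hv.isSobolevTriple.toSpace) := by
  have hpc : (M.p : ℂ) ≠ 0 := by exact_mod_cast M.p_pos.ne'
  rw [hv.isSobolevTriple.endFunctional_toSpace, ← hv.isSobolevTriple.coeff_topTrace,
    coeff_eq_setIntegral, map_mul, ← integral_conj, map_inv₀, Complex.conj_ofReal, rhs,
    intervalIntegral.integral_of_le M.p_pos.le, integral_Ioc_eq_integral_Ioo]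
  have : ∀ A D J : ℂ, -(A * D * M.p) * ((M.p : ℂ)⁻¹ * J) = -(A * D) * J := fun A D J => by
    field_simp
  rw [this, ← integral_const_mul]
  congr 1; funext x
  have hα : alpha M k θ 0 = k * Real.sin θ := by simp [alpha]
  have hm : conj (mode M k θ 0 x) = Complex.exp (Complex.I * ((k * Real.sin θ : ℝ) : ℂ) * x) := by
    rw [mode, ← Complex.exp_conj, hα]
    simp only [map_neg, map_mul, Complex.conj_I, Complex.conj_ofReal]
    congr 1; ring
  rw [map_mul, hm, sub_eq_add_neg, Complex.exp_add]
  ring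

/-! ### Real parts of the rotated form on the diagonal, and coercivity. -/

lemma hasSum_re_multiplierForm (c : ℂ) {e : ℝ} {σ : ℤ → ℂ} {S : ℂ} {x : sobolevSpace M k θ}
    (hS : HasSum (fun n => (M.p : ℂ) * (σ n * endFunctional e n x * conj (endFunctional e n x))) S) :
    HasSum (fun n => M.p * ((c * -σ n).re * ‖endFunctional e n x‖ ^ 2)) (c * -S).re := by
  have h := Complex.reCLM.hasSum (hS.neg.mul_left c)
  refine (congrArg (HasSum · (c * -S).re) (funext fun n => ?_)).mpr h
  have : c * -((M.p : ℂ) * (σ n * endFunctional e n x * conj (endFunctional e n x))) =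
      (M.p : ℂ) * (c * -σ n * ((‖endFunctional e n x‖ ^ 2 : ℝ) : ℂ)) := by
    rw [← Complex.normSq_eq_norm_sq, ← Complex.mul_conj]; ring
  change _ = (c * -((M.p : ℂ) * (σ n * endFunctional e n x * conj (endFunctional e n x)))).re
  rw [this, Complex.re_ofReal_mul, Complex.re_mul_ofReal]

lemma integrable_norm_sq (u : CellL2 M) :
    Integrable (fun z => ‖u z‖ ^ 2) (volume.restrict (cell M)) :=
  (Lp.memLp u).integrable_norm_pow (by norm_num)

lemma integrable_q₀_mul {B₀ : ℝ} (hq₀ : ∀ x ∈ (univ ×ˢ Ioo M.b M.d : Set (ℝ × ℝ)), ‖M.q₀ x‖ ≤ B₀)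
    (u : CellL2 M) :
    Integrable (fun z => M.q₀ z * ((‖u z‖ ^ 2 : ℝ) : ℂ)) (volume.restrict (cell M)) :=
  (integrable_norm_sq u).ofReal.bdd_mul (c := B₀) aestronglyMeasurable_q₀ (by
    filter_upwards [ae_restrict_mem measurableSet_cell] with z hz
    exact hq₀ z ⟨mem_univ _, hz.2⟩)

lemma volume_integral_self {B₀ : ℝ}
    (hq₀ : ∀ x ∈ (univ ×ˢ Ioo M.b M.d : Set (ℝ × ℝ)), ‖M.q₀ x‖ ≤ B₀) (κ : ℂ) (u g₁ g₂ : CellL2 M) :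
    ∫ z in cell M, (g₁ z * conj (g₁ z) + g₂ z * conj (g₂ z) - κ * M.q₀ z * u z * conj (u z)) =
      ((∫ z in cell M, ‖g₁ z‖ ^ 2 : ℝ) : ℂ) + ((∫ z in cell M, ‖g₂ z‖ ^ 2 : ℝ) : ℂ)
        - κ * ∫ z in cell M, M.q₀ z * ((‖u z‖ ^ 2 : ℝ) : ℂ) := by
  have hnn : ∀ z : ℂ, z * conj z = ((‖z‖ ^ 2 : ℝ) : ℂ) := fun z => by
    rw [Complex.mul_conj, Complex.normSq_eq_norm_sq]
  have i1 : Integrable (fun z => ((‖g₁ z‖ ^ 2 : ℝ) : ℂ)) (volume.restrict (cell M)) :=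
    (integrable_norm_sq g₁).ofReal
  have i2 : Integrable (fun z => ((‖g₂ z‖ ^ 2 : ℝ) : ℂ)) (volume.restrict (cell M)) :=
    (integrable_norm_sq g₂).ofReal
  have i12 : Integrable (fun z => ((‖g₁ z‖ ^ 2 : ℝ) : ℂ) + ((‖g₂ z‖ ^ 2 : ℝ) : ℂ))
    (volume.restrict (cell M)) := i1.add i2
  rw [← integral_complex_ofReal, ← integral_complex_ofReal, ← integral_const_mul,
    ← integral_add i1 i2, ← integral_sub i12 ((integrable_q₀_mul hq₀ u).const_mul κ)]
  congr 1; funext z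
  rw [mul_assoc _ (u z), hnn, hnn, hnn]
  ring

/-- Since `Re((1 + iτ) q₀) = Re q₀ - τ Im q₀` with `τ, Im q₀ ≥ 0`, absorption only helps. The bound
is free of `τ`, which is why `k` can be made small before `τ` is chosen. -/
lemma re_rotated_volume_le {B₀ τ : ℝ} (hτ : 0 ≤ τ)
    (hq₀ : ∀ x ∈ (univ ×ˢ Ioo M.b M.d : Set (ℝ × ℝ)), ‖M.q₀ x‖ ≤ B₀) (u : CellL2 M) :
    ((1 + Complex.I * τ) * ∫ z in cell M, M.q₀ z * ((‖u z‖ ^ 2 : ℝ) : ℂ)).re ≤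
      B₀ * ∫ z in cell M, ‖u z‖ ^ 2 := by
  have iq := (integrable_q₀_mul hq₀ u).const_mul (1 + Complex.I * τ)
  rw [← integral_const_mul, ← integral_const_mul]
  have := Complex.reCLM.integral_comp_comm iq
  simp only [Complex.reCLM_apply] at this
  rw [← this]
  refine integral_mono_ae iq.re ((integrable_norm_sq u).const_mul B₀) ?_
  filter_upwards [ae_restrict_mem measurableSet_cell] with z hz
  have hz' : z ∈ (univ ×ˢ Ioo M.b M.d : Set (ℝ × ℝ)) := ⟨mem_univ _, hz.2⟩
  have h3 : ((1 + Complex.I * τ) * M.q₀ z).re ≤ B₀ := by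
    have h4 := M.q₀_im z hz'
    have h5 := (Complex.re_le_norm _).trans (hq₀ z hz')
    have h6 : ((1 + Complex.I * τ) * M.q₀ z).re = (M.q₀ z).re - τ * (M.q₀ z).im := by
      simp [Complex.add_re, Complex.mul_re]
    rw [h6]
    have := mul_nonneg hτ h4
    linarith
  rw [← mul_assoc, Complex.re_mul_ofReal]
  gcongr

set_option maxHeartbeats 1000000 in
/-- Coercivity of a rotated form. -/
lemma coercive_form {U : ℤ → ℝ → ℂ} {B S₁ S₂ : sobolevSpace M k θ →L⋆[ℂ] sobolevSpace M k θ →L[ℂ] ℂ}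
    (hB : ∀ v u, B v u = (∫ x in cell M,
        (comp 1 u x * conj (comp 1 v x) + comp 2 u x * conj (comp 2 v x)
        - (k : ℂ) ^ 2 * M.q₀ x * comp 0 u x * conj (comp 0 v x))) - S₁ v u - S₂ v u)
    (h₁ : ∀ v u, HasSum (fun n => (M.p : ℂ) * (upMultiplier M k θ n * endFunctional M.b n u
        * conj (endFunctional M.b n v))) (S₁ v u))
    (h₂ : ∀ v u, HasSum (fun n => (M.p : ℂ) * (downMultiplier M U n * endFunctional M.d n u
        * conj (endFunctional M.d n v))) (S₂ v u))
    {τ K B₀ CP : ℝ} (hτ : 0 ≤ τ) (hK : 0 < K) (hα : ∀ n ≠ 0, K ≤ |alpha M k θ n|)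
    (hq₀ : ∀ x ∈ (univ ×ˢ Ioo M.b M.d : Set (ℝ × ℝ)), ‖M.q₀ x‖ ≤ B₀)
    (hCP : CP = 1 / K ^ 2 + 2 * (M.d - M.b) ^ 2) (hsmall : 4 * (k ^ 2 * B₀ * CP) ≤ 1)
    (hup : ∀ n ≠ 0, 0 ≤ ((1 + Complex.I * τ) * -upMultiplier M k θ n).re)
    (hup₀ : (M.d - M.b) / CP ≤ ((1 + Complex.I * τ) * -upMultiplier M k θ 0).re)
    (hdown : ∀ n, 0 ≤ ((1 + Complex.I * τ) * -downMultiplier M U n).re) :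
    ∃ δ : ℝ, 0 < δ ∧ ∀ x, δ * ‖x‖ ^ 2 ≤ ((1 + Complex.I * τ) * B x x).re := by
  have hp := M.p_pos
  have hL : 0 < M.d - M.b := sub_pos.2 M.b_lt_d
  have hCP0 : 0 < CP := by rw [hCP]; positivity
  set c : ℂ := 1 + Complex.I * τ with hc
  refine ⟨min (1 / 2) (1 / (4 * CP)), by positivity, fun x => ?_⟩
  -- All terms of the upward series are nonnegative after rotation, so it suffices to keep the one
  -- with `n = 0`.
  have b1 : M.p * ((M.d - M.b) / CP * ‖endFunctional M.b 0 x‖ ^ 2) ≤ (c * -S₁ x x).re := by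
    have h := hasSum_re_multiplierForm c (h₁ x x)
    refine le_trans ?_ (le_hasSum h 0 fun n hn => ?_)
    · gcongr
    · have := hup n hn; positivity
  have b2 : 0 ≤ (c * -S₂ x x).re :=
    (hasSum_re_multiplierForm c (h₂ x x)).nonneg fun n => by have := hdown n; positivity
  have hQ := re_rotated_volume_le hτ hq₀ (comp 0 x)
  rw [← hc] at hQ
  have hP := (isSobolevTriple_comp x).poincare hK hα
  rw [← hCP, ← endFunctional_apply] at hP
  rw [hB, volume_integral_self hq₀, norm_sq_eq, norm_sq_cellL2, norm_sq_cellL2, norm_sq_cellL2]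
  set N0 := ∫ z in cell M, ‖comp 0 x z‖ ^ 2
  set N1 := ∫ z in cell M, ‖comp 1 x z‖ ^ 2
  set N2 := ∫ z in cell M, ‖comp 2 x z‖ ^ 2
  set J := ∫ z in cell M, M.q₀ z * ((‖comp 0 x z‖ ^ 2 : ℝ) : ℂ)
  set E := ‖endFunctional M.b 0 x‖ ^ 2
  have hN0 : 0 ≤ N0 := integral_nonneg fun _ => by positivity
  have hN1 : 0 ≤ N1 := integral_nonneg fun _ => by positivity
  have hN2 : 0 ≤ N2 := integral_nonneg fun _ => by positivity
  have hsplit : (c * ((N1 : ℂ) + (N2 : ℂ) - (k : ℂ) ^ 2 * J - S₁ x x - S₂ x x)).re =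
      N1 + N2 - k ^ 2 * (c * J).re + (c * -S₁ x x).re + (c * -S₂ x x).re := by
    have : c * ((N1 : ℂ) + (N2 : ℂ) - (k : ℂ) ^ 2 * J - S₁ x x - S₂ x x) =
      c * ((N1 + N2 : ℝ) : ℂ) - ((k ^ 2 : ℝ) : ℂ) * (c * J) + c * -S₁ x x + c * -S₂ x x := by
      push_cast; ring
    rw [this, Complex.add_re, Complex.add_re, Complex.sub_re, Complex.re_mul_ofReal,
      Complex.re_ofReal_mul]
    have : c.re = 1 := by simp [hc]
    rw [this]; ring
  rw [hsplit]
  have h7 : k ^ 2 * (c * J).re ≤ k ^ 2 * (B₀ * N0) := by gcongr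
  have h8 : k ^ 2 * (B₀ * N0) ≤ 1 / (4 * CP) * N0 := by
    have : k ^ 2 * B₀ ≤ 1 / (4 * CP) := by
      rw [le_div_iff₀ (by positivity)]; linarith
    calc _ = k ^ 2 * B₀ * N0 := by ring
      _ ≤ _ := by gcongr
  -- Poincaré divided by `2 CP`: half of the gradient together with the zeroth boundary term pays
  -- for `N0 / (2 CP)`. The lower bound `(d - b)/CP` in `hup₀` is exactly the coefficient needed.
  -- One half of the gain absorbs the `q₀` term, the other half remains.
  have h9 : 1 / (2 * CP) * N0 ≤ 1 / 2 * (N1 + N2) + M.p * ((M.d - M.b) / CP * E) := by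
    have := mul_le_mul_of_nonneg_left hP (show 0 ≤ 1 / (2 * CP) by positivity)
    refine this.trans (le_of_eq ?_)
    field_simp
  have h10 : min (1 / 2) (1 / (4 * CP)) * (N0 + N1 + N2) ≤
      1 / (4 * CP) * N0 + 1 / 2 * (N1 + N2) := by
    have a1 : min (1 / 2) (1 / (4 * CP)) * N0 ≤ 1 / (4 * CP) * N0 := by
      gcongr; exact min_le_right _ _
    have a2 : min (1 / 2) (1 / (4 * CP)) * (N1 + N2) ≤ 1 / 2 * (N1 + N2) := by
      gcongr; exact min_le_left _ _
    linarith
  have h11 : 1 / (2 * CP) * N0 = 1 / (4 * CP) * N0 + 1 / (4 * CP) * N0 := by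
    field_simp; ring
  linarith

end Form

/-! ### Modes at small wave numbers -/

section Modes

variable {M : Medium} {k θ : ℝ}

lemma alpha_zero : alpha M k θ 0 = k * Real.sin θ := by simp [alpha]

lemma le_abs_alpha (hk : 0 ≤ k) {n : ℤ} (hn : n ≠ 0) :
    2 * Real.pi / M.p - k ≤ |alpha M k θ n| := by
  have h1 : (1 : ℝ) ≤ |(n : ℝ)| := by exact_mod_cast Int.one_le_abs hn
  have h2 : |k * Real.sin θ| ≤ k := by
    rw [abs_mul, abs_of_nonneg hk]
    exact mul_le_of_le_one_right hk (Real.abs_sin_le_one θ)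
  have hw : 0 < 2 * Real.pi / M.p := div_pos Real.two_pi_pos M.p_pos
  have h3 : 2 * Real.pi / M.p ≤ |2 * Real.pi / M.p * n| := by
    rw [abs_mul, abs_of_pos hw]
    exact le_mul_of_one_le_right hw.le h1
  have h4 := abs_sub_abs_le_abs_add (2 * Real.pi / M.p * n) (k * Real.sin θ)
  rw [alpha, add_comm]
  linarith

lemma beta_zero (hk : 0 ≤ k) (hc : 0 ≤ Real.cos θ) : beta M k θ 0 = ((k * Real.cos θ : ℝ) : ℂ) := by
  have h1 : k ^ 2 - alpha M k θ 0 ^ 2 = (k * Real.cos θ) ^ 2 := by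
    rw [alpha_zero, mul_pow, mul_pow, Real.cos_sq']; ring
  have h2 : alpha M k θ 0 ^ 2 ≤ k ^ 2 := by
    have := sq_nonneg (k * Real.cos θ); linarith
  rw [beta, if_pos h2, h1, Real.sqrt_sq (by positivity)]

lemma upMultiplier_of_lt {n : ℤ} (hk : 0 ≤ k) (h : k < |alpha M k θ n|) :
    upMultiplier M k θ n = ((-Real.sqrt (alpha M k θ n ^ 2 - k ^ 2) : ℝ) : ℂ) := by
  have h1 : ¬ alpha M k θ n ^ 2 ≤ k ^ 2 := by
    rw [not_le, ← sq_abs (alpha M k θ n)]; gcongr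
  rw [upMultiplier, beta, if_neg h1, ← mul_assoc, Complex.I_mul_I]
  push_cast; ring

lemma aestronglyMeasurable_hillPotential (n : ℤ) :
    AEStronglyMeasurable (hillPotential M k θ n) volume :=
  (M.q_meas.const_mul _).sub aestronglyMeasurable_const

lemma periodic_hillPotential (n : ℤ) :
    Function.Periodic (hillPotential M k θ n) (2 * Real.pi) := fun t => by
  rw [hillPotential, hillPotential, M.q_periodic]

/-- The potential equals `k² (q - sin² θ)`, and periodicity moves any `t` into the period below `b`
on which the hypothesis is given. -/
lemma hillPotential_zero_pos (hk : 0 < k)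
    (hθ : ∀ t ∈ Ioc (M.b - 2 * Real.pi) M.b, Real.sin θ ^ 2 < M.q t) (t : ℝ) :
    0 < hillPotential M k θ 0 t := by
  obtain ⟨s, hs, hts⟩ := M.q_periodic.exists_mem_Ioc Real.two_pi_pos t (M.b - 2 * Real.pi)
  rw [sub_add_cancel] at hs
  have := mul_pos (pow_pos hk 2) (sub_pos.2 (hθ s hs))
  rw [hillPotential, alpha_zero, hts]
  linarith

/-- The condition `k² B < K²` makes every potential with `n ≠ 0` uniformly negative, and `0 < α_n² -
k² q ≤ α_n²` allows `κ = |α_n|`. The potential with `n = 0` falls under `downwardMode_of_small`;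
passing from the logarithmic derivative to the multiplier flips the sign of its imaginary part. -/
lemma exists_downwardModeFamily {B K : ℝ} (hk : 0 < k) (hK : 0 < K) (hB : ∀ t, M.q t ≤ B)
    (hα : ∀ n ≠ 0, K ≤ |alpha M k θ n|) (hs : 12 * Real.pi ^ 2 * (k ^ 2 * B) ≤ 1)
    (hsK : k ^ 2 * B < K ^ 2)
    (hθ : ∀ t ∈ Ioc (M.b - 2 * Real.pi) M.b, Real.sin θ ^ 2 < M.q t) :
    (∃ U, IsDownwardModeFamily M k θ U) ∧ ∀ U, IsDownwardModeFamily M k θ U →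
      (∀ n, U n M.b ≠ 0) ∧
      (∀ n ≠ 0, ∃ r : ℝ, 0 ≤ r ∧ r ≤ |alpha M k θ n| ∧ downMultiplier M U n = ((-r : ℝ) : ℂ)) ∧
      0 < (downMultiplier M U 0).im := by
  have hq : ∀ t, 0 < k ^ 2 * M.q t ∧ k ^ 2 * M.q t ≤ k ^ 2 * B := fun t =>
    ⟨mul_pos (pow_pos hk 2) (M.q_pos t), by gcongr; exact hB t⟩
  have h0 := downwardMode_of_small (V := hillPotential M k θ 0) (m := k ^ 2 * B)
    (aestronglyMeasurable_hillPotential 0) (fun t => by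
      rw [abs_of_pos (hillPotential_zero_pos hk hθ t), hillPotential]
      have := sq_nonneg (alpha M k θ 0)
      linarith [(hq t).2]) (periodic_hillPotential 0) hs (hillPotential_zero_pos hk hθ)
  have h1 : ∀ n ≠ 0, (∃ U, IsDownwardMode (hillPotential M k θ n) U) ∧
      ∀ U, IsDownwardMode (hillPotential M k θ n) U → ∀ t, U t ≠ 0 ∧
        ∃ r : ℝ, 0 ≤ r ∧ r ≤ |alpha M k θ n| ∧ deriv U t / U t = r := fun n hn => by
    have hKα : K ^ 2 ≤ alpha M k θ n ^ 2 := by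
      rw [← sq_abs (alpha M k θ n)]
      have := hα n hn
      gcongr
    refine downwardMode_of_neg (m := alpha M k θ n ^ 2) (c := K ^ 2 - k ^ 2 * B)
      (aestronglyMeasurable_hillPotential n) (fun t => ?_) (periodic_hillPotential n)
      (sub_pos.2 hsK) (fun t => ?_) (abs_nonneg _) (fun t => ?_)
    · have := hq t
      rw [hillPotential, abs_le]
      constructor <;> linarith
    · have := hq t
      rw [hillPotential]; linarith
    · have := hq t
      rw [hillPotential, sq_abs]; linarith
  refine ⟨?_, fun U hU => ⟨fun n => ?_, fun n hn => ?_, ?_⟩⟩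
  · have : ∀ n, ∃ U, IsDownwardMode (hillPotential M k θ n) U := fun n => by
      rcases eq_or_ne n 0 with rfl | hn
      · exact h0.1
      · exact (h1 n hn).1
    choose U hU using this
    exact ⟨U, hU⟩
  · rcases eq_or_ne n 0 with rfl | hn
    · exact (h0.2 _ (hU 0) M.b).1
    · exact ((h1 n hn).2 _ (hU n) M.b).1
  · obtain ⟨-, r, hr0, hr, e⟩ := (h1 n hn).2 _ (hU n) M.b
    exact ⟨r, hr0, hr, by rw [downMultiplier, e, Complex.ofReal_neg]⟩
  · rw [downMultiplier, Complex.neg_im]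
    exact neg_pos.2 (h0.2 _ (hU 0) M.b).2

end Modes

/-! ### The variational problem -/

section Solve

variable {M : Medium} {k θ : ℝ}

lemma exists_inner_eq {H : Type*} [NormedAddCommGroup H] [InnerProductSpace ℂ H] [CompleteSpace H]
    (L : H →L[ℂ] ℂ) (c : ℂ) : ∃ f : H, ∀ v, inner ℂ v f = c * conj (L v) :=
  ⟨c • (InnerProductSpace.toDual ℂ H).symm L, fun v => by
    rw [inner_smul_right, ← inner_conj_symm, InnerProductSpace.toDual_symm_apply]⟩

/-- Well-posedness of the variational problem for a form that becomes coercive after a rotation. -/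
lemma existsUnique_variationalSolution {U : ℤ → ℝ → ℂ}
    {B : sobolevSpace M k θ →L⋆[ℂ] sobolevSpace M k θ →L[ℂ] ℂ}
    (hB : ∀ u v (hu : MemH1 M (alpha M k θ 0) u) (hv : MemH1 M (alpha M k θ 0) v),
      form M k θ U u v = B hv.isSobolevTriple.toSpace hu.isSobolevTriple.toSpace)
    {c : ℂ} {δ : ℝ} (hδ : 0 < δ) (hco : ∀ x, δ * ‖x‖ ^ 2 ≤ (c * B x x).re) :
    (∃ u, IsVariationalSolution M k θ U u) ∧
      ∀ u u', IsVariationalSolution M k θ U u → IsVariationalSolution M k θ U u' →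
        u =ᵐ[volume.restrict (cell M)] u' := by
  set c₀ : ℂ := -(2 * Complex.I * ((k * Real.cos θ : ℝ) : ℂ)
      * Complex.exp (-(Complex.I * ((k * Real.cos θ : ℝ) : ℂ) * M.d)) * M.p) with hc₀
  obtain ⟨f, hf⟩ := exists_inner_eq (endFunctional (M := M) (k := k) (θ := θ) M.b 0) c₀
  have hrhs : ∀ v (hv : MemH1 M (alpha M k θ 0) v),
      rhs M k θ v = inner ℂ hv.isSobolevTriple.toSpace f := fun v hv => by
    rw [rhs_eq hv, ← hc₀, hf]
  obtain ⟨x, hx, hx'⟩ := exists_unique_of_coercive B c hδ hco f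
  have huniq : ∀ u (hu : IsVariationalSolution M k θ U u), hu.1.isSobolevTriple.toSpace = x :=
    -- Every `v` in the Hilbert space comes from an `H¹` function, so the variational equation
    -- supplies all the tests that uniqueness of `x` requires.
    fun u hu => hx' _ fun v => by
      obtain ⟨w, hw, rfl⟩ := exists_memH1 v
      rw [← hB _ _ hu.1 hw, hu.2 w hw, hrhs w hw]
  refine ⟨?_, fun u u' hu hu' => ?_⟩
  · obtain ⟨u, hu, rfl⟩ := exists_memH1 x
    exact ⟨u, hu, fun v hv => by rw [hB u v hu hv, hx, hrhs v hv]⟩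
  · have h := congrArg (comp 0) ((huniq u hu).trans (huniq u' hu').symm)
    rw [IsSobolevTriple.comp_zero_toSpace, IsSobolevTriple.comp_zero_toSpace] at h
    exact (MemLp.toLp_eq_toLp_iff _ _).1 h

/-- `K = π/p` is half the spacing of the `α_n`: for `k < K` and `n ≠ 0` one has `|α_n| ≥ 2K - k ≥ K
> k`, so all these modes are evanescent in the cover. What remains is to choose `τ` for the mode `n
= 0`. -/
lemma solvability {B B₀ K CP : ℝ} (hk : 0 < k) (hθ0 : θ ∈ Ioo (-(Real.pi / 2)) (Real.pi / 2))
    (hkK : k < K) (hK : K = Real.pi / M.p)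
    (hB : ∀ t, M.q t ≤ B) (hB₀ : ∀ x ∈ (univ ×ˢ Ioo M.b M.d : Set (ℝ × ℝ)), ‖M.q₀ x‖ ≤ B₀)
    (hCP : CP = 1 / K ^ 2 + 2 * (M.d - M.b) ^ 2)
    (hs : 12 * Real.pi ^ 2 * (k ^ 2 * B) ≤ 1) (hsK : k ^ 2 * B < K ^ 2)
    (hsP : 4 * (k ^ 2 * B₀ * CP) ≤ 1)
    (hθ : ∀ t ∈ Ioc (M.b - 2 * Real.pi) M.b, Real.sin θ ^ 2 < M.q t) :
    (∃ U, IsDownwardModeFamily M k θ U) ∧ ∀ U, IsDownwardModeFamily M k θ U →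
      (∀ n, U n M.b ≠ 0) ∧
      (∀ u v, MemH1 M (alpha M k θ 0) u → MemH1 M (alpha M k θ 0) v →
        Summable (pairingTerm M k θ (upMultiplier M k θ) (topTrace M u) (topTrace M v)) ∧
        Summable (pairingTerm M k θ (downMultiplier M U) (bottomTrace M u) (bottomTrace M v))) ∧
      (∃ u, IsVariationalSolution M k θ U u) ∧
      ∀ u u', IsVariationalSolution M k θ U u → IsVariationalSolution M k θ U u' →
        u =ᵐ[volume.restrict (cell M)] u' := by
  have hK0 : 0 < K := hk.trans hkK
  have hL : 0 < M.d - M.b := sub_pos.2 M.b_lt_d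
  have hCP0 : 0 < CP := by rw [hCP]; positivity
  have hα : ∀ n ≠ 0, K ≤ |alpha M k θ n| := fun n hn => by
    have := le_abs_alpha (M := M) (θ := θ) hk.le hn
    rw [mul_div_assoc, ← hK] at this
    linarith
  obtain ⟨hex, hall⟩ := exists_downwardModeFamily hk hK0 hB hα hs hsK hθ
  refine ⟨hex, fun U hU => ?_⟩
  obtain ⟨hb, hdn, hd0⟩ := hall U hU
  have hcos : 0 < Real.cos θ := Real.cos_pos_of_mem_Ioo hθ0
  have hβ : 0 < k * Real.cos θ := mul_pos hk hcos
  have hu0 : upMultiplier M k θ 0 = Complex.I * ((k * Real.cos θ : ℝ) : ℂ) := by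
    rw [upMultiplier, beta_zero hk.le hcos.le]
  have hun : ∀ n ≠ 0, upMultiplier M k θ n = ((-Real.sqrt (alpha M k θ n ^ 2 - k ^ 2) : ℝ) : ℂ) :=
    fun n hn => upMultiplier_of_lt hk.le (hkK.trans_le (hα n hn))
  set s := downMultiplier M U 0 with hsdef
  -- One constant for both multipliers: `k` covers the propagating upward mode, `1` the evanescent
  -- modes, and `‖s‖` the zeroth downward mode, for which no explicit bound is available.
  have hC1 : 0 ≤ k + 1 + ‖s‖ := by positivity
  have hup : ∀ n, ‖upMultiplier M k θ n‖ ≤ (k + 1 + ‖s‖) * (|alpha M k θ n| + 1) := fun n => by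
    have ha := abs_nonneg (alpha M k θ n)
    have hns := norm_nonneg s
    rcases eq_or_ne n 0 with rfl | hn
    · rw [hu0, norm_mul, Complex.norm_I, one_mul, Complex.norm_real, Real.norm_of_nonneg hβ.le]
      have h1 : k * Real.cos θ ≤ k := mul_le_of_le_one_right hk.le (Real.cos_le_one θ)
      nlinarith
    · rw [hun n hn, Complex.norm_real, norm_neg, Real.norm_of_nonneg (Real.sqrt_nonneg _)]
      have h1 : Real.sqrt (alpha M k θ n ^ 2 - k ^ 2) ≤ |alpha M k θ n| := by
        rw [← Real.sqrt_sq_eq_abs]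
        exact Real.sqrt_le_sqrt (sub_le_self _ (sq_nonneg k))
      nlinarith
  have hdown : ∀ n, ‖downMultiplier M U n‖ ≤ (k + 1 + ‖s‖) * (|alpha M k θ n| + 1) := fun n => by
    have ha := abs_nonneg (alpha M k θ n)
    have hns := norm_nonneg s
    rcases eq_or_ne n 0 with rfl | hn
    · rw [← hsdef]; nlinarith
    · obtain ⟨r, hr0, hr, e⟩ := hdn n hn
      rw [e, Complex.norm_real, norm_neg, Real.norm_of_nonneg hr0]
      nlinarith
  obtain ⟨A, S₁, S₂, hA, h₁, h₂, hform⟩ := exists_form hC1 hup hdown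
  -- The first entry gives `τ k cos θ ≥ (d - b)/CP`, the upward bound Poincaré asks for. The second
  -- gives `τ Im s ≥ |Re s|`, which offsets the unknown sign of `Re s`.
  set τ := max ((M.d - M.b) / CP / (k * Real.cos θ)) (|s.re| / s.im) with hτ
  have hτ0 : 0 ≤ τ := le_max_of_le_left (by positivity)
  have hrot : ∀ r : ℝ, ((1 + Complex.I * τ) * -((-r : ℝ) : ℂ)).re = r := fun r => by
    simp [Complex.mul_re]
  obtain ⟨δ, hδ, hco⟩ := coercive_form (U := U) hA h₁ h₂ hτ0 hK0 hα hB₀ hCP hsP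
    (fun n hn => by rw [hun n hn, hrot]; exact Real.sqrt_nonneg _)
    (by
      have h1 : ∀ r : ℝ, ((1 + Complex.I * τ) * -(Complex.I * r)).re = τ * r := fun r => by
        simp [Complex.mul_re, Complex.mul_im]
      rw [hu0, h1, ← div_le_iff₀ hβ]
      exact le_max_left _ _)
    (fun n => by
      rcases eq_or_ne n 0 with rfl | hn
      · have h1 : ((1 + Complex.I * τ) * -s).re = -s.re + τ * s.im := by
          simp [Complex.mul_re]; ring
        rw [← hsdef, h1]
        have h2 : |s.re| / s.im ≤ τ := le_max_right _ _
        rw [div_le_iff₀ hd0] at h2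
        linarith [le_abs_self s.re]
      · obtain ⟨r, hr0, -, e⟩ := hdn n hn
        rw [e, hrot]; exact hr0)
  exact ⟨hb, fun u v hu hv => ⟨(hform u v hu hv).1, (hform u v hu hv).2.1⟩,
    existsUnique_variationalSolution (fun u v hu hv => (hform u v hu hv).2.2) hδ hco⟩

end Solve

end Grating

end

theorem mainTheorem2 (M : Grating.Medium) :
    ∃ k₀ : ℝ, 0 < k₀ ∧
      ∀ θ ∈ Set.Ioo (-(Real.pi / 2)) (Real.pi / 2),
        (∀ t ∈ Set.Ioc (M.b - 2 * Real.pi) M.b, Real.sin θ ^ 2 < M.q t) →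
        ∀ k ∈ Set.Ioo 0 k₀,
          -- the downward DtN map is well defined
          (∃ U, Grating.IsDownwardModeFamily M k θ U) ∧
          ∀ U, Grating.IsDownwardModeFamily M k θ U →
            (∀ n, U n M.b ≠ 0) ∧
            -- the boundary terms of the sesquilinear form converge
            (∀ u v, Grating.MemH1 M (Grating.alpha M k θ 0) u →
              Grating.MemH1 M (Grating.alpha M k θ 0) v →
                Summable (Grating.pairingTerm M k θ (Grating.upMultiplier M k θ)
                  (Grating.topTrace M u) (Grating.topTrace M v)) ∧
                Summable (Grating.pairingTerm M k θ (Grating.downMultiplier M U)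
                  (Grating.bottomTrace M u) (Grating.bottomTrace M v))) ∧
            -- existence, and uniqueness up to null sets
            (∃ u, Grating.IsVariationalSolution M k θ U u) ∧
            ∀ u u', Grating.IsVariationalSolution M k θ U u →
              Grating.IsVariationalSolution M k θ U u' →
                u =ᵐ[MeasureTheory.volume.restrict (Grating.cell M)] u' := by
  obtain ⟨B, hB⟩ := M.q_bounded
  obtain ⟨B₀', hB₀'⟩ := M.q₀_bounded
  -- A pointwise bound over the strip, made visibly nonnegative so that `k₀` below is positive.
  set B₀ := max B₀' 0
  have hB₀ : ∀ x ∈ (univ ×ˢ Ioo M.b M.d : Set (ℝ × ℝ)), ‖M.q₀ x‖ ≤ B₀ := fun x hx =>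
    (hB₀' x hx).trans (le_max_left _ _)
  have hB0 : 0 ≤ B₀ := le_max_right _ _
  have hBpos : 0 < B := (M.q_pos 0).trans_le (hB 0)
  set K := Real.pi / M.p with hK
  have hK0 : 0 < K := div_pos Real.pi_pos M.p_pos
  set CP := 1 / K ^ 2 + 2 * (M.d - M.b) ^ 2 with hCP
  have hCP0 : 0 < CP := by positivity
  -- Each summand carries one smallness condition, so `k < 1/D` yields all of them. The summand `1`
  -- gives `k < 1`, hence `k² ≤ k`, and reduces the quadratic conditions to linear ones. No summand
  -- involves `θ`.
  set D := 1 + 12 * Real.pi ^ 2 * B + B / K ^ 2 + 4 * (B₀ * CP) + 1 / K with hD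
  have t1 : 0 ≤ 12 * Real.pi ^ 2 * B := by positivity
  have t2 : 0 ≤ B / K ^ 2 := by positivity
  have t3 : 0 ≤ 4 * (B₀ * CP) := by positivity
  have t4 : 0 ≤ 1 / K := by positivity
  have hD0 : 0 < D := by positivity
  refine ⟨1 / D, by positivity, fun θ hθ0 hθ k hk => ?_⟩
  have hkD : k * D < 1 := (lt_div_iff₀ hD0).1 hk.2
  have key : ∀ t, t ≤ D → k * t < 1 := fun t ht =>
    (mul_le_mul_of_nonneg_left ht hk.1.le).trans_lt hkD
  have hk1 : k < 1 := by simpa using key 1 (by linarith)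
  have hk2 : k ^ 2 ≤ k := by nlinarith [hk.1]
  have key2 : ∀ t, 0 ≤ t → t ≤ D → k ^ 2 * t < 1 := fun t h0 ht =>
    (mul_le_mul_of_nonneg_right hk2 h0).trans_lt (key t ht)
  refine Grating.solvability hk.1 hθ0 ?_ hK hB hB₀ hCP ?_ ?_ ?_ hθ
  · have := key (1 / K) (by linarith)
    rwa [mul_one_div, div_lt_one hK0] at this
  · have := key2 _ t1 (by linarith)
    linarith
  · have := key2 _ t2 (by linarith)
    rwa [← mul_div_assoc, div_lt_one (by positivity)] at this
  · have := key2 _ t3 (by linarith)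
    linarith
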